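/- Let $\mathbb F$ be a field of characteristic $p>3$, let $n\ge 3$ be an integer and let $\underline t=(t_1,\dots,t_n)$ be an $n$-tuple of positive integers. Put $Y_0=\{1,\dots,n\}$, $Y_1=\{n+1,\dots,2n\}$, $Y=Y_0\cup Y_1$; for $i\in Y$ let $\mu(i)=\bar 0$ if $i\in Y_0$ and $\mu(i)=\bar 1$ if $i\in Y_1$, and let $i'=i+n$ if $i\in Y_0$ and $i'=i-n$ if $i\in Y_1$. Let $\mathcal O(n,n)=\mathcal O(n)\otimes\Lambda(n)$ be the tensor product of the divided power algebra $\mathcal O(n)$, with basis $x^{(\alpha)}$ ($\alpha\in\mathbb N_0^n$) and product $x^{(\alpha)}x^{(\beta)}=\binom{\alpha+\beta}{\alpha}x^{(\alpha+\beta)}$, and the exterior algebra $\Lambda(n)$ in the odd variables $x_{n+1},\dots,x_{2n}$. It has the basis $x^{(\alpha)}x^u$, where $u$ runs over the subsets of $Y_1$ and $x^u$ is the product of the $x_k$, $k\in u$, in increasing order; write $\mathrm p(a)\in\mathbb Z_2$ for the parity of a homogeneous element $a$. For $r\in Y_0$ let $\partial_r$ be the derivation $x^{(\alpha)}x^u\mapsto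 x^{(\alpha-\varepsilon_r)}x^u$ (zero if $\alpha_r=0$), and for $r\in Y_1$ let $\partial_r$ be the odd superderivation $x^{(\alpha)}x^u\mapsto x^{(\alpha)}\,\partial x^u/\partial x_r$. Let $\mathcal O(n,n;\underline t)$ be the subalgebra spanned by the $x^{(\alpha)}x^u$ with $\alpha_i\le p^{t_i}-1$ for all $i\in Y_0$, and let $$W(n,n;\underline t)=\Big\{\sum_{r\in Y}f_r\partial_r\ \Big|\ f_r\in\mathcal O(n,n;\underline t)\Big\}$$ be the generalized Witt superalgebra, where $f\partial_r$ has parity $\mathrm p(f)+\mu(r)$. Let $\mathrm{T_H}:\mathcal O(n,n;\underline t)\to W(n,n;\underline t)$ be the linear map with $\mathrm{T_H}(a)=\sum_{i\in Y}(-1)^{\mu(i)\mathrm p(a)}\partial_i(a)\partial_{i'}$ for homogeneous $a$, and let $HO(n,n;\underline t)=\mathrm{T_H}(\mathcal O(n,n;\underline t))$ be the odd Hamiltonian superalgebra. Let the Lie algebras $\mathcal W$ and $\mathcal{HO}\subseteq\mathcal W$ be the even parts of $W(n,n;\underline t)$ and $HO(n,n;\underline t)$. Let $\mathrm{Der}(\mathcal{HO},\mathcal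 W)$ be the space of all linear maps $D:\mathcal{HO}\to\mathcal W$ with $D([x,y])=[x,D(y)]-[y,D(x)]$ for all $x,y\in\mathcal{HO}$. For $w\in\mathcal W$ let $\mathrm{ad}\,w$ be the map $x\mapsto[w,x]$, and regard it and its powers as linear maps from $\mathcal{HO}$ to $\mathcal W$ by restriction. Then $$\mathrm{Der}(\mathcal{HO},\mathcal W)=\mathrm{ad}\,\mathcal W+\mathrm{span}_{\mathbb F}\big\{(\mathrm{ad}\,\partial_i)^{p^{k_i}}\ \big|\ i\in Y_0,\ 1\le k_i<t_i\big\}.$$ -/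

import Mathlib

namespace OddHamiltonian

attribute [local instance] LieRing.ofAssociativeRing

/-- The index set `Y = Y₀ ∪ Y₁`: `Sum.inl i` is `i ∈ Y₀ = {1, …, n}` and `Sum.inr i` is
`i' = n + i ∈ Y₁ = {n + 1, …, 2n}`. -/
abbrev Idx (n : ℕ) : Type := Fin n ⊕ Fin n

/-- The parity `μ(i)` of an index, as one of the integers `0`, `1`. -/
def mu {n : ℕ} : Idx n → ℕ
  | Sum.inl _ => 0
  | Sum.inr _ => 1

/-- The involution `i ↦ i'` exchanging `Y₀` and `Y₁`. -/
abbrev prime {n : ℕ} (i : Idx n) : Idx n := i.swap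

/-- The monomials `x^(α) x^u`: a multi-exponent `α` and a subset `u` of `Y₁`, the latter standing
for the increasing product of its variables. -/
abbrev Mono (n : ℕ) : Type := (Fin n → ℕ) × Finset (Fin n)

/-- The superalgebra `𝒪(n,n) = 𝒪(n) ⊗ Λ(n)`, the tensor product of the divided power algebra in
`n` variables and the exterior algebra in `n` variables, as the vector space with basis the
monomials `x^(α) x^u`. Its product is `mul`. -/
def O (F : Type*) [Field F] (n : ℕ) : Type _ := Mono n →₀ F

noncomputable instance (F : Type*) [Field F] (n : ℕ) : AddCommGroup (O F n) :=
  inferInstanceAs (AddCommGroup (Mono n →₀ F))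

noncomputable instance (F : Type*) [Field F] (n : ℕ) : Module F (O F n) :=
  inferInstanceAs (Module F (Mono n →₀ F))

variable (F : Type*) [Field F] {n : ℕ}

/-- The basis of monomials of `𝒪(n,n)`. -/
noncomputable def monoBasis (n : ℕ) : Module.Basis (Mono n) F (O F n) :=
  Finsupp.basisSingleOne

/-- The monomial `x^(α) x^u`. -/
noncomputable def mono (a : Mono n) : O F n := monoBasis F n a

/-- `∏ᵢ binom(αᵢ + βᵢ, αᵢ)`. -/
def binom (α β : Fin n → ℕ) : ℕ := ∏ i, (α i + β i).choose (α i)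

/-- The number of pairs `(k, l) ∈ u × v` with `l < k`; reordering `x^u x^v` into an increasing
product costs the sign `(-1) ^ inv u v`. -/
def inv (u v : Finset (Fin n)) : ℕ := ∑ k ∈ u, (v.filter (· < k)).card

/-- The product of two monomials. -/
noncomputable def mulMono (a b : Mono n) : O F n :=
  if Disjoint a.2 b.2 then
    ((-1) ^ inv a.2 b.2 * (binom a.1 b.1 : F)) • mono F (a.1 + b.1, a.2 ∪ b.2)
  else 0

/-- The product of `𝒪(n,n)`. -/
noncomputable def mul : O F n →ₗ[F] O F n →ₗ[F] O F n :=
  (monoBasis F n).constr F fun a => (monoBasis F n).constr F fun b => mulMono F a b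

/-- `∂_r` on monomials; for `r ∈ Y₁` it is the left derivative of the exterior algebra. -/
noncomputable def partialMono : Idx n → Mono n → O F n
  | Sum.inl i, (α, u) => if α i = 0 then 0 else mono F (α - Pi.single i 1, u)
  | Sum.inr k, (α, u) =>
      if k ∈ u then ((-1) ^ (u.filter (· < k)).card : F) • mono F (α, u.erase k) else 0

/-- The superderivation `∂_r` of `𝒪(n,n)`. -/
noncomputable def pd (r : Idx n) : Module.End F (O F n) :=
  (monoBasis F n).constr F (partialMono F r)

/-- The linear map `a ↦ (-1)^(μ(r) p(a)) a` (for homogeneous `a`). -/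
noncomputable def twist (r : Idx n) : Module.End F (O F n) :=
  (monoBasis F n).constr F fun a => ((-1) ^ (mu r * a.2.card) : F) • mono F a

/-- The homogeneous component of `𝒪(n,n)` of parity `θ`. -/
noncomputable def parityPart (θ : ZMod 2) : Submodule F (O F n) :=
  Submodule.span F (mono F '' {a : Mono n | (a.2.card : ZMod 2) = θ})

/-- The subspace `𝒪(n,n;t)` spanned by the `x^(α) x^u` with `αᵢ ≤ πᵢ = p ^ tᵢ - 1`. -/
noncomputable def trunc (p : ℕ) (t : Fin n → ℕ) : Submodule F (O F n) :=
  Submodule.span F (mono F '' {a : Mono n | ∀ i, a.1 i ≤ p ^ t i - 1})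

/-- The operator `∑_r f_r ∂_r` on `𝒪(n,n)`. -/
noncomputable def vectorField : (Idx n → O F n) →ₗ[F] Module.End F (O F n) :=
  ∑ r, (LinearMap.lcomp F (O F n) (pd F r)) ∘ₗ mul F ∘ₗ LinearMap.proj r

/-- `T_H(a) = ∑_i (-1)^(μ(i) p(a)) ∂_i(a) ∂_{i'}`, here indexed by `r = i'`. -/
noncomputable def TH : O F n →ₗ[F] Module.End F (O F n) :=
  vectorField F ∘ₗ LinearMap.pi fun r => pd F (prime r) ∘ₗ twist F (prime r)

/-- The component of parity `θ` of the generalized Witt superalgebra `W(n,n;t)`: all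
`∑_r f_r ∂_r` with `f_r ∈ 𝒪(n,n;t)` of parity `θ + μ(r)`. -/
noncomputable def wittPart (p : ℕ) (t : Fin n → ℕ) (θ : ZMod 2) : Submodule F (Module.End F (O F n)) :=
  (Submodule.pi Set.univ fun r => trunc F p t ⊓ parityPart F (θ + mu r)).map (vectorField F)

/-- The odd Hamiltonian superalgebra `HO(n,n;t) = T_H(𝒪(n,n;t))`. -/
noncomputable def hoSuper (p : ℕ) (t : Fin n → ℕ) : Submodule F (Module.End F (O F n)) :=
  (trunc F p t).map (TH F)

section

variable {F}

theorem mono_induction {P : O F n → Prop} (hadd : ∀ f g, P f → P g → P (f + g))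
    (hsmul : ∀ (c : F) f, P f → P (c • f)) (hmono : ∀ a, P (mono F a)) (f : O F n) : P f := by
  refine Submodule.span_induction (p := fun f _ => P f) ?_ ?_ (fun f g _ _ => hadd f g)
    (fun c f _ => hsmul c f) ((monoBasis F n).mem_span f)
  · rintro _ ⟨a, rfl⟩; exact hmono a
  · simpa using hsmul 0 _ (hmono (0, ∅))

@[simp] theorem mul_mono (a b : Mono n) : mul F (mono F a) (mono F b) = mulMono F a b := by
  simp [mul, mono]

@[simp] theorem pd_mono (r : Idx n) (a : Mono n) : pd F r (mono F a) = partialMono F r a := by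
  simp [pd, mono]

@[simp] theorem twist_mono (r : Idx n) (a : Mono n) :
    twist F r (mono F a) = ((-1) ^ (mu r * a.2.card) : F) • mono F a := by
  simp [twist, mono]

theorem inv_union_left {u v w : Finset (Fin n)} (h : Disjoint u v) :
    inv (u ∪ v) w = inv u w + inv v w := Finset.sum_union h

theorem inv_union_right {u v w : Finset (Fin n)} (h : Disjoint v w) :
    inv u (v ∪ w) = inv u v + inv u w := by
  simp only [inv, ← Finset.sum_add_distrib]
  refine Finset.sum_congr rfl fun k _ => ?_
  rw [Finset.filter_union, Finset.card_union_of_disjoint (Finset.disjoint_filter_filter h)]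

theorem binom_assoc (α β γ : Fin n → ℕ) :
    binom α β * binom (α + β) γ = binom β γ * binom α (β + γ) := by
  simp only [binom, ← Finset.prod_mul_distrib]
  refine Finset.prod_congr rfl fun i _ => ?_
  have h := Nat.add_choose_mul_factorial_mul_factorial (β i) (α i)
  have h2 := Nat.add_choose_mul_factorial_mul_factorial (γ i) (α i + β i)
  have h3 := Nat.add_choose_mul_factorial_mul_factorial (γ i) (β i)
  have h4 := Nat.add_choose_mul_factorial_mul_factorial (β i + γ i) (α i)
  rw [add_comm (β i)] at h
  rw [add_comm (γ i)] at h2 h3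
  rw [add_comm _ (α i), ← add_assoc] at h4
  have : 0 < (α i).factorial * (β i).factorial * (γ i).factorial := by positivity
  apply Nat.eq_of_mul_eq_mul_right this
  simp only [Pi.add_apply, ← add_assoc]
  rw [← h] at h2
  rw [← h3] at h4
  linear_combination h2 - h4

theorem mulMono_of_disjoint {a b : Mono n} (h : Disjoint a.2 b.2) : mulMono F a b =
    ((-1) ^ inv a.2 b.2 * (binom a.1 b.1 : F)) • mono F (a.1 + b.1, a.2 ∪ b.2) := if_pos h

theorem mulMono_pair {u v : Finset (Fin n)} (h : Disjoint u v) (α β : Fin n → ℕ) :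
    mulMono F (α, u) (β, v) =
      ((-1) ^ inv u v * (binom α β : F)) • mono F (α + β, u ∪ v) := if_pos h

theorem mulMono_of_not_disjoint {a b : Mono n} (h : ¬ Disjoint a.2 b.2) : mulMono F a b = 0 :=
  if_neg h

theorem mul_assoc' (f g h : O F n) : mul F (mul F f g) h = mul F f (mul F g h) := by
  induction f using mono_induction with
  | hadd f₁ f₂ h₁ h₂ => simp only [map_add, LinearMap.add_apply, h₁, h₂]
  | hsmul c f h => simp only [map_smul, LinearMap.smul_apply, h]
  | hmono a =>
  induction g using mono_induction with
  | hadd f₁ f₂ h₁ h₂ => simp only [map_add, LinearMap.add_apply, h₁, h₂]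
  | hsmul c f h => simp only [map_smul, LinearMap.smul_apply, h]
  | hmono b =>
  induction h using mono_induction with
  | hadd f₁ f₂ h₁ h₂ => simp only [map_add, h₁, h₂]
  | hsmul c f h => simp only [map_smul, h]
  | hmono c =>
  by_cases hab : Disjoint a.2 b.2
  · by_cases hbc : Disjoint b.2 c.2
    · rw [mul_mono, mul_mono, mulMono_of_disjoint hab, mulMono_of_disjoint hbc]
      simp only [map_smul, LinearMap.smul_apply, mul_mono]
      by_cases hac : Disjoint a.2 c.2
      · rw [mulMono_of_disjoint (by simp [hbc, hac]), mulMono_of_disjoint (by simp [hab, hac])]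
        simp only [smul_smul, add_assoc, Finset.union_assoc]
        rw [inv_union_left hab, inv_union_right hbc]
        congr 1
        have := congrArg (Nat.cast (R := F)) (binom_assoc a.1 b.1 c.1)
        push_cast at this
        simp only [pow_add]
        linear_combination (-1) ^ inv a.2 b.2 * (-1) ^ inv b.2 c.2 * (-1) ^ inv a.2 c.2 * this
      · rw [mulMono_of_not_disjoint (by simp [hac]), mulMono_of_not_disjoint (by simp [hac])]
        simp
    · rw [mul_mono, mul_mono, mulMono_of_disjoint hab, mulMono_of_not_disjoint hbc]
      simp only [map_smul, LinearMap.smul_apply, mul_mono]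
      rw [mulMono_of_not_disjoint (by simp [hbc])]
      simp
  · rw [mul_mono, mul_mono, mulMono_of_not_disjoint hab]
    by_cases hbc : Disjoint b.2 c.2
    · rw [mulMono_of_disjoint hbc]
      simp only [map_smul, mul_mono]
      rw [mulMono_of_not_disjoint (by simp [hab])]
      simp
    · rw [mulMono_of_not_disjoint hbc]
      simp

theorem inv_add_inv {u v : Finset (Fin n)} (h : Disjoint u v) :
    inv u v + inv v u = u.card * v.card := by
  have : inv v u = ∑ k ∈ u, (v.filter (k < ·)).card := by
    simp only [inv, Finset.card_filter]
    exact Finset.sum_comm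
  rw [this, inv, ← Finset.sum_add_distrib, ← smul_eq_mul, ← Finset.sum_const]
  refine Finset.sum_congr rfl fun k hk => ?_
  rw [← Finset.card_union_of_disjoint, ← Finset.filter_or]
  · congr 1
    refine Finset.filter_true_of_mem fun j hj => ?_
    exact lt_or_gt_of_ne fun e => Finset.disjoint_left.1 h hk (e ▸ hj)
  · rw [Finset.disjoint_filter]
    intro j _ h1
    exact h1.le.not_gt

theorem mulMono_comm (a b : Mono n) :
    mulMono F a b = ((-1) ^ (a.2.card * b.2.card) : F) • mulMono F b a := by
  by_cases h : Disjoint a.2 b.2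
  · rw [mulMono_of_disjoint h, mulMono_of_disjoint h.symm, ← inv_add_inv h, add_comm a.1,
      Finset.union_comm, smul_smul]
    have : binom a.1 b.1 = binom b.1 a.1 := by
      refine Finset.prod_congr rfl fun i _ => ?_
      rw [add_comm, Nat.choose_symm_add]
    rw [this, ← mul_assoc, ← pow_add]
    congr 2
    rw [add_assoc, pow_add, Even.neg_one_pow ⟨_, rfl⟩, mul_one]
  · rw [mulMono_of_not_disjoint h, mulMono_of_not_disjoint fun h' => h h'.symm, smul_zero]

theorem filter_lt_add_filter_gt {u : Finset (Fin n)} (k : Fin n) :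
    (u.filter (· < k)).card + (u.filter (k < ·)).card = (u.erase k).card := by
  rw [← Finset.card_union_of_disjoint, ← Finset.filter_or]
  · congr 1
    ext j
    simp [and_comm]
  · rw [Finset.disjoint_filter]
    intro j _ h1
    exact h1.le.not_gt

theorem inv_erase_left {u v : Finset (Fin n)} {k : Fin n} (h : k ∈ u) :
    inv u v = inv (u.erase k) v + (v.filter (· < k)).card := by
  rw [inv, inv, Finset.sum_erase_add _ _ h]

theorem inv_erase_right {u v : Finset (Fin n)} {k : Fin n} (h : k ∈ v) :
    inv u v = inv u (v.erase k) + (u.filter (k < ·)).card := by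
  have e : (u.filter (k < ·)).card = ∑ j ∈ u, if k < j then 1 else 0 := by
    rw [Finset.card_filter]
  rw [e, inv, inv, ← Finset.sum_add_distrib]
  refine Finset.sum_congr rfl fun j _ => ?_
  simp only [Finset.card_filter]
  rw [Finset.sum_erase_add _ _ h]

theorem binom_pd (α β : Fin n → ℕ) (i : Fin n) :
    (if (α + β) i = 0 then 0 else binom α β) =
      (if α i = 0 then 0 else binom (α - Pi.single i 1) β) +
      (if β i = 0 then 0 else binom α (β - Pi.single i 1)) := by
  have key : ∀ γ δ : Fin n → ℕ, (∀ j, j ≠ i → γ j = α j) → (∀ j, j ≠ i → δ j = β j) →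
      binom γ δ = (γ i + δ i).choose (γ i) *
        ∏ j ∈ Finset.univ.erase i, (α j + β j).choose (α j) := by
    intro γ δ h1 h2
    rw [binom, ← Finset.mul_prod_erase _ _ (Finset.mem_univ i)]
    congr 1
    refine Finset.prod_congr rfl fun j hj => ?_
    rw [h1 j (Finset.ne_of_mem_erase hj), h2 j (Finset.ne_of_mem_erase hj)]
  rw [key α β (fun _ _ => rfl) (fun _ _ => rfl),
    key (α - Pi.single i 1) β (fun j hj => by simp [hj]) (fun _ _ => rfl),
    key α (β - Pi.single i 1) (fun _ _ => rfl) (fun j hj => by simp [hj])]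
  simp only [Pi.add_apply, Pi.sub_apply, Pi.single_eq_same]
  have aux : ∀ a b R : ℕ, (if a + b = 0 then 0 else (a + b).choose a * R) =
      (if a = 0 then 0 else (a - 1 + b).choose (a - 1) * R) +
      (if b = 0 then 0 else (a + (b - 1)).choose a * R) := by
    intro a b R
    rcases a with _ | a <;> rcases b with _ | b <;> simp
    rw [← add_mul, show a + 1 + (b + 1) = (a + 1 + b) + 1 by ring, Nat.choose_succ_succ,
      show a + 1 + b = a + (b + 1) by ring]
  exact aux (α i) (β i) _

theorem leibMono_inl (i : Fin n) (a b : Mono n) :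
    pd F (Sum.inl i) (mulMono F a b) = mul F (partialMono F (Sum.inl i) a) (mono F b) +
      mul F (mono F a) (partialMono F (Sum.inl i) b) := by
  obtain ⟨α, u⟩ := a
  obtain ⟨β, v⟩ := b
  have hb := congrArg (Nat.cast (R := F)) (binom_pd α β i)
  have e1 : α i ≠ 0 → α - Pi.single i 1 + β = α + β - Pi.single i 1 := by
    intro h
    ext j
    by_cases hj : j = i
    · subst hj; simp; omega
    · simp [hj]
  have e2 : β i ≠ 0 → α + (β - Pi.single i 1) = α + β - Pi.single i 1 := by
    intro h
    ext j
    by_cases hj : j = i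
    · subst hj; simp; omega
    · simp [hj]
  by_cases h : Disjoint u v
  · rw [mulMono_of_disjoint h, map_smul, pd_mono]
    simp only [partialMono]
    by_cases ha : α i = 0 <;> by_cases hb' : β i = 0 <;>
      simp [ha, hb', mulMono_of_disjoint, h] at hb e1 e2 ⊢
    · rw [e2, hb]
    · rw [e1, hb]
    · rw [e1, e2, hb, ← add_smul, mul_add]
  · rw [mulMono_of_not_disjoint h]
    simp only [partialMono]
    split_ifs <;> simp [mulMono_of_not_disjoint, h]

theorem leibMono_inr (k : Fin n) (a b : Mono n) :
    pd F (Sum.inr k) (mulMono F a b) = mul F (partialMono F (Sum.inr k) a) (mono F b) +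
      ((-1) ^ a.2.card : F) • mul F (mono F a) (partialMono F (Sum.inr k) b) := by
  obtain ⟨α, u⟩ := a
  obtain ⟨β, v⟩ := b
  by_cases hu : k ∈ u <;> by_cases hv : k ∈ v
  · have h : ¬ Disjoint u v := Finset.not_disjoint_iff.2 ⟨k, hu, hv⟩
    rw [mulMono_of_not_disjoint h]
    simp only [partialMono, hu, hv, if_true, map_zero]
    by_cases h' : Disjoint (u.erase k) (v.erase k)
    · have h1 : Disjoint (u.erase k) v := by
        rw [Finset.disjoint_left] at h' ⊢
        intro j hj hjv
        exact h' hj (Finset.mem_erase.2 ⟨(Finset.mem_erase.1 hj).1, hjv⟩)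
      have h2 : Disjoint u (v.erase k) := by
        rw [Finset.disjoint_left] at h' ⊢
        intro j hj hjv
        exact h' (Finset.mem_erase.2 ⟨(Finset.mem_erase.1 hjv).1, hj⟩) hjv
      have e : u ∪ v.erase k = u.erase k ∪ v := by
        ext j; by_cases hj : j = k <;> simp [hj, hu, hv]
      simp only [map_smul, LinearMap.smul_apply, mul_mono, mulMono_pair h1, mulMono_pair h2, e,
        smul_smul, ← add_smul]
      symm
      convert zero_smul F _ using 2
      rw [inv_erase_left hu, inv_erase_right hv]
      have e3 : (u.erase k).filter (k < ·) = u.filter (k < ·) := by ext j; simp; grind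
      have e4 : (v.erase k).filter (· < k) = v.filter (· < k) := by ext j; simp; grind
      rw [e3, e4, ← Finset.card_erase_add_one hu, ← filter_lt_add_filter_gt k]
      simp only [pow_add, pow_one]
      have : ((-1 : F) ^ (v.filter (· < k)).card) * (-1 : F) ^ (v.filter (· < k)).card = 1 := by
        rw [← pow_add, Even.neg_one_pow ⟨_, rfl⟩]
      linear_combination (-(-1 : F) ^ (u.filter (· < k)).card * (-1 : F) ^ (u.filter (k < ·)).card *
        (-1) ^ inv (u.erase k) (v.erase k) * binom α β) * this
    · have h1 : ¬ Disjoint (u.erase k) v := fun hd => h' (hd.mono_right (Finset.erase_subset _ _))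
      have h2 : ¬ Disjoint u (v.erase k) := fun hd => h' (hd.mono_left (Finset.erase_subset _ _))
      simp [mulMono_of_not_disjoint, h1, h2]
  · have h1 : Disjoint (u.erase k) v ↔ Disjoint u v := by
      simp only [Finset.disjoint_left]; grind
    by_cases h : Disjoint u v
    · have e : (u ∪ v).erase k = u.erase k ∪ v := by
        ext j; by_cases hj : j = k <;> simp [hj, hv]
      simp only [partialMono, hu, hv, if_true, if_false, mul_mono, mulMono_pair h,
        mulMono_pair (h1.2 h), map_smul, pd_mono, Finset.mem_union, true_or, map_zero, smul_zero,
        add_zero, smul_smul, map_smul, LinearMap.smul_apply, e]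
      congr 1
      rw [inv_erase_left hu, Finset.filter_union,
        Finset.card_union_of_disjoint (Finset.disjoint_filter_filter h)]
      have : ((-1 : F) ^ (v.filter (· < k)).card) * (-1 : F) ^ (v.filter (· < k)).card = 1 := by
        rw [← pow_add, Even.neg_one_pow ⟨_, rfl⟩]
      simp only [pow_add]
      linear_combination ((-1 : F) ^ (u.filter (· < k)).card * (-1) ^ inv (u.erase k) v *
        binom α β) * this
    · simp [partialMono, hu, hv, mulMono_of_not_disjoint, h, h1]
  · have h1 : Disjoint u (v.erase k) ↔ Disjoint u v := by
      simp only [Finset.disjoint_left]; grind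
    by_cases h : Disjoint u v
    · have e : (u ∪ v).erase k = u ∪ v.erase k := by
        ext j; by_cases hj : j = k <;> simp [hj, hu]
      simp only [partialMono, hu, hv, if_true, if_false, mul_mono, mulMono_pair h,
        mulMono_pair (h1.2 h), map_smul, pd_mono, Finset.mem_union, or_true, map_zero,
        zero_add, smul_smul, map_smul, e, LinearMap.zero_apply]
      congr 1
      rw [inv_erase_right hv, Finset.filter_union,
        Finset.card_union_of_disjoint (Finset.disjoint_filter_filter h)]
      have hc : u.card = (u.filter (· < k)).card + (u.filter (k < ·)).card := by
        rw [filter_lt_add_filter_gt, Finset.erase_eq_of_notMem hu]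
      rw [hc]
      simp only [pow_add]
      ring
    · simp [partialMono, hu, hv, mulMono_of_not_disjoint, h, h1]
  · by_cases h : Disjoint u v <;>
      simp [partialMono, hu, hv, mulMono_of_not_disjoint, mulMono_of_disjoint, h]

theorem pd_mul (r : Idx n) (f g : O F n) :
    pd F r (mul F f g) = mul F (pd F r f) g + mul F (twist F r f) (pd F r g) := by
  induction f using mono_induction with
  | hadd f₁ f₂ h₁ h₂ => simp only [map_add, LinearMap.add_apply, h₁, h₂]; abel
  | hsmul c f h => simp only [map_smul, LinearMap.smul_apply, h, smul_add]
  | hmono a =>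
  induction g using mono_induction with
  | hadd f₁ f₂ h₁ h₂ => simp only [map_add, h₁, h₂]; abel
  | hsmul c f h => simp only [map_smul, h, smul_add]
  | hmono b =>
  rcases r with i | k
  · simp [leibMono_inl, mu]
  · simp [leibMono_inr, mu]

theorem pd_comm (r s : Idx n) (f : O F n) :
    pd F r (pd F s f) = ((-1) ^ (mu r * mu s) : F) • pd F s (pd F r f) := by
  induction f using mono_induction with
  | hadd f₁ f₂ h₁ h₂ => simp only [map_add, h₁, h₂, smul_add]
  | hsmul c f h => simp only [map_smul, h, smul_comm c]
  | hmono a =>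
  obtain ⟨α, u⟩ := a
  simp only [pd_mono]
  rcases r with i | k <;> rcases s with j | l
  · by_cases hij : i = j
    · subst hij; simp [mu]
    · have hji : j ≠ i := fun h => hij h.symm
      have e : α - Pi.single i 1 - Pi.single j 1 = α - Pi.single j 1 - Pi.single i 1 := by
        ext m; simp [Nat.sub_right_comm]
      by_cases hi : α i = 0 <;> by_cases hj : α j = 0 <;>
        simp [partialMono, mu, hi, hj, hij, hji, e]
  · by_cases hi : α i = 0 <;> by_cases hl : l ∈ u <;> simp [partialMono, mu, hi, hl]
  · by_cases hi : α j = 0 <;> by_cases hk : k ∈ u <;> simp [partialMono, mu, hi, hk]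
  · by_cases hkl : k = l
    · subst hkl; by_cases hk : k ∈ u <;> simp [partialMono, mu, hk]
    · have hlk : l ≠ k := fun h => hkl h.symm
      by_cases hk : k ∈ u <;> by_cases hl : l ∈ u <;>
        simp [partialMono, mu, hk, hl, hkl, hlk]
      rw [Finset.erase_right_comm, smul_smul, smul_smul, ← neg_smul]
      congr 1
      have key : ∀ a b : Fin n, a < b → a ∈ u →
          (u.filter (· < b)).card = ((u.erase a).filter (· < b)).card + 1 ∧
          ((u.erase b).filter (· < a)) = u.filter (· < a) := by
        intro a b hab ha
        constructor
        · rw [Finset.filter_erase, Finset.card_erase_add_one (by simp [ha, hab])]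
        · ext j; simp; intro h _ hj; subst hj; exact absurd h hab.le.not_gt
      rcases lt_or_gt_of_ne hkl with h | h
      · obtain ⟨e1, e2⟩ := key k l h hk
        rw [e1, e2]; ring
      · obtain ⟨e1, e2⟩ := key l k h hl
        rw [e1, e2]; ring

theorem mem_parityPart_induction {θ : ZMod 2} (P : O F n → Prop) {f : O F n}
    (hf : f ∈ parityPart F θ) (h0 : P 0) (hadd : ∀ f g, P f → P g → P (f + g))
    (hsmul : ∀ (c : F) f, P f → P (c • f))
    (hs : ∀ a : Mono n, (a.2.card : ZMod 2) = θ → P (mono F a)) : P f := by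
  refine Submodule.span_induction (p := fun f _ => P f) ?_ h0 (fun f g _ _ => hadd f g)
    (fun c f _ => hsmul c f) hf
  rintro _ ⟨a, ha, rfl⟩
  exact hs a ha

theorem mono_mem_parityPart {θ : ZMod 2} {a : Mono n} (h : (a.2.card : ZMod 2) = θ) :
    mono F a ∈ parityPart F θ := Submodule.subset_span ⟨a, h, rfl⟩

theorem pd_mem_parityPart {θ : ZMod 2} {f : O F n} (r : Idx n) (hf : f ∈ parityPart F θ) :
    pd F r f ∈ parityPart F (θ + mu r) := by
  refine mem_parityPart_induction (fun f => pd F r f ∈ parityPart F (θ + mu r)) hf (by simp)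
    (fun f g h1 h2 => ?_) (fun c f h => ?_) fun a ha => ?_
  · rw [map_add]; exact add_mem h1 h2
  · rw [map_smul]; exact Submodule.smul_mem _ _ h
  · rw [pd_mono]
    subst ha
    obtain ⟨α, u⟩ := a
    rcases r with i | k <;> simp only [partialMono] <;> split_ifs with h
    · exact zero_mem _
    · exact mono_mem_parityPart (by simp [mu])
    · refine Submodule.smul_mem _ _ (mono_mem_parityPart ?_)
      simp only [mu]
      rw [← Finset.card_erase_add_one h]
      push_cast
      rw [add_assoc]
      exact (add_zero _).symm
    · exact zero_mem _

theorem mul_mem_parityPart {θ η : ZMod 2} {f g : O F n} (hf : f ∈ parityPart F θ)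
    (hg : g ∈ parityPart F η) : mul F f g ∈ parityPart F (θ + η) := by
  refine mem_parityPart_induction (fun f => mul F f g ∈ parityPart F (θ + η)) hf (by simp)
    (fun f g h1 h2 => ?_) (fun c f h => ?_) fun a ha => ?_
  · rw [map_add]; exact add_mem h1 h2
  · rw [map_smul]; exact Submodule.smul_mem _ _ h
  refine mem_parityPart_induction (fun f => mul F (mono F a) f ∈ parityPart F (θ + η)) hg (by simp)
    (fun f g h1 h2 => ?_) (fun c f h => ?_) fun b hb => ?_
  · rw [map_add]; exact add_mem h1 h2
  · rw [map_smul]; exact Submodule.smul_mem _ _ h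
  rw [mul_mono]
  by_cases h : Disjoint a.2 b.2
  · rw [mulMono_of_disjoint h]
    refine Submodule.smul_mem _ _ (mono_mem_parityPart ?_)
    rw [Finset.card_union_of_disjoint h, Nat.cast_add, ha, hb]
  · rw [mulMono_of_not_disjoint h]; exact zero_mem _

theorem neg_one_pow_congr {a b c : ℕ} (h : (a : ZMod 2) = b) : (-1 : F) ^ (c * a) = (-1) ^ (c * b) := by
  rw [mul_comm c, mul_comm c, pow_mul, pow_mul, neg_one_pow_eq_pow_mod_two (n := a),
    neg_one_pow_eq_pow_mod_two (n := b), (ZMod.natCast_eq_natCast_iff' a b 2).1 h]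

theorem twist_of_mem {m : ℕ} {f : O F n} (r : Idx n) (hf : f ∈ parityPart F (m : ZMod 2)) :
    twist F r f = ((-1) ^ (mu r * m) : F) • f := by
  refine mem_parityPart_induction (fun f => twist F r f = ((-1) ^ (mu r * m) : F) • f) hf (by simp)
    (fun f g h1 h2 => ?_) (fun c f h => ?_) fun a ha => ?_
  · rw [map_add, h1, h2, smul_add]
  · rw [map_smul, h, smul_comm]
  · rw [twist_mono, neg_one_pow_congr ha]

theorem mul_twist {r : Idx n} {f : O F n} (hf : f ∈ parityPart F (mu r : ZMod 2)) (g : O F n) :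
    mul F f (twist F r g) = mul F g f := by
  refine mem_parityPart_induction (fun f => mul F f (twist F r g) = mul F g f) hf (by simp)
    (fun f g h1 h2 => ?_) (fun c f h => ?_) fun a ha => ?_
  · simp only [map_add, LinearMap.add_apply, h1, h2]
  · simp only [map_smul, LinearMap.smul_apply, h]
  induction g using mono_induction with
  | hadd f₁ f₂ h₁ h₂ => simp only [map_add, LinearMap.add_apply, h₁, h₂]
  | hsmul c f h => simp only [map_smul, LinearMap.smul_apply, h]
  | hmono b =>
  rw [twist_mono, map_smul, mul_mono, mul_mono, mulMono_comm b a, mul_comm (mu r),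
    neg_one_pow_congr ha]

theorem mul_comm_of_mem {r s : Idx n} {f g : O F n} (hf : f ∈ parityPart F (mu r : ZMod 2))
    (hg : g ∈ parityPart F (mu s : ZMod 2)) :
    mul F g f = ((-1) ^ (mu r * mu s) : F) • mul F f g := by
  rw [← mul_twist hf, twist_of_mem r hg, map_smul]

theorem vectorField_apply (f : Idx n → O F n) (g : O F n) :
    vectorField F f g = ∑ r, mul F (f r) (pd F r g) := by
  simp [vectorField, LinearMap.sum_apply]

theorem vectorField_mul {f : Idx n → O F n} (hf : ∀ r, f r ∈ parityPart F (mu r : ZMod 2))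
    (g h : O F n) : vectorField F f (mul F g h) =
      mul F (vectorField F f g) h + mul F g (vectorField F f h) := by
  simp only [vectorField_apply, map_sum, LinearMap.sum_apply, ← Finset.sum_add_distrib]
  refine Finset.sum_congr rfl fun r _ => ?_
  rw [pd_mul, map_add, mul_assoc', ← mul_assoc' (f r) (twist F r g), mul_twist (hf r),
    mul_assoc']

theorem lie_vectorField {f g : Idx n → O F n} (hf : ∀ r, f r ∈ parityPart F (mu r : ZMod 2))
    (hg : ∀ r, g r ∈ parityPart F (mu r : ZMod 2)) :
    ⁅vectorField F f, vectorField F g⁆ =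
      vectorField F fun s => vectorField F f (g s) - vectorField F g (f s) := by
  refine LinearMap.ext fun h => ?_
  rw [LieRing.of_associative_ring_bracket, LinearMap.sub_apply, Module.End.mul_apply,
    Module.End.mul_apply, vectorField_apply g h, vectorField_apply f h, vectorField_apply _ h]
  simp only [map_sum, vectorField_mul hf, vectorField_mul hg, map_sub, LinearMap.sub_apply,
    Finset.sum_add_distrib, Finset.sum_sub_distrib]
  have : ∑ s, mul F (g s) (vectorField F f (pd F s h)) =
      ∑ r, mul F (f r) (vectorField F g (pd F r h)) := by
    simp only [vectorField_apply, map_sum]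
    rw [Finset.sum_comm]
    refine Finset.sum_congr rfl fun r _ => Finset.sum_congr rfl fun s _ => ?_
    rw [← mul_assoc', ← mul_assoc', mul_comm_of_mem (hf r) (hg s), pd_comm r s, map_smul,
      map_smul, LinearMap.smul_apply, smul_smul, ← pow_add, Even.neg_one_pow ⟨_, rfl⟩, one_smul]
  rw [this]
  abel

/-- The variables `x_r`, `r ∈ Y`. -/
def gen : Idx n → Mono n
  | Sum.inl i => (Pi.single i 1, ∅)
  | Sum.inr k => (0, {k})

theorem mul_one' (f : O F n) : mul F f (mono F (0, ∅)) = f := by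
  induction f using mono_induction with
  | hadd f₁ f₂ h₁ h₂ => simp only [map_add, LinearMap.add_apply, h₁, h₂]
  | hsmul c f h => simp only [map_smul, LinearMap.smul_apply, h]
  | hmono a => simp [mulMono_of_disjoint, inv, binom]

theorem one_mul' (f : O F n) : mul F (mono F (0, ∅)) f = f := by
  induction f using mono_induction with
  | hadd f₁ f₂ h₁ h₂ => simp only [map_add, h₁, h₂]
  | hsmul c f h => simp only [map_smul, h]
  | hmono a => simp [mulMono_of_disjoint, inv, binom]

theorem pd_gen (r s : Idx n) : pd F r (mono F (gen s)) =
    if r = s then mono F (0, ∅) else 0 := by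
  rw [pd_mono]
  rcases r with i | k <;> rcases s with j | l
  · by_cases h : i = j
    · subst h; simp [gen, partialMono]
    · simp [gen, partialMono, h]
  · simp [gen, partialMono]
  · simp [gen, partialMono]
  · by_cases h : k = l
    · subst h; simp [gen, partialMono, Finset.filter_singleton]
    · simp [gen, partialMono, h]

theorem vectorField_gen (f : Idx n → O F n) (r : Idx n) :
    vectorField F f (mono F (gen r)) = f r := by
  rw [vectorField_apply, Finset.sum_eq_single r]
  · rw [pd_gen, if_pos rfl, mul_one']
  · intro s _ hs; rw [pd_gen, if_neg hs, map_zero]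
  · simp

theorem vectorField_injective : Function.Injective (vectorField F (n := n)) := by
  intro f g h
  funext r
  rw [← vectorField_gen f, h, vectorField_gen]

theorem TH_eq {m : ℕ} {a : O F n} (ha : a ∈ parityPart F (m : ZMod 2)) :
    TH F a = vectorField F fun r => ((-1) ^ (mu (prime r) * m) : F) • pd F (prime r) a := by
  simp only [TH, LinearMap.comp_apply]
  congr 1
  funext r
  simp [twist_of_mem _ ha]

theorem mu_prime (r : Idx n) : mu (prime r) = 1 - mu r := by
  rcases r with i | k <;> simp [mu]

theorem mu_prime_add (r : Idx n) : (mu (prime r) : ZMod 2) = 1 + mu r := by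
  rcases r with i | k <;> simp [mu]; rfl

theorem TH_coeff_mem {θ : ZMod 2} {a : O F n} (ha : a ∈ parityPart F θ) (c : F) (r : Idx n) :
    c • pd F (prime r) a ∈ parityPart F (θ + 1 + mu r) := by
  have := pd_mem_parityPart (prime r) ha
  rw [mu_prime_add, ← add_assoc] at this
  exact Submodule.smul_mem _ _ this

theorem lie_TH {a b : O F n} (ha : a ∈ parityPart F 1) (hb : b ∈ parityPart F 1) :
    ⁅TH F a, TH F b⁆ = TH F (TH F a b) := by
  have ha' : a ∈ parityPart F ((1 : ℕ) : ZMod 2) := by simpa using ha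
  have hb' : b ∈ parityPart F ((1 : ℕ) : ZMod 2) := by simpa using hb
  have h2 : ∀ x : ZMod 2, 1 + 1 + x = x := by decide
  have hfa := fun r => h2 (mu r) ▸ TH_coeff_mem ha ((-1) ^ (mu (prime r) * 1)) r
  have hfb := fun r => h2 (mu r) ▸ TH_coeff_mem hb ((-1) ^ (mu (prime r) * 1)) r
  have hc : TH F a b ∈ parityPart F ((1 : ℕ) : ZMod 2) := by
    rw [TH_eq ha', vectorField_apply]
    refine sum_mem fun r _ => ?_
    have := mul_mem_parityPart (hfa r) (pd_mem_parityPart r hb)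
    have e : (mu r : ZMod 2) + (1 + mu r) = ((1 : ℕ) : ZMod 2) := by
      generalize (mu r : ZMod 2) = x
      revert x; decide
    rwa [e] at this
  rw [TH_eq hc, TH_eq ha', TH_eq hb', lie_vectorField hfa hfb]
  congr 1
  funext s
  generalize hj : prime s = j
  simp only [map_smul, ← smul_sub]
  congr 1
  simp only [vectorField_apply, map_sum]
  rw [← Equiv.sum_comp (Equiv.sumComm (Fin n) (Fin n)) 
    (fun x => mul F ((-1) ^ (mu (prime x) * 1) • pd F (prime x) b) (pd F x (pd F j a))),
    ← Finset.sum_sub_distrib]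
  refine Finset.sum_congr rfl fun r _ => ?_
  have e0 : (Equiv.sumComm (Fin n) (Fin n)) r = prime r := rfl
  have e1 : prime (prime r) = r := Sum.swap_swap r
  rw [e0, e1]
  have hA : pd F (prime r) a ∈ parityPart F (mu r : ZMod 2) := by
    simpa [h2] using TH_coeff_mem ha (1 : F) r
  have hB : pd F r b ∈ parityPart F (mu (prime r) : ZMod 2) := by
    rw [mu_prime_add]; exact pd_mem_parityPart r hb
  have hA' : pd F j (pd F (prime r) a) ∈ parityPart F ((mu r + mu j : ℕ) : ZMod 2) := by
    rw [Nat.cast_add]; exact pd_mem_parityPart j hA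
  have h3 : mul F (pd F j (pd F (prime r) a)) (pd F r b) =
      mul F (pd F r b) (pd F (prime r) (pd F j a)) := by
    rw [← mul_twist hB, twist_of_mem _ hA', pd_comm j (prime r), smul_smul, ← pow_add]
    rw [Even.neg_one_pow, one_smul]
    rcases r with i | k <;> rcases j with i | k <;> simp [mu]
  have h4 : mul F (twist F j (pd F (prime r) a)) (pd F j (pd F r b)) =
      mul F (pd F (prime r) a) (pd F r (pd F j b)) := by
    rw [twist_of_mem _ hA, pd_comm j r, map_smul, map_smul, LinearMap.smul_apply, smul_smul,
      ← pow_add, Even.neg_one_pow ⟨_, rfl⟩, one_smul]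
  simp only [map_smul, LinearMap.smul_apply, pd_mul, h3, h4]
  rcases r with i | k <;> simp [mu] <;> abel

theorem mono_mem_trunc {p : ℕ} {t : Fin n → ℕ} {a : Mono n} (h : ∀ i, a.1 i ≤ p ^ t i - 1) :
    mono F a ∈ trunc F p t := Submodule.subset_span ⟨a, h, rfl⟩

theorem mem_trunc_induction {p : ℕ} {t : Fin n → ℕ} (P : O F n → Prop) {f : O F n}
    (hf : f ∈ trunc F p t) (h0 : P 0) (hadd : ∀ f g, P f → P g → P (f + g))
    (hsmul : ∀ (c : F) f, P f → P (c • f))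
    (hs : ∀ a : Mono n, (∀ i, a.1 i ≤ p ^ t i - 1) → P (mono F a)) : P f := by
  refine Submodule.span_induction (p := fun f _ => P f) ?_ h0 (fun f g _ _ => hadd f g)
    (fun c f _ => hsmul c f) hf
  rintro _ ⟨a, ha, rfl⟩
  exact hs a ha

theorem pd_mem_trunc {p : ℕ} {t : Fin n → ℕ} {f : O F n} (r : Idx n) (hf : f ∈ trunc F p t) :
    pd F r f ∈ trunc F p t := by
  refine mem_trunc_induction (fun f => pd F r f ∈ trunc F p t) hf (by simp)
    (fun f g h1 h2 => ?_) (fun c f h => ?_) fun a ha => ?_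
  · rw [map_add]; exact add_mem h1 h2
  · rw [map_smul]; exact Submodule.smul_mem _ _ h
  · rw [pd_mono]
    obtain ⟨α, u⟩ := a
    rcases r with i | k <;> simp only [partialMono] <;> split_ifs with h
    · exact zero_mem _
    · exact mono_mem_trunc (fun j => (Nat.sub_le _ _).trans (ha j))
    · exact Submodule.smul_mem _ _ (mono_mem_trunc ha)
    · exact zero_mem _

theorem choose_cast_eq_zero (p : ℕ) [Fact p.Prime] [CharP F p] {t a b : ℕ}
    (ha : a ≤ p ^ t - 1) (hb : b ≤ p ^ t - 1) (h : ¬ a + b ≤ p ^ t - 1) :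
    ((a + b).choose a : F) = 0 := by
  have hp : 0 < p ^ t := pow_pos (Fact.out : p.Prime).pos t
  obtain ⟨c, hc⟩ : ∃ c, a + b = p ^ t + c := ⟨a + b - p ^ t, by omega⟩
  rw [← Polynomial.coeff_X_add_one_pow, hc, pow_add, add_pow_char_pow, one_pow, add_mul, one_mul,
    Polynomial.coeff_add, Polynomial.coeff_X_pow_mul', if_neg (by omega),
    Polynomial.coeff_X_add_one_pow, Nat.choose_eq_zero_of_lt (by omega)]
  simp

theorem mul_mem_trunc {p : ℕ} [Fact p.Prime] [CharP F p] {t : Fin n → ℕ} {f g : O F n}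
    (hf : f ∈ trunc F p t) (hg : g ∈ trunc F p t) : mul F f g ∈ trunc F p t := by
  refine mem_trunc_induction (fun f => mul F f g ∈ trunc F p t) hf (by simp)
    (fun f g h1 h2 => ?_) (fun c f h => ?_) fun a ha => ?_
  · rw [map_add]; exact add_mem h1 h2
  · rw [map_smul]; exact Submodule.smul_mem _ _ h
  refine mem_trunc_induction (fun f => mul F (mono F a) f ∈ trunc F p t) hg (by simp)
    (fun f g h1 h2 => ?_) (fun c f h => ?_) fun b hb => ?_
  · rw [map_add]; exact add_mem h1 h2
  · rw [map_smul]; exact Submodule.smul_mem _ _ h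
  rw [mul_mono]
  by_cases h : Disjoint a.2 b.2
  · rw [mulMono_of_disjoint h]
    by_cases hab : ∀ i, a.1 i + b.1 i ≤ p ^ t i - 1
    · exact Submodule.smul_mem _ _ (mono_mem_trunc hab)
    · push Not at hab
      obtain ⟨i, hi⟩ := hab
      have : (binom a.1 b.1 : F) = 0 := by
        rw [binom, Nat.cast_prod]
        exact Finset.prod_eq_zero (Finset.mem_univ i)
          (choose_cast_eq_zero p (ha i) (hb i) hi.not_ge)
      simp [this]
  · rw [mulMono_of_not_disjoint h]; exact zero_mem _

theorem vectorField_mem_trunc {p : ℕ} [Fact p.Prime] [CharP F p] {t : Fin n → ℕ}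
    {f : Idx n → O F n} {g : O F n} (hf : ∀ r, f r ∈ trunc F p t) (hg : g ∈ trunc F p t) :
    vectorField F f g ∈ trunc F p t := by
  rw [vectorField_apply]
  exact sum_mem fun r _ => mul_mem_trunc (hf r) (pd_mem_trunc r hg)

theorem mem_wittPart {p : ℕ} {t : Fin n → ℕ} {θ : ZMod 2} {D : Module.End F (O F n)} :
    D ∈ wittPart F p t θ ↔ ∃ f : Idx n → O F n,
      (∀ r, f r ∈ trunc F p t ∧ f r ∈ parityPart F (θ + mu r)) ∧ vectorField F f = D := by
  simp [wittPart, Submodule.mem_pi]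

theorem lie_mem_wittPart {p : ℕ} [Fact p.Prime] [CharP F p] {t : Fin n → ℕ}
    {D E : Module.End F (O F n)} (hD : D ∈ wittPart F p t 0) (hE : E ∈ wittPart F p t 0) :
    ⁅D, E⁆ ∈ wittPart F p t 0 := by
  obtain ⟨f, hf, rfl⟩ := mem_wittPart.1 hD
  obtain ⟨g, hg, rfl⟩ := mem_wittPart.1 hE
  simp only [zero_add] at hf hg
  rw [lie_vectorField (fun r => (hf r).2) fun r => (hg r).2]
  have key : ∀ f g : Idx n → O F n, (∀ r, f r ∈ parityPart F (mu r : ZMod 2)) →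
      (∀ r, g r ∈ parityPart F (mu r : ZMod 2)) → ∀ s,
      vectorField F f (g s) ∈ parityPart F (mu s : ZMod 2) := by
    intro f g hf hg s
    rw [vectorField_apply]
    refine sum_mem fun r _ => ?_
    have := mul_mem_parityPart (hf r) (pd_mem_parityPart r (hg s))
    have e : ∀ x y : ZMod 2, x + (y + x) = y := by decide
    rwa [e] at this
  refine mem_wittPart.2 ⟨_, fun s => ⟨?_, ?_⟩, rfl⟩
  · exact sub_mem (vectorField_mem_trunc (fun r => (hf r).1) (hg s).1)
      (vectorField_mem_trunc (fun r => (hg r).1) (hf s).1)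
  · rw [zero_add]
    exact sub_mem (key f g (fun r => (hf r).2) (fun r => (hg r).2) s)
      (key g f (fun r => (hg r).2) (fun r => (hf r).2) s)

theorem TH_mem_wittPart {p : ℕ} {t : Fin n → ℕ} {θ : ZMod 2} {a : O F n}
    (ht : a ∈ trunc F p t) (ha : a ∈ parityPart F θ) : TH F a ∈ wittPart F p t (θ + 1) := by
  have ha' : a ∈ parityPart F ((θ.val : ℕ) : ZMod 2) := by simpa using ha
  rw [TH_eq ha']
  exact mem_wittPart.2 ⟨_, fun r => ⟨Submodule.smul_mem _ _ (pd_mem_trunc _ ht),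
    TH_coeff_mem ha _ r⟩, rfl⟩

theorem wittPart_disjoint {p : ℕ} {t : Fin n → ℕ} {D : Module.End F (O F n)}
    (h0 : D ∈ wittPart F p t 0) (h1 : D ∈ wittPart F p t 1) : D = 0 := by
  obtain ⟨f, hf, rfl⟩ := mem_wittPart.1 h0
  obtain ⟨g, hg, e⟩ := mem_wittPart.1 h1
  rw [← vectorField_injective e.symm] at hg
  have : f = 0 := by
    funext r
    refine Submodule.disjoint_def.1 ((monoBasis F n).linearIndependent.disjoint_span_image
      (Set.disjoint_left.2 fun a ha hb => ?_)) _ (hf r).2 (hg r).2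
    have h2 := ha.symm.trans hb
    generalize (mu r : ZMod 2) = x at h2
    revert x; decide
  rw [this, map_zero]

theorem exists_parity {p : ℕ} {t : Fin n → ℕ} {a : O F n} (h : a ∈ trunc F p t) :
    ∃ b c : O F n, a = b + c ∧ b ∈ trunc F p t ∧ c ∈ trunc F p t ∧
      b ∈ parityPart F 0 ∧ c ∈ parityPart F 1 := by
  refine mem_trunc_induction (fun a => ∃ b c : O F n, a = b + c ∧ b ∈ trunc F p t ∧
    c ∈ trunc F p t ∧ b ∈ parityPart F 0 ∧ c ∈ parityPart F 1) h ?_ ?_ ?_ ?_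
  · exact ⟨0, 0, by simp, zero_mem _, zero_mem _, zero_mem _, zero_mem _⟩
  · rintro _ _ ⟨b, c, rfl, h1, h2, h3, h4⟩ ⟨b', c', rfl, h1', h2', h3', h4'⟩
    exact ⟨b + b', c + c', by abel, add_mem h1 h1', add_mem h2 h2', add_mem h3 h3', add_mem h4 h4'⟩
  · rintro x _ ⟨b, c, rfl, h1, h2, h3, h4⟩
    exact ⟨x • b, x • c, smul_add _ _ _, Submodule.smul_mem _ _ h1, Submodule.smul_mem _ _ h2,
      Submodule.smul_mem _ _ h3, Submodule.smul_mem _ _ h4⟩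
  · intro m hm
    have : ∀ x : ZMod 2, x = 0 ∨ x = 1 := by decide
    rcases this (m.2.card : ZMod 2) with h | h
    · exact ⟨_, 0, (add_zero _).symm, mono_mem_trunc hm, zero_mem _, mono_mem_parityPart h,
        zero_mem _⟩
    · exact ⟨0, _, (zero_add _).symm, zero_mem _, mono_mem_trunc hm, zero_mem _,
        mono_mem_parityPart h⟩

theorem exists_odd_of_mem {p : ℕ} {t : Fin n → ℕ} {D : Module.End F (O F n)}
    (h : D ∈ hoSuper F p t) (h0 : D ∈ wittPart F p t 0) :
    ∃ a ∈ trunc F p t, a ∈ parityPart F 1 ∧ TH F a = D := by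
  obtain ⟨a, ha, rfl⟩ := h
  obtain ⟨b, c, rfl, hb, hc, hb', hc'⟩ := exists_parity ha
  refine ⟨c, hc, hc', ?_⟩
  have h1 := TH_mem_wittPart hc hc'
  have h2 := TH_mem_wittPart hb hb'
  rw [map_add] at h0 ⊢
  have h4 : TH F b ∈ wittPart F p t 0 := (Submodule.add_mem_iff_left _ h1).1 h0
  rw [wittPart_disjoint h4 (by simpa using h2), zero_add]

theorem lie_mem_hoSuper {p : ℕ} [Fact p.Prime] [CharP F p] {t : Fin n → ℕ}
    {D E : Module.End F (O F n)} (hD : D ∈ hoSuper F p t) (hD0 : D ∈ wittPart F p t 0)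
    (hE : E ∈ hoSuper F p t) (hE0 : E ∈ wittPart F p t 0) : ⁅D, E⁆ ∈ hoSuper F p t := by
  obtain ⟨a, ha, ha1, rfl⟩ := exists_odd_of_mem hD hD0
  obtain ⟨b, hb, hb1, rfl⟩ := exists_odd_of_mem hE hE0
  rw [lie_TH ha1 hb1]
  refine ⟨_, ?_, rfl⟩
  obtain ⟨f, hf, e⟩ := mem_wittPart.1 (TH_mem_wittPart ha ha1)
  rw [← e]
  exact vectorField_mem_trunc (fun r => (hf r).1) hb

theorem pd_mem_wittPart (p : ℕ) (t : Fin n → ℕ) (i : Fin n) :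
    pd F (Sum.inl i) ∈ wittPart F p t 0 := by
  refine mem_wittPart.2 ⟨Pi.single (Sum.inl i) (mono F (0, ∅)), fun r => ?_, ?_⟩
  · by_cases h : r = Sum.inl i
    · subst h
      rw [Pi.single_eq_same]
      exact ⟨mono_mem_trunc (fun j => Nat.zero_le _), mono_mem_parityPart (by simp [mu])⟩
    · rw [Pi.single_eq_of_ne h]
      exact ⟨zero_mem _, zero_mem _⟩
  · refine LinearMap.ext fun g => ?_
    rw [vectorField_apply, Finset.sum_eq_single (Sum.inl i)]
    · rw [Pi.single_eq_same, one_mul']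
    · intro s _ hs; rw [Pi.single_eq_of_ne hs]; simp
    · simp

end

/-- The Lie algebra `𝒲`, the even part of `W(n,n;t)`; on even operators the superbracket is the
commutator. -/
noncomputable def W (p : ℕ) [Fact p.Prime] [CharP F p] (t : Fin n → ℕ) :
    LieSubalgebra F (Module.End F (O F n)) where
  toSubmodule := wittPart F p t 0
  lie_mem' := lie_mem_wittPart

/-- The Lie algebra `ℋ𝒪`, the even part of `HO(n,n;t)`, as a subalgebra of `𝒲`. -/
noncomputable def HO (p : ℕ) [Fact p.Prime] [CharP F p] (t : Fin n → ℕ) : LieSubalgebra F (W F p t) where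
  toSubmodule := (hoSuper F p t).comap (W F p t).toSubmodule.subtype
  lie_mem' := fun {D E} hD hE => lie_mem_hoSuper hD D.2 hE E.2

/-- `∂_i`, `i ∈ Y₀`, as an element of `𝒲`. -/
noncomputable def partialW (p : ℕ) [Fact p.Prime] [CharP F p] (t : Fin n → ℕ) (i : Fin n) :
    W F p t :=
  ⟨pd F (Sum.inl i), pd_mem_wittPart p t i⟩

/-- The derivation space `Der(L, M)` of a Lie algebra `L` into an `L`-module `M`, as a subspace of
`Hom(L, M)`. -/
def derSpace (R L M : Type*) [CommRing R] [LieRing L] [LieAlgebra R L] [AddCommGroup M]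
    [Module R M] [LieRingModule L M] [LieModule R L M] : Submodule R (L →ₗ[R] M) where
  carrier := Set.range fun D : LieDerivation R L M => (D : L →ₗ[R] M)
  zero_mem' := ⟨0, rfl⟩
  add_mem' := by rintro _ _ ⟨D, rfl⟩ ⟨E, rfl⟩; exact ⟨D + E, rfl⟩
  smul_mem' := by rintro c _ ⟨D, rfl⟩; exact ⟨c • D, rfl⟩

/-- The restriction to a subalgebra `H` of a linear endomorphism of the Lie algebra `L`. -/
def restrictTo {R L : Type*} [CommRing R] [LieRing L] [LieAlgebra R L] (H : LieSubalgebra R L) :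
    Module.End R L →ₗ[R] (H →ₗ[R] L) :=
  LinearMap.lcomp R L H.toSubmodule.subtype

/-- The space `ad L` of the maps `ad w : H → L`, `x ↦ ⁅w, x⁆`, with `w ∈ L`. -/
def adSpace {R L : Type*} [CommRing R] [LieRing L] [LieAlgebra R L] (H : LieSubalgebra R L) :
    Submodule R (H →ₗ[R] L) :=
  LinearMap.range (restrictTo H ∘ₗ (LieAlgebra.ad R L : L →ₗ[R] Module.End R L))

end OddHamiltonian

/-! Every element of `HO` is T_H(a) for an odd truncated a, and on odd elements T_H carries the
bracket {a, b} = T_H(a)(b) (`poisson`) to the commutator. A derivation of `HO` into `W` therefore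
becomes a linear map D on odd elements whose values are coefficient vectors of even fields
(`IsDer`). The values are not required to be truncated: in the full divided power algebra a closed
system ∂_i w = f_i can always be integrated, so inner derivations by untruncated fields are
available for correcting D.

Such corrections make D vanish on x_{i'} (integration of a closed system), on x_i x_{i'} (the fields
T_H(x_i x_{i'}) span a torus acting diagonally), on all x_i x_{j'} and on all x^u with |u| = 3. For
the last two, weights leave only scalars as unknowns, and a combination of the fields x_{k'} ∂_{k'}
absorbs them. The maps (ad ∂_i)^(p^k) with 1 ≤ k < t_i annihilate all these elements and serve to
remove the ∂_i-coefficient of D(x_i^(p^k) x_{i'}). This is `IsDer.exists_normal`.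

A normalized D is zero, by induction on the degree |α| + |u| (`IsNormal.killsBelow`). The bracket of
monomials of degrees a and b has degree a + b - 2, so most monomials of degree N are nonzero
multiples of brackets of monomials of degree below N. For the others, D of the monomial is a field
with constant even coefficients (all ∂_i annihilate it) having the weight of the monomial. The
weights of x^v ∂_r are integers in [-1, 2], and since p ≥ 5 few congruences modulo p are possible.
The exceptional elements x_i^(p^k) x_{i'} survive, which is why the powers of ad ∂_i are outer.

Finally the correcting field w is truncated (`mem_trunc_of_br_mem`): (ad ∂_j)^(p^(t_j)) is a
derivation killing every truncated field, so it sends w to a field centralizing all even Hamiltonian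
fields, and such a field is 0 (`eq_zero_of_centralizes`). -/

namespace OddHamiltonian

attribute [local instance] LieRing.ofAssociativeRing

variable {F : Type*} [Field F] {n : ℕ}

/-! ### Coefficients with respect to the monomial basis -/

/-- The coefficient of the monomial `a` in an element of `𝒪(n,n)`. -/
noncomputable def coeff (a : Mono n) : O F n →ₗ[F] F := (monoBasis F n).coord a

theorem coeff_mono (a b : Mono n) : coeff a (mono F b) = if b = a then 1 else 0 := by
  classical
  simp [coeff, mono, Finsupp.single_apply]

theorem ext_coeff {f g : O F n} (h : ∀ a, coeff a f = coeff a g) : f = g :=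
  (monoBasis F n).ext_elem h

theorem coeff_support_finite (f : O F n) : ∃ s : Finset (Mono n), ∀ a, coeff a f ≠ 0 → a ∈ s :=
  ⟨((monoBasis F n).repr f).support, fun _ h => Finsupp.mem_support_iff.2 h⟩

theorem exists_coeff (s : Finset (Mono n)) (φ : Mono n → F) (h : ∀ a, φ a ≠ 0 → a ∈ s) :
    ∃ f : O F n, ∀ a, coeff a f = φ a := by
  refine ⟨(monoBasis F n).repr.symm (Finsupp.onFinset s φ h), fun a => ?_⟩
  simp [coeff]

theorem mem_span_mono_iff {S : Set (Mono n)} {f : O F n} :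
    f ∈ Submodule.span F (mono F '' S) ↔ ∀ a, coeff a f ≠ 0 → a ∈ S := by
  change f ∈ Submodule.span F (monoBasis F n '' S) ↔ _
  rw [Module.Basis.mem_span_image]
  exact ⟨fun h a ha => h (Finsupp.mem_support_iff.2 ha),
    fun h a ha => h a (Finsupp.mem_support_iff.1 ha)⟩

theorem mem_parityPart_iff {θ : ZMod 2} {f : O F n} :
    f ∈ parityPart F θ ↔ ∀ a, coeff a f ≠ 0 → (a.2.card : ZMod 2) = θ := mem_span_mono_iff

theorem mem_trunc_iff {p : ℕ} {t : Fin n → ℕ} {f : O F n} :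
    f ∈ trunc F p t ↔ ∀ a, coeff a f ≠ 0 → ∀ i, a.1 i ≤ p ^ t i - 1 := mem_span_mono_iff

theorem coeff_pd_inl (i : Fin n) (α : Fin n → ℕ) (u : Finset (Fin n)) (f : O F n) :
    coeff (α, u) (pd F (Sum.inl i) f) = coeff (α + Pi.single i 1, u) f := by
  induction f using mono_induction with
  | hadd f₁ f₂ h₁ h₂ => simp only [map_add, h₁, h₂]
  | hsmul c f h => simp only [map_smul, h]
  | hmono a =>
  obtain ⟨β, v⟩ := a
  rw [pd_mono, coeff_mono]
  simp only [partialMono]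
  by_cases h : β i = 0
  · rw [if_pos h, if_neg, map_zero]
    rintro ⟨⟩
    simp at h
  · rw [if_neg h, coeff_mono]
    have : β - Pi.single i 1 = α ↔ β = α + Pi.single i 1 := by
      constructor
      · rintro rfl
        ext j
        by_cases hj : j = i
        · subst hj; simp; omega
        · simp [hj]
      · rintro rfl; simp
    simp only [Prod.mk.injEq, this]

theorem coeff_pd_inl_pow (i : Fin n) (k : ℕ) (α : Fin n → ℕ) (u : Finset (Fin n)) (f : O F n) :
    coeff (α, u) ((pd F (Sum.inl i) ^ k) f) = coeff (α + Pi.single i k, u) f := by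
  induction k generalizing f with
  | zero => simp
  | succ k ih => rw [pow_succ, Module.End.mul_apply, ih, coeff_pd_inl, add_assoc, ← Pi.single_add]

/-! ### Even vector fields and Hamiltonian fields as coefficient vectors -/

/-- The coefficient vectors of even vector fields. -/
noncomputable def evenFields (F : Type*) [Field F] (n : ℕ) : Submodule F (Idx n → O F n) :=
  Submodule.pi Set.univ fun r => parityPart F (mu r : ZMod 2)

theorem mem_evenFields {f : Idx n → O F n} :
    f ∈ evenFields F n ↔ ∀ r, f r ∈ parityPart F (mu r : ZMod 2) := by
  simp [evenFields, Submodule.mem_pi]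

/-- The commutator of vector fields in terms of coefficients. -/
noncomputable def br : (Idx n → O F n) →ₗ[F] (Idx n → O F n) →ₗ[F] (Idx n → O F n) :=
  LinearMap.mk₂ F (fun f g s => vectorField F f (g s) - vectorField F g (f s))
    (fun f f' g => by ext s : 1; simp; abel) (fun c f g => by ext s : 1; simp [smul_sub])
    (fun f f' g => by ext s : 1; simp; abel) (fun c f g => by ext s : 1; simp [smul_sub])

theorem br_apply (f g : Idx n → O F n) (s : Idx n) :
    br f g s = vectorField F f (g s) - vectorField F g (f s) := rfl

theorem br_swap (f g : Idx n → O F n) : br f g = - br g f := by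
  ext s : 1; simp [br_apply]

theorem vectorField_br {f g : Idx n → O F n} (hf : f ∈ evenFields F n) (hg : g ∈ evenFields F n) :
    vectorField F (br f g) = ⁅vectorField F f, vectorField F g⁆ :=
  (lie_vectorField (mem_evenFields.1 hf) (mem_evenFields.1 hg)).symm

theorem vectorField_mem_parityPart {f : Idx n → O F n} (hf : f ∈ evenFields F n) {θ : ZMod 2}
    {g : O F n} (hg : g ∈ parityPart F θ) : vectorField F f g ∈ parityPart F θ := by
  rw [vectorField_apply]
  refine sum_mem fun r _ => ?_
  have := mul_mem_parityPart (mem_evenFields.1 hf r) (pd_mem_parityPart r hg)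
  have e : ∀ x y : ZMod 2, x + (y + x) = y := by decide
  rwa [e] at this

theorem br_mem {f g : Idx n → O F n} (hf : f ∈ evenFields F n) (hg : g ∈ evenFields F n) :
    br f g ∈ evenFields F n :=
  mem_evenFields.2 fun s => sub_mem (vectorField_mem_parityPart hf (mem_evenFields.1 hg s))
    (vectorField_mem_parityPart hg (mem_evenFields.1 hf s))

/-- Inherited from the commutator of operators through the injectivity of `vectorField`. Evenness is
needed because `br` represents the commutator only for even fields. -/
theorem br_jacobi {f g h : Idx n → O F n} (hf : f ∈ evenFields F n) (hg : g ∈ evenFields F n)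
    (hh : h ∈ evenFields F n) : br f (br g h) = br (br f g) h + br g (br f h) := by
  apply vectorField_injective
  rw [map_add, vectorField_br hf (br_mem hg hh), vectorField_br (br_mem hf hg) hh,
    vectorField_br hg (br_mem hf hh), vectorField_br hf hg, vectorField_br hg hh,
    vectorField_br hf hh, leibniz_lie]

/-- The coefficients of `T_H(a)`, `a` odd. -/
noncomputable def ham : O F n →ₗ[F] (Idx n → O F n) :=
  LinearMap.pi fun r => Sum.elim (fun i => - pd F (Sum.inr i)) (fun i => pd F (Sum.inl i)) r

@[simp] theorem ham_inl (a : O F n) (i : Fin n) : ham a (Sum.inl i) = - pd F (Sum.inr i) a := rfl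

@[simp] theorem ham_inr (a : O F n) (i : Fin n) : ham a (Sum.inr i) = pd F (Sum.inl i) a := rfl

theorem TH_eq_vectorField_ham {a : O F n} (ha : a ∈ parityPart F 1) :
    TH F a = vectorField F (ham a) := by
  rw [TH_eq (m := 1) (by simpa using ha)]
  congr 1
  funext r
  rcases r with i | i <;> simp [mu]

theorem ham_mem {a : O F n} (ha : a ∈ parityPart F 1) : ham a ∈ evenFields F n := by
  rw [mem_evenFields]
  have h2 : ∀ x : ZMod 2, 1 + 1 + x = x := by decide
  intro r
  rw [← h2 (mu r)]
  rcases r with i | i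
  · simpa using TH_coeff_mem ha (-1) (Sum.inl i)
  · simpa using TH_coeff_mem ha 1 (Sum.inr i)

/-- The Lie bracket of odd elements of `𝒪(n,n)` carried over from vector fields by `T_H`. -/
noncomputable def poisson : O F n →ₗ[F] O F n →ₗ[F] O F n := vectorField F ∘ₗ ham

theorem poisson_apply (a b : O F n) : poisson a b = vectorField F (ham a) b := rfl

theorem poisson_mem_parityPart {a b : O F n} (ha : a ∈ parityPart F 1) (hb : b ∈ parityPart F 1) :
    poisson a b ∈ parityPart F 1 := vectorField_mem_parityPart (ham_mem ha) hb

theorem ham_poisson {a b : O F n} (ha : a ∈ parityPart F 1) (hb : b ∈ parityPart F 1) :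
    ham (poisson a b) = br (ham a) (ham b) := by
  apply vectorField_injective
  rw [vectorField_br (ham_mem ha) (ham_mem hb), ← TH_eq_vectorField_ham ha,
    ← TH_eq_vectorField_ham hb, lie_TH ha hb,
    ← TH_eq_vectorField_ham (poisson_mem_parityPart ha hb), poisson_apply,
    TH_eq_vectorField_ham ha]

/-- The odd elements of `𝒪(n,n;t)`. -/
noncomputable def oddTrunc (F : Type*) [Field F] {n : ℕ} (p : ℕ) (t : Fin n → ℕ) :
    Submodule F (O F n) := trunc F p t ⊓ parityPart F 1

theorem ham_mem_trunc {p : ℕ} {t : Fin n → ℕ} {a : O F n} (ha : a ∈ trunc F p t) (r : Idx n) :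
    ham a r ∈ trunc F p t := by
  rcases r with i | i
  · exact neg_mem (pd_mem_trunc _ ha)
  · exact pd_mem_trunc _ ha

theorem poisson_mem {p : ℕ} [Fact p.Prime] [CharP F p] {t : Fin n → ℕ} {a b : O F n}
    (ha : a ∈ oddTrunc F p t) (hb : b ∈ oddTrunc F p t) : poisson a b ∈ oddTrunc F p t :=
  ⟨vectorField_mem_trunc (ham_mem_trunc ha.1) hb.1, poisson_mem_parityPart ha.2 hb.2⟩

/-! ### The derivations ad ∂_i and their p-powers -/

/-- Componentwise application of `∂_i`, `i ∈ Y₀`. -/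
noncomputable def pdField (i : Fin n) : Module.End F (Idx n → O F n) :=
  LinearMap.pi fun r => pd F (Sum.inl i) ∘ₗ LinearMap.proj r

theorem pdField_apply (i : Fin n) (f : Idx n → O F n) (r : Idx n) :
    pdField i f r = pd F (Sum.inl i) (f r) := rfl

theorem pdField_pow_apply (i : Fin n) (k : ℕ) (f : Idx n → O F n) (r : Idx n) :
    (pdField i ^ k) f r = (pd F (Sum.inl i) ^ k) (f r) := by
  induction k generalizing f with
  | zero => simp
  | succ k ih => rw [pow_succ, Module.End.mul_apply, ih, pow_succ, Module.End.mul_apply,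
      pdField_apply]

theorem pdField_mem (i : Fin n) {f : Idx n → O F n} (hf : f ∈ evenFields F n) :
    pdField i f ∈ evenFields F n := by
  rw [mem_evenFields] at hf ⊢
  intro r
  have := pd_mem_parityPart (Sum.inl i) (hf r)
  rwa [show (mu (Sum.inl i : Idx n) : ZMod 2) = 0 by simp [mu], add_zero] at this

theorem pdField_pow_mem (i : Fin n) (k : ℕ) {f : Idx n → O F n} (hf : f ∈ evenFields F n) :
    (pdField i ^ k) f ∈ evenFields F n := by
  induction k generalizing f with
  | zero => simpa
  | succ k ih => rw [pow_succ]; exact ih (pdField_mem i hf)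

theorem pdField_pow_mem_trunc {p : ℕ} {t : Fin n → ℕ} (i : Fin n) (k : ℕ) {f : Idx n → O F n}
    (hf : ∀ r, f r ∈ trunc F p t) (r : Idx n) : (pdField i ^ k) f r ∈ trunc F p t := by
  induction k generalizing f with
  | zero => simpa using hf r
  | succ k ih => rw [pow_succ]; exact ih fun r => pd_mem_trunc _ (hf r)

theorem vectorField_single (i : Fin n) :
    vectorField F (Pi.single (Sum.inl i) (mono F (0, ∅))) = pd F (Sum.inl i) := by
  refine LinearMap.ext fun g => ?_
  rw [vectorField_apply, Finset.sum_eq_single (Sum.inl i)]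
  · rw [Pi.single_eq_same, one_mul']
  · intro s _ hs; rw [Pi.single_eq_of_ne hs]; simp
  · simp

theorem pd_one (r : Idx n) : pd F r (mono F (0, ∅)) = 0 := by
  rw [pd_mono]; rcases r with i | i <;> simp [partialMono]

theorem br_single (i : Fin n) (f : Idx n → O F n) :
    br (Pi.single (Sum.inl i) (mono F (0, ∅))) f = pdField i f := by
  ext s : 1
  rw [br_apply, vectorField_single, pdField_apply]
  convert sub_zero _
  by_cases h : s = Sum.inl i
  · subst h
    rw [Pi.single_eq_same, vectorField_apply]
    exact Finset.sum_eq_zero fun r _ => by rw [pd_one, map_zero]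
  · rw [Pi.single_eq_of_ne h, map_zero]

theorem single_mem (i : Fin n) :
    Pi.single (Sum.inl i) (mono F (0, ∅)) ∈ evenFields F n := by
  rw [mem_evenFields]
  intro r
  by_cases h : r = Sum.inl i
  · subst h; rw [Pi.single_eq_same]; exact mono_mem_parityPart (by simp [mu])
  · rw [Pi.single_eq_of_ne h]; exact zero_mem _

theorem vectorField_pdField_pow (i : Fin n) (k : ℕ) {f : Idx n → O F n}
    (hf : f ∈ evenFields F n) : vectorField F ((pdField i ^ k) f) =
      (LieAlgebra.ad F (Module.End F (O F n)) (pd F (Sum.inl i)) ^ k) (vectorField F f) := by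
  induction k generalizing f with
  | zero => simp
  | succ k ih =>
    rw [pow_succ, Module.End.mul_apply, ih (pdField_mem i hf), pow_succ, Module.End.mul_apply,
      LieAlgebra.ad_apply, ← br_single, vectorField_br (single_mem i) hf, vectorField_single]

/-- Left and right multiplication by x commute, so the Frobenius identity applies to their
difference ad x. Hence p-power iterates of ad x are again derivations. -/
theorem ad_pow_char {A : Type*} [Ring A] [Algebra F A] (p : ℕ) [Fact p.Prime] [CharP F p]
    (x : A) (k : ℕ) : LieAlgebra.ad F A x ^ p ^ k = LieAlgebra.ad F A (x ^ p ^ k) := by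
  have e := congrFun (LieAlgebra.ad_eq_lmul_left_sub_lmul_right (R := F) A)
  simp only [Pi.sub_apply] at e
  rcases subsingleton_or_nontrivial A with h | h
  · exact LinearMap.ext fun y => Subsingleton.elim _ _
  have : CharP (Module.End F A) p := charP_of_injective_algebraMap' F p
  rw [e, e, sub_pow_char_pow_of_commute _ _ (LinearMap.commute_mulLeft_right x x),
    LinearMap.pow_mulLeft, LinearMap.pow_mulRight]

theorem pdField_pow_br (p : ℕ) [Fact p.Prime] [CharP F p] (i : Fin n) (k : ℕ)
    {f g : Idx n → O F n} (hf : f ∈ evenFields F n) (hg : g ∈ evenFields F n) :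
    (pdField i ^ p ^ k) (br f g) = br ((pdField i ^ p ^ k) f) g + br f ((pdField i ^ p ^ k) g) := by
  apply vectorField_injective
  rw [map_add, vectorField_pdField_pow i _ (br_mem hf hg),
    vectorField_br (pdField_pow_mem i _ hf) hg, vectorField_br hf (pdField_pow_mem i _ hg),
    vectorField_pdField_pow i _ hf, vectorField_pdField_pow i _ hg, vectorField_br hf hg,
    ad_pow_char p]
  simp only [LieAlgebra.ad_apply]
  rw [leibniz_lie]

/-! ### Explicit brackets of monomials -/

theorem binom_zero_left (β : Fin n → ℕ) : binom 0 β = 1 := by simp [binom]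

theorem binom_zero_right (β : Fin n → ℕ) : binom β 0 = 1 := by simp [binom]

theorem binom_single_left (c : ℕ) (j : Fin n) (β : Fin n → ℕ) :
    binom (Pi.single j c) β = (c + β j).choose c := by
  rw [binom, Finset.prod_eq_single j]
  · simp
  · intro i _ hi; simp [hi]
  · simp

theorem binom_single_right (c : ℕ) (j : Fin n) (β : Fin n → ℕ) :
    binom β (Pi.single j c) = (β j + c).choose c := by
  rw [binom, Finset.prod_eq_single j]
  · simp [Nat.choose_symm_add]
  · intro i _ hi; simp [hi]
  · simp

theorem poisson_eq (a b : O F n) : poisson a b = ∑ i, (mul F (pd F (Sum.inl i) a)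
    (pd F (Sum.inr i) b) - mul F (pd F (Sum.inr i) a) (pd F (Sum.inl i) b)) := by
  rw [poisson_apply, vectorField_apply, Fintype.sum_sum_type, Finset.sum_sub_distrib]
  simp [sub_eq_add_neg, add_comm]

theorem pd_inl_mono (i : Fin n) (α : Fin n → ℕ) (u : Finset (Fin n)) :
    pd F (Sum.inl i) (mono F (α, u)) =
      if α i = 0 then 0 else mono F (α - Pi.single i 1, u) := by
  rw [pd_mono]; rfl

theorem pd_inr_mono (i : Fin n) (α : Fin n → ℕ) (u : Finset (Fin n)) :
    pd F (Sum.inr i) (mono F (α, u)) = if i ∈ u then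
      ((-1) ^ (u.filter (· < i)).card : F) • mono F (α, u.erase i) else 0 := by
  rw [pd_mono]; rfl

theorem pd_inr_mono_singleton (i j : Fin n) (α : Fin n → ℕ) :
    pd F (Sum.inr i) (mono F (α, {j})) = if i = j then mono F (α, ∅) else 0 := by
  rw [pd_inr_mono]
  by_cases h : i = j
  · subst h; simp [Finset.filter_singleton]
  · simp [h]

theorem mul_mono_empty_left (α β : Fin n → ℕ) (u : Finset (Fin n)) :
    mul F (mono F (α, ∅)) (mono F (β, u)) = (binom α β : F) • mono F (α + β, u) := by
  rw [mul_mono, mulMono_pair (Finset.disjoint_empty_left u)]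
  simp [inv]

theorem mul_mono_empty_right (α β : Fin n → ℕ) (u : Finset (Fin n)) :
    mul F (mono F (α, u)) (mono F (β, ∅)) = (binom α β : F) • mono F (α + β, u) := by
  rw [mul_mono, mulMono_pair (Finset.disjoint_empty_right u)]
  simp [inv]

/-- The sign of the left derivative is the sign of moving x_{j'} back into its place, so the two
cancel. -/
theorem mul_singleton_pd {j : Fin n} {u : Finset (Fin n)} (h : j ∈ u) (γ β : Fin n → ℕ) :
    mul F (mono F (γ, {j})) (pd F (Sum.inr j) (mono F (β, u))) =
      (binom γ β : F) • mono F (γ + β, u) := by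
  rw [pd_inr_mono, if_pos h, map_smul, mul_mono, mulMono_pair (by simp), smul_smul]
  have e : inv {j} (u.erase j) = (u.filter (· < j)).card := by
    rw [inv, Finset.sum_singleton, Finset.filter_erase, Finset.erase_eq_of_notMem (by simp)]
  have e2 : {j} ∪ u.erase j = u := by
    rw [← Finset.insert_eq, Finset.insert_erase h]
  rw [e, e2, ← mul_assoc, ← pow_add, Even.neg_one_pow ⟨_, rfl⟩, one_mul]

theorem mul_singleton_pd_of_ne {i j : Fin n} {u : Finset (Fin n)} (h : j ∈ u) (hij : i ≠ j)
    (γ β : Fin n → ℕ) : mul F (mono F (γ, {j})) (pd F (Sum.inr i) (mono F (β, u))) = 0 := by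
  rw [pd_inr_mono]
  split_ifs with hi
  · rw [map_smul, mul_mono, mulMono_of_not_disjoint (by simp [h, hij.symm]), smul_zero]
  · simp

theorem poisson_singleton (α : Fin n → ℕ) (j : Fin n) (g : O F n) :
    poisson (mono F (α, {j})) g = ∑ i, mul F (pd F (Sum.inl i) (mono F (α, {j})))
      (pd F (Sum.inr i) g) - mul F (mono F (α, ∅)) (pd F (Sum.inl j) g) := by
  rw [poisson_eq, Finset.sum_sub_distrib]
  congr 1
  rw [Finset.sum_eq_single j]
  · simp only [pd_inr_mono_singleton, if_true]
  · intro i _ hi; rw [pd_inr_mono_singleton, if_neg hi]; simp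
  · simp

theorem mul_empty_pd_inl (α β : Fin n → ℕ) (j : Fin n) (u : Finset (Fin n)) :
    mul F (mono F (α, ∅)) (pd F (Sum.inl j) (mono F (β, u))) = if β j = 0 then 0 else
      (binom α (β - Pi.single j 1) : F) • mono F (α + (β - Pi.single j 1), u) := by
  rw [pd_inl_mono]
  split_ifs
  · simp
  · rw [mul_mono_empty_left]

theorem poisson_singleton_singleton (α β : Fin n → ℕ) (j l : Fin n) :
    poisson (mono F (α, {j})) (mono F (β, {l})) =
      (if α l = 0 then 0 else
        (binom (α - Pi.single l 1) β : F) • mono F (α - Pi.single l 1 + β, {j})) -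
      (if β j = 0 then 0 else
        (binom α (β - Pi.single j 1) : F) • mono F (α + (β - Pi.single j 1), {l})) := by
  rw [poisson_singleton, mul_empty_pd_inl]
  congr 1
  rw [Finset.sum_eq_single l]
  · simp only [pd_inr_mono_singleton, if_true, pd_inl_mono]
    split_ifs
    · simp
    · rw [mul_mono_empty_right]
  · intro i _ hi; rw [pd_inr_mono_singleton, if_neg hi, map_zero]
  · simp

theorem poisson_singleton_of_mem {j : Fin n} {u : Finset (Fin n)} (h : j ∈ u)
    (α β : Fin n → ℕ) : poisson (mono F (α, {j})) (mono F (β, u)) =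
      (if α j = 0 then 0 else
        (binom (α - Pi.single j 1) β : F) • mono F (α - Pi.single j 1 + β, u)) -
      (if β j = 0 then 0 else
        (binom α (β - Pi.single j 1) : F) • mono F (α + (β - Pi.single j 1), u)) := by
  rw [poisson_singleton, mul_empty_pd_inl]
  congr 1
  rw [Finset.sum_eq_single j]
  · rw [pd_inl_mono]
    split_ifs
    · simp
    · rw [mul_singleton_pd h]
  · intro i _ hi
    rw [pd_inl_mono]
    split_ifs
    · simp
    · rw [mul_singleton_pd_of_ne h hi]
  · simp

theorem poisson_const_singleton (i : Fin n) (a : O F n) :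
    poisson (mono F (0, {i})) a = - pd F (Sum.inl i) a := by
  rw [poisson_singleton, one_mul', Finset.sum_eq_zero, zero_sub]
  intro l _
  rw [pd_inl_mono]; simp

theorem ham_const_singleton (i : Fin n) :
    ham (mono F ((0 : Fin n → ℕ), {i})) = - Pi.single (Sum.inl i) (mono F (0, ∅)) := by
  ext r : 1
  rcases r with j | j
  · rw [ham_inl, pd_inr_mono_singleton]
    by_cases h : j = i
    · subst h; simp
    · simp [h]
  · rw [ham_inr, pd_inl_mono]; simp

theorem br_ham_const (i : Fin n) (f : Idx n → O F n) :
    br (ham (mono F ((0 : Fin n → ℕ), {i}))) f = - pdField i f := by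
  rw [ham_const_singleton, map_neg, LinearMap.neg_apply, br_single]

/-! ### The torus and its weights -/

/-- `x_i x_{i'}`; the fields `T_H(x_i x_{i'})` span a torus. -/
abbrev toral (i : Fin n) : Mono n := (Pi.single i 1, {i})

/-- The weight of a monomial with respect to `T_H(x_i x_{i'})`. -/
def wt (F : Type*) [Field F] {n : ℕ} (i : Fin n) (a : Mono n) : F :=
  (if i ∈ a.2 then 1 else 0) - a.1 i

/-- The weight of `∂_r` with respect to `T_H(x_i x_{i'})`. -/
def wtPd (F : Type*) [Field F] {n : ℕ} (i : Fin n) : Idx n → F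
  | Sum.inl j => if j = i then 1 else 0
  | Sum.inr j => if j = i then -1 else 0

theorem poisson_toral_mono (i : Fin n) (a : Mono n) :
    poisson (mono F (toral i)) (mono F a) = wt F i a • mono F a := by
  obtain ⟨β, u⟩ := a
  have e1 : β i ≠ 0 → Pi.single i 1 + (β - Pi.single i 1) = β := by
    intro h
    ext j
    by_cases hj : j = i
    · subst hj; simp; omega
    · simp [hj]
  have e2 : β i ≠ 0 → 1 + (β i - 1) = β i := by omega
  by_cases h : i ∈ u
  · rw [poisson_singleton_of_mem h]
    by_cases hb : β i = 0
    · simp [hb, wt, h, binom_zero_left]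
    · simp [hb, wt, h, binom_zero_left, binom_single_left, e1 hb, e2 hb, sub_smul]
  · rw [poisson_singleton, mul_empty_pd_inl, Finset.sum_eq_zero]
    · by_cases hb : β i = 0
      · simp [hb, wt, h]
      · simp [hb, wt, h, binom_single_left, e1 hb, e2 hb]
    · intro l _
      by_cases hl : l = i
      · subst hl; rw [pd_inr_mono, if_neg h, map_zero]
      · rw [pd_inl_mono]; simp [hl]

theorem coeff_poisson_toral (i : Fin n) (a : Mono n) (f : O F n) :
    coeff a (poisson (mono F (toral i)) f) = wt F i a * coeff a f := by
  induction f using mono_induction with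
  | hadd f₁ f₂ h₁ h₂ => simp only [map_add, h₁, h₂, mul_add]
  | hsmul c f h => simp only [map_smul, h, smul_eq_mul]; ring
  | hmono b =>
    rw [poisson_toral_mono, map_smul, coeff_mono, smul_eq_mul]
    split_ifs with h
    · rw [h]
    · simp

theorem ham_toral (i : Fin n) (r : Idx n) :
    ham (mono F (toral i)) r = - wtPd F i r • mono F (gen r) := by
  rcases r with j | j
  · rw [ham_inl, pd_inr_mono_singleton]
    by_cases h : j = i
    · subst h; simp [wtPd, gen]
    · simp [wtPd, h]
  · rw [ham_inr, pd_inl_mono]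
    by_cases h : j = i
    · subst h; simp [wtPd, gen]
    · simp [wtPd, h]

/-- The torus acts diagonally on the fields x^(α) x^u ∂_r. All weight arguments below are
comparisons of coefficients through this formula. -/
theorem coeff_br_toral (i : Fin n) (f : Idx n → O F n) (r : Idx n) (a : Mono n) :
    coeff a (br (ham (mono F (toral i))) f r) = (wt F i a + wtPd F i r) * coeff a (f r) := by
  rw [br_apply, ham_toral, map_smul, vectorField_gen, ← poisson_apply, map_sub,
    coeff_poisson_toral, map_smul, smul_eq_mul]
  ring

theorem mono_mem_oddTrunc {p : ℕ} {t : Fin n → ℕ} {α : Fin n → ℕ} {u : Finset (Fin n)}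
    (h : ∀ i, α i ≤ p ^ t i - 1) (hu : Odd u.card) : mono F (α, u) ∈ oddTrunc F p t :=
  ⟨mono_mem_trunc h, mono_mem_parityPart (ZMod.natCast_eq_one_iff_odd.2 hu)⟩

/-! ### Derivations in terms of coefficients -/

/-- Linear maps that are derivations on the odd part of `𝒪(n,n;t)` with values in even vector
fields. -/
structure IsDer (p : ℕ) (t : Fin n → ℕ) (D : O F n →ₗ[F] (Idx n → O F n)) : Prop where
  mem : ∀ a ∈ oddTrunc F p t, D a ∈ evenFields F n
  leibniz : ∀ a ∈ oddTrunc F p t, ∀ b ∈ oddTrunc F p t,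
    D (poisson a b) = br (ham a) (D b) - br (ham b) (D a)

/-- The inner derivation of the even vector field with coefficients `w`. -/
noncomputable def inner (w : Idx n → O F n) : O F n →ₗ[F] (Idx n → O F n) := br w ∘ₗ ham

theorem inner_apply (w : Idx n → O F n) (a : O F n) : inner w a = br w (ham a) := rfl

theorem inner_add (v w : Idx n → O F n) : inner (v + w) = inner v + inner w := by
  ext; simp [inner_apply]

/-- The map `(ad ∂_i) ^ k` on Hamiltonian fields. -/
noncomputable def adPow (i : Fin n) (k : ℕ) : O F n →ₗ[F] (Idx n → O F n) :=
  (pdField i ^ k) ∘ₗ ham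

theorem adPow_apply (i : Fin n) (k : ℕ) (a : O F n) : adPow i k a = (pdField i ^ k) (ham a) := rfl

section

variable {p : ℕ} {t : Fin n → ℕ} {D E : O F n →ₗ[F] (Idx n → O F n)}

theorem IsDer.sub (hD : IsDer p t D) (hE : IsDer p t E) : IsDer p t (D - E) where
  mem a ha := sub_mem (hD.mem a ha) (hE.mem a ha)
  leibniz a ha b hb := by
    simp only [LinearMap.sub_apply, hD.leibniz a ha b hb, hE.leibniz a ha b hb, map_sub]
    abel

theorem IsDer.smul (c : F) (hD : IsDer p t D) : IsDer p t (c • D) where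
  mem a ha := Submodule.smul_mem _ _ (hD.mem a ha)
  leibniz a ha b hb := by
    simp only [LinearMap.smul_apply, hD.leibniz a ha b hb, map_smul, smul_sub]

theorem IsDer.sum {ι : Type*} (s : Finset ι) {E : ι → O F n →ₗ[F] (Idx n → O F n)}
    (hE : ∀ i ∈ s, IsDer p t (E i)) : IsDer p t (∑ i ∈ s, E i) where
  mem a ha := by
    rw [LinearMap.sum_apply]
    exact sum_mem fun i hi => (hE i hi).mem a ha
  leibniz a ha b hb := by
    simp only [LinearMap.sum_apply, map_sum, ← Finset.sum_sub_distrib]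
    exact Finset.sum_congr rfl fun i hi => (hE i hi).leibniz a ha b hb

theorem isDer_inner {w : Idx n → O F n} (hw : w ∈ evenFields F n) : IsDer p t (inner w) where
  mem a ha := br_mem hw (ham_mem ha.2)
  leibniz a ha b hb := by
    rw [inner_apply, ham_poisson ha.2 hb.2, br_jacobi hw (ham_mem ha.2) (ham_mem hb.2),
      inner_apply, inner_apply, br_swap (br w (ham a))]
    abel

theorem isDer_adPow [Fact p.Prime] [CharP F p] (i : Fin n) (k : ℕ) :
    IsDer p t (adPow (F := F) i (p ^ k)) where
  mem a ha := pdField_pow_mem i _ (ham_mem ha.2)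
  leibniz a ha b hb := by
    rw [adPow_apply, ham_poisson ha.2 hb.2, pdField_pow_br p i k (ham_mem ha.2) (ham_mem hb.2),
      adPow_apply, adPow_apply, br_swap _ (ham b)]
    abel

end

/-! ### Potentials: closed systems for ∂_i and for the torus -/

/-- Poincaré lemma for divided powers, valid since exponents are unbounded. The second conclusion
makes g inherit parity from the f_i. -/
theorem exists_potential (f : Fin n → O F n)
    (h : ∀ i j, pd F (Sum.inl i) (f j) = pd F (Sum.inl j) (f i)) :
    ∃ g : O F n, (∀ i, pd F (Sum.inl i) g = f i) ∧
      ∀ a, coeff a g ≠ 0 → ∃ i b, coeff b (f i) ≠ 0 ∧ b.2 = a.2 := by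
  classical
  choose s hs using fun i => coeff_support_finite (f i)
  -- The coefficient of g at a is read from f_i at a - ε_i for any i with a_i ≠ 0; closedness makes
  -- the choice of i irrelevant. The constants of integration are 0.
  let φ : Mono n → F := fun a =>
    if h : ∃ i, a.1 i ≠ 0 then coeff (a.1 - Pi.single h.choose 1, a.2) (f h.choose) else 0
  obtain ⟨g, hg⟩ := exists_coeff (Finset.univ.biUnion fun i =>
    (s i).image fun b : Mono n => (b.1 + Pi.single i 1, b.2)) φ (by
      intro a ha
      simp only [φ] at ha
      split_ifs at ha with hi
      · refine Finset.mem_biUnion.2 ⟨hi.choose, Finset.mem_univ _, Finset.mem_image.2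
          ⟨_, hs _ _ ha, Prod.ext ?_ rfl⟩⟩
        ext j
        by_cases hj : j = hi.choose
        · have := hi.choose_spec
          rw [← hj] at this ⊢
          simp; omega
        · simp [hj]
      · exact absurd rfl ha)
  refine ⟨g, fun j => ext_coeff fun a => ?_, fun a ha => ?_⟩
  · obtain ⟨α, u⟩ := a
    rw [coeff_pd_inl, hg]
    have hi : ∃ i, (α + Pi.single j 1 : Fin n → ℕ) i ≠ 0 := ⟨j, by simp⟩
    simp only [φ]
    rw [dif_pos hi]
    have hsp := hi.choose_spec
    generalize hi.choose = i at hsp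
    by_cases hij : i = j
    · subst hij; simp
    · have e : α + Pi.single j 1 - Pi.single i 1 = α - Pi.single i 1 + Pi.single j 1 := by
        ext k
        by_cases hk : k = i
        · subst hk; simp [hij]
        · simp [hk]
      have e2 : α - Pi.single i 1 + Pi.single i 1 = α := by
        ext k
        by_cases hk : k = i
        · subst hk; simp [hij] at hsp; simp; omega
        · simp [hk]
      rw [e, ← coeff_pd_inl, ← h i j, coeff_pd_inl, e2]
  · rw [hg] at ha
    simp only [φ] at ha
    split_ifs at ha with hi
    · exact ⟨_, _, ha, rfl⟩
    · exact absurd rfl ha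

theorem exists_field_potential (f : Fin n → Idx n → O F n) (hf : ∀ i, f i ∈ evenFields F n)
    (h : ∀ i j, pdField i (f j) = pdField j (f i)) :
    ∃ w ∈ evenFields F n, ∀ i, pdField i w = f i := by
  choose w hw hw' using fun r => exists_potential (fun i => f i r) fun i j => congrFun (h i j) r
  refine ⟨w, mem_evenFields.2 fun r => mem_parityPart_iff.2 fun a ha => ?_,
    fun i => funext fun r => hw r i⟩
  obtain ⟨i, b, hb, e⟩ := hw' r a ha
  rw [← e]
  exact mem_parityPart_iff.1 (mem_evenFields.1 (hf i) r) b hb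

/-- A 1-cocycle of a diagonally acting abelian algebra is a coboundary outside the weight 0: at a
nonzero weight one divides by one of its components, and the cocycle identity takes care of the
others. What remains of z commutes with the torus. The condition on the support of w ensures that w
has constant coefficients when the z_i do. -/
theorem exists_toral_potential (z : Fin n → Idx n → O F n) (hz : ∀ i, z i ∈ evenFields F n)
    (h : ∀ i j, br (ham (mono F (toral i))) (z j) = br (ham (mono F (toral j))) (z i)) :
    ∃ w ∈ evenFields F n, (∀ r a, (∀ j, coeff a (z j r) = 0) → coeff a (w r) = 0) ∧
      ∀ i j, br (ham (mono F (toral j))) (z i + br (ham (mono F (toral i))) w) = 0 := by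
  classical
  have h' : ∀ i j r a, (wt F i a + wtPd F i r) * coeff a (z j r) =
      (wt F j a + wtPd F j r) * coeff a (z i r) := fun i j r a => by
    rw [← coeff_br_toral, h, coeff_br_toral]
  let φ : Idx n → Mono n → F := fun r a => if h : ∃ i, wt F i a + wtPd F i r ≠ 0 then
    - coeff a (z h.choose r) / (wt F h.choose a + wtPd F h.choose r) else 0
  have hφ : ∀ r a, (∀ j, coeff a (z j r) = 0) → φ r a = 0 := by
    intro r a h0
    simp only [φ]
    split_ifs
    · rw [h0]; simp
    · rfl
  choose s hs using fun i r => coeff_support_finite (z i r)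
  choose w hw using fun r => exists_coeff (Finset.univ.biUnion fun i => s i r) (φ r) (by
    intro a ha
    by_contra hc
    simp only [Finset.mem_biUnion, Finset.mem_univ, true_and, not_exists] at hc
    exact ha (hφ r a fun j => by_contra fun hj => hc j (hs j r a hj)))
  have hw0 : ∀ r a, (∀ j, coeff a (z j r) = 0) → coeff a (w r) = 0 := fun r a h0 => by
    rw [hw, hφ r a h0]
  refine ⟨w, mem_evenFields.2 fun r => mem_parityPart_iff.2 fun a ha => ?_, hw0,
    fun i j => funext fun r => ext_coeff fun a => ?_⟩
  · have : ∃ j, coeff a (z j r) ≠ 0 := by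
      by_contra hc
      push Not at hc
      exact ha (hw0 r a hc)
    obtain ⟨j, hj⟩ := this
    exact mem_parityPart_iff.1 (mem_evenFields.1 (hz j) r) a hj
  · rw [coeff_br_toral, Pi.add_apply, map_add, coeff_br_toral, hw, Pi.zero_apply, map_zero]
    simp only [φ]
    split_ifs with hk
    · have hsp := hk.choose_spec
      have e := h' hk.choose i r a
      generalize hk.choose = k at hsp e
      have : coeff a (z i r) + (wt F i a + wtPd F i r) *
          (- coeff a (z k r) / (wt F k a + wtPd F k r)) = 0 := by
        field_simp
        linear_combination e
      rw [this, mul_zero]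
    · push Not at hk
      rw [hk, zero_mul]

/-! ### Weights of constant fields as integers -/

/-- The weight of `x^v ∂_r`, as an integer. -/
def wtInt (i : Fin n) (v : Finset (Fin n)) : Idx n → ℤ
  | Sum.inl j => (if i ∈ v then 1 else 0) + (if j = i then 1 else 0)
  | Sum.inr j => (if i ∈ v then 1 else 0) - (if j = i then 1 else 0)

theorem wtInt_cast (i : Fin n) (v : Finset (Fin n)) (r : Idx n) :
    (wtInt i v r : F) = wt F i (0, v) + wtPd F i r := by
  rcases r with j | j <;> simp only [wtInt, wt, wtPd] <;> split_ifs <;> norm_num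

theorem wtInt_bounds (i : Fin n) (v : Finset (Fin n)) (r : Idx n) :
    -1 ≤ wtInt i v r ∧ wtInt i v r ≤ 2 := by
  rcases r with j | j <;> simp only [wtInt] <;> split_ifs <;> simp

/-- Weights of fields x^v ∂_r lie in [-1, 2] and the integers compared with them in [-2, 1].
Differences are thus at most 4 in absolute value, while p ≥ 5; this is where p > 3 enters the weight
arguments. -/
theorem int_eq_of_cast_eq {p : ℕ} [CharP F p] (hp : 3 < p) (hp' : p.Prime) {x y : ℤ} (h : (x : F) = y)
    (h1 : x - y ≤ 4) (h2 : -4 ≤ x - y) : x = y := by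
  have h5 : 5 ≤ p := by
    rcases Nat.lt_or_ge p 5 with h | h
    · interval_cases p; revert hp'; decide
    · exact h
  have : ((x - y : ℤ) : F) = 0 := by push_cast; rw [h, sub_self]
  rw [CharP.intCast_eq_zero_iff F p] at this
  obtain ⟨c, hc⟩ := this
  have : c = 0 := by
    by_contra hne
    rcases lt_or_gt_of_ne hne with h | h <;> nlinarith
  subst this
  linarith

theorem wtInt_eq_zero {v : Finset (Fin n)} {r : Idx n} (h : ∀ i, wtInt i v r = 0) :
    ∃ k, r = Sum.inr k ∧ v = {k} := by
  rcases r with k | k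
  · have := h k; simp only [wtInt] at this; grind
  · refine ⟨k, rfl, ?_⟩
    ext i
    have := h i
    simp only [wtInt] at this
    rw [Finset.mem_singleton]
    grind

theorem wtInt_eq_sub {v : Finset (Fin n)} {r : Idx n} {i j : Fin n} (hij : i ≠ j)
    (h : ∀ k, wtInt k v r = (if k = j then 1 else 0) - (if k = i then 1 else 0)) :
    r = Sum.inr i ∧ v = {j} := by
  rcases r with k | k
  · have := h i; simp only [wtInt] at this; grind
  · have hk : k = i := by
      have := h i; simp only [wtInt] at this; grind
    subst hk
    refine ⟨rfl, ?_⟩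
    ext l
    have := h l
    simp only [wtInt] at this
    rw [Finset.mem_singleton]
    grind

/-- The other fields with these weights are x^v ∂_{k'} with v = u ∪ {k}, k ∉ u. They are excluded by
parity, as |v| would be even. -/
theorem wtInt_eq_indicator {v u : Finset (Fin n)} {r : Idx n} (hu : Odd u.card)
    (hv : (v.card : ZMod 2) = mu r) (h : ∀ k, wtInt k v r = if k ∈ u then 1 else 0) :
    ∃ k ∈ u, r = Sum.inl k ∧ v = u.erase k := by
  rcases r with k | k
  · refine ⟨k, ?_, rfl, ?_⟩
    · have := h k; simp only [wtInt] at this; grind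
    · ext l
      have := h l
      simp only [wtInt] at this
      rw [Finset.mem_erase]
      grind
  · exfalso
    have hk : k ∉ u := by
      have := h k; simp only [wtInt] at this; grind
    have e : v = insert k u := by
      ext l
      have := h l
      simp only [wtInt] at this
      rw [Finset.mem_insert]
      grind
    rw [e, Finset.card_insert_of_notMem hk, Nat.cast_add, ZMod.natCast_eq_one_iff_odd.2 hu] at hv
    simp [mu] at hv

/-- Only ∂_{i'} has these weights, and it is odd. -/
theorem wtInt_ne_neg {v : Finset (Fin n)} {r : Idx n} {i : Fin n}
    (hv : (v.card : ZMod 2) = mu r) (h : ∀ k, wtInt k v r = if k = i then -1 else 0) : False := by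
  rcases r with k | k
  · have := h i; simp only [wtInt] at this; grind
  · have hk : k = i := by
      have := h i; simp only [wtInt] at this; grind
    subst hk
    have e : v = ∅ := by
      ext l
      have := h l
      simp only [wtInt] at this
      grind
    rw [e] at hv
    simp [mu] at hv

/-- A negative weight can come only from the factor ∂_{k'}, at the index k. -/
theorem wtInt_neg_unique {v : Finset (Fin n)} {r : Idx n} {i l : Fin n}
    (h1 : wtInt i v r = -1) (h2 : wtInt l v r = -1) : i = l := by
  rcases r with k | k <;> simp only [wtInt] at h1 h2 <;> grind

/-! ### Odd Euler fields and the centralizer of the even Hamiltonian fields -/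

/-- The even vector field `∑_k c_k x_{k'} ∂_{k'}`. -/
noncomputable def oddEuler (c : Fin n → F) : Idx n → O F n :=
  Sum.elim (fun _ => 0) fun k => c k • mono F (0, {k})

@[simp] theorem oddEuler_inl (c : Fin n → F) (k : Fin n) : oddEuler c (Sum.inl k) = 0 := rfl

@[simp] theorem oddEuler_inr (c : Fin n → F) (k : Fin n) :
    oddEuler c (Sum.inr k) = c k • mono F (0, {k}) := rfl

theorem oddEuler_mem (c : Fin n → F) : oddEuler c ∈ evenFields F n := by
  rw [mem_evenFields]
  rintro (k | k)
  · exact zero_mem _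
  · exact Submodule.smul_mem _ _ (mono_mem_parityPart (by simp [mu]))

theorem vectorField_oddEuler (c : Fin n → F) (α : Fin n → ℕ) (u : Finset (Fin n)) :
    vectorField F (oddEuler c) (mono F (α, u)) = (∑ k ∈ u, c k) • mono F (α, u) := by
  classical
  rw [vectorField_apply, Fintype.sum_sum_type]
  simp only [oddEuler_inl, oddEuler_inr, map_zero, LinearMap.zero_apply, Finset.sum_const_zero,
    zero_add, map_smul, LinearMap.smul_apply]
  rw [Finset.sum_smul, ← Finset.sum_subset (Finset.subset_univ u)]
  · refine Finset.sum_congr rfl fun k hk => ?_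
    rw [mul_singleton_pd hk, binom_zero_left, zero_add, Nat.cast_one, one_smul]
  · intro k _ hk
    rw [pd_inr_mono, if_neg hk, map_zero, smul_zero]

theorem br_oddEuler_inl (c : Fin n → F) (α : Fin n → ℕ) (u : Finset (Fin n)) (i : Fin n) :
    br (oddEuler c) (ham (mono F (α, u))) (Sum.inl i) =
      (∑ k ∈ u.erase i, c k) • ham (mono F (α, u)) (Sum.inl i) := by
  rw [br_apply, oddEuler_inl, map_zero, sub_zero, ham_inl, map_neg, smul_neg, pd_inr_mono]
  split_ifs with h
  · rw [map_smul, vectorField_oddEuler, smul_comm]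
  · simp

theorem br_oddEuler_inr (c : Fin n → F) (α : Fin n → ℕ) (u : Finset (Fin n)) (i : Fin n) :
    br (oddEuler c) (ham (mono F (α, u))) (Sum.inr i) =
      (∑ k ∈ u, c k - c i) • ham (mono F (α, u)) (Sum.inr i) := by
  have e : vectorField F (ham (mono F (α, u))) (mono F (0, {i})) =
      ham (mono F (α, u)) (Sum.inr i) := vectorField_gen _ (Sum.inr i)
  rw [br_apply, oddEuler_inr, map_smul, e, sub_smul, ham_inr]
  congr 1
  rw [pd_inl_mono]
  split_ifs with h
  · simp
  · rw [vectorField_oddEuler]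

theorem pdField_oddEuler (c : Fin n → F) (i : Fin n) : pdField i (oddEuler c) = 0 := by
  ext r : 1
  rw [pdField_apply]
  rcases r with k | k
  · simp
  · rw [oddEuler_inr, map_smul, pd_inl_mono]; simp

theorem exists_card_three (hn : 3 ≤ n) (k : Fin n) : ∃ u : Finset (Fin n), u.card = 3 ∧ k ∈ u := by
  obtain ⟨u, h1, h2⟩ := Finset.exists_superset_card_eq (s := {k}) (n := 3) (by simp) (by simpa)
  exact ⟨u, h2, by simpa using h1⟩

section

variable {p : ℕ} [Fact p.Prime] [CharP F p]

theorem two_ne_zero_of_char (hp : 3 < p) : (2 : F) ≠ 0 := by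
  intro h
  have := int_eq_of_cast_eq (F := F) hp Fact.out (x := 2) (y := 0) (by simpa using h)
    (by norm_num) (by norm_num)
  omega

theorem coeff_eq_zero_of_pdField {z : Idx n → O F n} (h : ∀ i, pdField i z = 0) {r : Idx n}
    {a : Mono n} (ha : a.1 ≠ 0) : coeff a (z r) = 0 := by
  obtain ⟨α, u⟩ := a
  obtain ⟨i, hi⟩ := Function.ne_iff.1 ha
  have e : α = α - Pi.single i 1 + Pi.single i 1 := by
    ext j
    by_cases hj : j = i
    · subst hj; simp at hi; simp; omega
    · simp [hj]
  rw [e, ← coeff_pd_inl, ← pdField_apply, h]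
  simp

/-- Commuting with the ∂_i makes the coefficients of z constant, and commuting with the torus leaves
weight 0, that is z = ∑ c_k x_{k'} ∂_{k'}. For |u| = 3, the ∂_i-component of the bracket with
T_H(x^u) gives ∑_{l ∈ u} c_l = c_i for i ∈ u. Summing over u gives 2 ∑ c_l = 0, so all c_i vanish.
Every index lies in such a u because n ≥ 3. -/
theorem eq_zero_of_centralizes (hp : 3 < p) (hn : 3 ≤ n) {z : Idx n → O F n}
    (h1 : ∀ i, pdField i z = 0)
    (h2 : ∀ i, br (ham (mono F (toral i))) z = 0)
    (h3 : ∀ u : Finset (Fin n), u.card = 3 → br (ham (mono F ((0 : Fin n → ℕ), u))) z = 0) :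
    z = 0 := by
  classical
  have key : ∀ r a, coeff a (z r) ≠ 0 → ∃ k, r = Sum.inr k ∧ a = (0, {k}) := by
    rintro r ⟨α, v⟩ ha
    have hα : α = 0 := by
      by_contra hα
      exact ha (coeff_eq_zero_of_pdField h1 hα)
    subst hα
    have : ∀ i, wtInt i v r = 0 := by
      intro i
      have e := coeff_br_toral i z r (0, v)
      rw [h2, Pi.zero_apply, map_zero] at e
      have e' := (mul_eq_zero.1 e.symm).resolve_right ha
      rw [← wtInt_cast] at e'
      have := wtInt_bounds i v r
      exact int_eq_of_cast_eq hp Fact.out (by simpa using e') (by omega) (by omega)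
    obtain ⟨k, rfl, rfl⟩ := wtInt_eq_zero this
    exact ⟨k, rfl, rfl⟩
  obtain ⟨c, hc⟩ : ∃ c : Fin n → F, z = oddEuler c := by
    refine ⟨fun k => coeff (0, {k}) (z (Sum.inr k)), funext fun r => ext_coeff fun a => ?_⟩
    rcases r with k | k
    · rw [oddEuler_inl, map_zero]
      by_contra hne
      obtain ⟨l, hl, -⟩ := key _ _ hne
      cases hl
    · rw [oddEuler_inr, map_smul, coeff_mono, smul_eq_mul]
      split_ifs with h
      · rw [h, mul_one]
      · rw [mul_zero]
        by_contra hne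
        obtain ⟨l, hl, rfl⟩ := key _ _ hne
        cases hl
        exact h rfl
  subst hc
  have hc0 : ∀ k, c k = 0 := by
    intro k
    obtain ⟨u, hu, hku⟩ := exists_card_three hn k
    have hs : ∀ i ∈ u, ∑ l ∈ u, c l - c i = 0 := by
      intro i hi
      have e := congrFun (h3 u hu) (Sum.inl i)
      rw [br_swap, Pi.neg_apply, br_oddEuler_inl, ham_inl, pd_inr_mono, if_pos hi] at e
      have e' := congrArg (coeff ((0 : Fin n → ℕ), u.erase i)) e
      simp only [map_neg, map_smul, coeff_mono, if_true, smul_eq_mul, Pi.zero_apply, map_zero,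
        mul_eq_zero, mul_one, mul_neg, neg_neg] at e'
      rw [← Finset.sum_erase_eq_sub hi]
      refine e'.resolve_right ?_
      exact pow_ne_zero _ (by simp)
    have hsum : ∑ l ∈ u, c l = 0 := by
      have e := Finset.sum_eq_zero hs
      rw [Finset.sum_sub_distrib, Finset.sum_const, hu] at e
      have h2 := two_ne_zero_of_char (F := F) hp
      have : (2 : F) * ∑ l ∈ u, c l = 0 := by
        rw [← e]; simp only [nsmul_eq_mul]; push_cast; ring
      exact (mul_eq_zero.1 this).resolve_left h2
    have := hs k hku
    rw [hsum] at this
    simpa using this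
  ext r : 1
  rcases r with k | k
  · rfl
  · rw [oddEuler_inr, hc0, zero_smul]; rfl

end

/-! ### Powers of ad ∂_i on monomials, and exchange arguments -/

theorem inner_const (w : Idx n → O F n) (i : Fin n) :
    inner w (mono F (0, {i})) = pdField i w := by
  rw [inner_apply, br_swap, br_ham_const, neg_neg]

theorem pdField_ham (i : Fin n) (a : O F n) : pdField i (ham a) = ham (pd F (Sum.inl i) a) := by
  ext r : 1
  rw [pdField_apply]
  rcases r with j | j <;> simp [pd_comm (Sum.inl i), mu]

theorem adPow_eq (i : Fin n) (m : ℕ) (a : O F n) :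
    adPow i m a = ham ((pd F (Sum.inl i) ^ m) a) := by
  rw [adPow_apply]
  induction m generalizing a with
  | zero => simp
  | succ m ih => rw [pow_succ, Module.End.mul_apply, pdField_ham, ih, pow_succ,
      Module.End.mul_apply]

theorem pd_inl_pow_mono (i : Fin n) (m : ℕ) (α : Fin n → ℕ) (u : Finset (Fin n)) :
    (pd F (Sum.inl i) ^ m) (mono F (α, u)) =
      if α i < m then 0 else mono F (α - Pi.single i m, u) := by
  induction m generalizing α with
  | zero => simp
  | succ m ih =>
    rw [pow_succ, Module.End.mul_apply, pd_inl_mono]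
    by_cases h : α i = 0
    · simp [h]
    · rw [if_neg h, ih]
      have e : (α - Pi.single i 1 : Fin n → ℕ) i < m ↔ α i < m + 1 := by simp; omega
      simp only [e]
      congr 3
      ext j
      by_cases hj : j = i
      · subst hj; simp; omega
      · simp [hj]

theorem adPow_mono_of_lt {i : Fin n} {m : ℕ} {α : Fin n → ℕ} (h : α i < m)
    (u : Finset (Fin n)) : adPow i m (mono F (α, u)) = 0 := by
  rw [adPow_eq, pd_inl_pow_mono, if_pos h, map_zero]

/-- Up to sign, the maps (ad ∂_l)^(p^m) are dual to the coefficients required to vanish in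
`IsNormal.power`. -/
theorem coeff_adPow (p : ℕ) [Fact p.Prime] (i l : Fin n) (k m : ℕ) :
    coeff (0, ∅) (adPow l (p ^ m) (mono F (Pi.single i (p ^ k), {i})) (Sum.inl i)) =
      if l = i ∧ m = k then -1 else 0 := by
  have hpos : ∀ m, 0 < p ^ m := fun m => pow_pos (Fact.out : p.Prime).pos m
  rw [adPow_eq, pd_inl_pow_mono]
  by_cases hl : l = i
  · subst hl
    rw [Pi.single_eq_same]
    split_ifs with h1 h2 h2
    · rw [h2.2] at h1; exact absurd h1 (lt_irrefl _)
    · simp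
    · rw [h2.2, ham_inl, pd_inr_mono_singleton, if_pos rfl, map_neg, coeff_mono, if_pos]
      simp
    · rw [ham_inl, pd_inr_mono_singleton, if_pos rfl, map_neg, coeff_mono, if_neg, neg_zero]
      intro h
      have := congrFun (congrArg Prod.fst h) l
      simp only [Pi.sub_apply, Pi.single_eq_same, Pi.zero_apply] at this
      refine h2 ⟨rfl, ?_⟩
      exact Nat.pow_right_injective (Fact.out : p.Prime).two_le (show p ^ m = p ^ k by omega)
  · rw [Pi.single_eq_of_ne hl, if_pos (hpos m), if_neg (fun h => hl h.1)]
    simp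

/-- `x_i x_{j'}`. -/
abbrev elem (i j : Fin n) : Mono n := (Pi.single i 1, {j})

theorem poisson_single_const {i : Fin n} {v w : Finset (Fin n)} (hi : i ∈ w)
    (hv : Disjoint v (w.erase i)) : ∃ ε : F, ε ≠ 0 ∧
      poisson (mono F (Pi.single i 1, v)) (mono F (0, w)) = ε • mono F (0, v ∪ w.erase i) := by
  refine ⟨(-1) ^ (w.filter (· < i)).card * (-1) ^ inv v (w.erase i),
    mul_ne_zero (pow_ne_zero _ (by simp)) (pow_ne_zero _ (by simp)), ?_⟩
  rw [poisson_eq, Finset.sum_eq_single i]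
  · rw [pd_inl_mono, pd_inl_mono, pd_inr_mono i 0 w, if_pos hi, if_neg (by simp), if_pos (by simp),
      map_zero, sub_zero, map_smul, mul_mono, mulMono_pair hv, smul_smul]
    simp [binom_zero_left]
  · intro l _ hl
    rw [pd_inl_mono, pd_inl_mono, if_pos (by simp [hl]), if_pos (by simp)]
    simp
  · simp

/-- Any set is reached from u₀ by exchanging one element at a time; the induction is on |u \ u₀|. -/
theorem swap_induction {P : Finset (Fin n) → Prop} {u₀ : Finset (Fin n)} (h0 : P u₀)
    (hs : ∀ u, u.card = u₀.card → ∀ r ∈ u, ∀ s ∉ u, P u → P (insert s (u.erase r))) (u : Finset (Fin n))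
    (hu : u.card = u₀.card) : P u := by
  classical
  induction hm : (u \ u₀).card generalizing u with
  | zero =>
    rw [Finset.card_eq_zero, Finset.sdiff_eq_empty_iff_subset] at hm
    rwa [Finset.eq_of_subset_of_card_le hm hu.ge]
  | succ m ih =>
    obtain ⟨r, hr⟩ : (u \ u₀).Nonempty := by rw [← Finset.card_pos]; omega
    obtain ⟨s, hs'⟩ : (u₀ \ u).Nonempty := by
      rw [← Finset.card_pos, Finset.card_sdiff_comm hu.symm]; omega
    rw [Finset.mem_sdiff] at hr hs'
    have hrs : r ≠ s := fun h => hs'.2 (h ▸ hr.1)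
    have hc : (insert s (u.erase r)).card = u₀.card := by
      rw [Finset.card_insert_of_notMem (by simp [hs'.2]), Finset.card_erase_add_one hr.1, hu]
    have hd : insert s (u.erase r) \ u₀ = (u \ u₀).erase r := by
      ext x; simp only [Finset.mem_sdiff, Finset.mem_insert, Finset.mem_erase]
      by_cases h1 : x = s
      · subst h1; simp [hs'.1]
      · simp only [h1, false_or]; tauto
    have h1 := ih (insert s (u.erase r)) hc (by
      rw [hd, Finset.card_erase_of_mem (Finset.mem_sdiff.2 hr), hm]; rfl)
    have h2 := hs _ hc s (by simp) r (by simp [hrs]) h1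
    have e : insert r ((insert s (u.erase r)).erase s) = u := by
      rw [Finset.erase_insert (by simp [hs'.2]), Finset.insert_erase hr.1]
    rwa [e] at h2

/-! ### Normalizing a derivation in low degree by inner derivations -/

section

variable {p : ℕ} {t : Fin n → ℕ} {D : O F n →ₗ[F] (Idx n → O F n)}

theorem le_pow_sub_one (hp : 3 < p) (ht : ∀ i, 1 ≤ t i) (i : Fin n) : 3 ≤ p ^ t i - 1 := by
  have : p ^ 1 ≤ p ^ t i := Nat.pow_le_pow_right (by omega) (ht i)
  rw [pow_one] at this
  omega

theorem const_mem (i : Fin n) : mono F (0, {i}) ∈ oddTrunc F p t :=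
  mono_mem_oddTrunc (fun _ => Nat.zero_le _) (by simp)

theorem elem_mem (hp : 3 < p) (ht : ∀ i, 1 ≤ t i) (i j : Fin n) :
    mono F (elem i j) ∈ oddTrunc F p t := by
  refine mono_mem_oddTrunc (fun l => ?_) (by simp)
  have := le_pow_sub_one hp ht l
  by_cases h : l = i
  · subst h; simp; omega
  · simp [h]

/-- T_H(x_{i'}) = -∂_i, and {x_{i'}, x_{j'}} = 0 says that the fields D(x_{i'}) form a closed
system. Its potential w gives the inner derivation. -/
theorem IsDer.exists_kill_const (hD : IsDer p t D) :
    ∃ w ∈ evenFields F n, ∀ i, (D - inner w) (mono F (0, {i})) = 0 := by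
  obtain ⟨w, hw, h⟩ := exists_field_potential (fun i => D (mono F (0, {i})))
    (fun i => hD.mem _ (const_mem i)) (by
      intro i j
      have := hD.leibniz _ (const_mem i) _ (const_mem j)
      rw [poisson_const_singleton, pd_inl_mono, if_pos (by simp), neg_zero, map_zero,
        br_ham_const, br_ham_const, eq_comm, sub_eq_zero, neg_inj] at this
      exact this)
  refine ⟨w, hw, fun i => ?_⟩
  rw [LinearMap.sub_apply, inner_const, h, sub_self]

theorem IsDer.map_pd (hD : IsDer p t D) (hx : ∀ i, D (mono F (0, {i})) = 0) (i : Fin n)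
    {a : O F n} (ha : a ∈ oddTrunc F p t) : D (pd F (Sum.inl i) a) = pdField i (D a) := by
  have := hD.leibniz _ (const_mem i) a ha
  rwa [poisson_const_singleton, hx, map_zero, sub_zero, br_ham_const, map_neg, neg_inj] at this

theorem IsDer.pdField_mono (hD : IsDer p t D) (hx : ∀ i, D (mono F (0, {i})) = 0)
    {α : Fin n → ℕ} {u : Finset (Fin n)} (ha : mono F (α, u) ∈ oddTrunc F p t)
    (h : ∀ i, α i ≠ 0 → D (mono F (α - Pi.single i 1, u)) = 0) (i : Fin n) :
    pdField i (D (mono F (α, u))) = 0 := by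
  rw [← hD.map_pd hx i ha, pd_inl_mono]
  split_ifs with h0
  · simp
  · exact h i h0

theorem IsDer.pdField_elem (hD : IsDer p t D) (hp : 3 < p) (ht : ∀ i, 1 ≤ t i)
    (hx : ∀ i, D (mono F (0, {i})) = 0) (i j l : Fin n) :
    pdField l (D (mono F (elem i j))) = 0 := by
  refine hD.pdField_mono hx (elem_mem hp ht i j) (fun l hl => ?_) l
  by_cases h : l = i
  · subst h; rw [tsub_self]; exact hx j
  · simp [h] at hl

/-- Weights are preserved, and a monomial whose derivatives are killed has constant image. -/
theorem IsDer.coeff_ne_zero (hD : IsDer p t D) (hp : 3 < p) (ht : ∀ i, 1 ≤ t i)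
    (hx : ∀ i, D (mono F (0, {i})) = 0) (hh : ∀ i, D (mono F (toral i)) = 0)
    {α : Fin n → ℕ} {u : Finset (Fin n)} (ha : mono F (α, u) ∈ oddTrunc F p t)
    (hd : ∀ i, α i ≠ 0 → D (mono F (α - Pi.single i 1, u)) = 0) {r : Idx n} {b : Mono n}
    (hb : coeff b (D (mono F (α, u)) r) ≠ 0) : b.1 = 0 ∧ (b.2.card : ZMod 2) = mu r ∧
      ∀ i, (wtInt i b.2 r : F) = wt F i (α, u) := by
  have h0 : b.1 = 0 := by
    by_contra h0
    exact hb (coeff_eq_zero_of_pdField (hD.pdField_mono hx ha hd) h0)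
  refine ⟨h0, mem_parityPart_iff.1 (mem_evenFields.1 (hD.mem _ ha) r) b hb, fun i => ?_⟩
  have l1 := hD.leibniz _ (elem_mem hp ht i i) _ ha
  rw [hh, map_zero, sub_zero, poisson_toral_mono, map_smul] at l1
  have c1 := congrArg (coeff b) (congrFun l1 r)
  rw [coeff_br_toral, Pi.smul_apply, map_smul, smul_eq_mul] at c1
  rw [wtInt_cast, show ((0 : Fin n → ℕ), b.2) = b by rw [← h0]]
  exact (mul_right_cancel₀ hb c1).symm

variable [Fact p.Prime] [CharP F p]

/-- The torus elements commute, so their images form a cocycle, and removing its potential leaves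
values z of weight 0 with constant coefficients. Such z need not vanish by weight alone; they do
because they also commute with T_H(x^u), |u| = 3, so that `eq_zero_of_centralizes` applies. -/
theorem IsDer.exists_kill_toral (hD : IsDer p t D) (hp : 3 < p) (hn : 3 ≤ n) (ht : ∀ i, 1 ≤ t i)
    (hx : ∀ i, D (mono F (0, {i})) = 0) : ∃ w ∈ evenFields F n,
      (∀ i, (D - inner w) (mono F (0, {i})) = 0) ∧ ∀ i, (D - inner w) (mono F (toral i)) = 0 := by
  obtain ⟨w, hw, hw0, h⟩ := exists_toral_potential (fun i => D (mono F (toral i)))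
    (fun i => hD.mem _ (elem_mem hp ht i i)) (by
      intro i j
      have := hD.leibniz _ (elem_mem hp ht i i) _ (elem_mem hp ht j j)
      rw [poisson_toral_mono, eq_comm] at this
      have e : wt F i (toral j) = 0 := by
        by_cases hij : i = j
        · subst hij; simp [wt]
        · simp [wt, hij]
      rwa [e, zero_smul, map_zero, sub_eq_zero] at this)
  have hwc : ∀ i, pdField i w = 0 := by
    intro i
    ext r : 1
    refine ext_coeff fun ⟨α, u⟩ => ?_
    rw [pdField_apply, coeff_pd_inl, Pi.zero_apply, map_zero]
    refine hw0 _ _ fun j => coeff_eq_zero_of_pdField (hD.pdField_elem hp ht hx j j) ?_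
    intro h0
    have := congrFun h0 i
    simp at this
  have hE := hD.sub (isDer_inner hw)
  have hEx : ∀ i, (D - inner w) (mono F (0, {i})) = 0 := fun i => by
    rw [LinearMap.sub_apply, inner_const, hx, hwc, sub_zero]
  have hEh : ∀ i, (D - inner w) (mono F (toral i)) =
      D (mono F (toral i)) + br (ham (mono F (toral i))) w := fun i => by
    rw [LinearMap.sub_apply, inner_apply, br_swap, sub_neg_eq_add]
  refine ⟨w, hw, hEx, fun i => eq_zero_of_centralizes hp hn (hE.pdField_elem hp ht hEx i i)
    (fun j => by rw [hEh]; exact h i j) fun u hu => ?_⟩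
  have hu' : mono F ((0 : Fin n → ℕ), u) ∈ oddTrunc F p t :=
    mono_mem_oddTrunc (fun _ => Nat.zero_le _) (by rw [hu]; decide)
  have hz := hE.mem _ (elem_mem hp ht i i)
  have hj : br (ham (mono F (toral i))) ((D - inner w) (mono F (toral i))) = 0 := by
    rw [hEh]; exact h i i
  have l1 := hE.leibniz _ (elem_mem hp ht i i) _ hu'
  have l2 := br_jacobi (ham_mem (elem_mem (F := F) hp ht i i).2) (ham_mem hu'.2) hz
  rw [hj, map_zero, add_zero, ← ham_poisson (elem_mem hp ht i i).2 hu'.2] at l2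
  rw [poisson_toral_mono, map_smul] at l1 l2
  rw [map_smul, LinearMap.smul_apply] at l2
  ext r : 1
  refine ext_coeff fun a => ?_
  have c1 := congrArg (coeff a) (congrFun l1 r)
  have c2 := congrArg (coeff a) (congrFun l2 r)
  rw [Pi.sub_apply, map_sub, coeff_br_toral, Pi.smul_apply, map_smul, smul_eq_mul] at c1
  rw [coeff_br_toral, Pi.smul_apply, map_smul, smul_eq_mul] at c2
  rw [Pi.zero_apply, map_zero]
  -- With λ the weight of x^u, the Leibniz rule shows that [T_H(x^u), z] lies in the image of ad
  -- T_H(x_i x_{i'}) - λ, and the Jacobi identity that it lies in its kernel. The operator is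
  -- diagonal, so the bracket is 0.
  by_cases hc : wt F i a + wtPd F i r = wt F i (0, u)
  · rw [hc] at c1
    linear_combination c1
  · exact (mul_eq_zero.1 (show (wt F i a + wtPd F i r - wt F i (0, u)) * _ = 0 by
      linear_combination c2)).resolve_left (sub_ne_zero.2 hc)

/-- For i ≠ j, the only constant field with the weight of x_i x_{j'} is x_{j'} ∂_{i'}. -/
theorem IsDer.map_elem (hD : IsDer p t D) (hp : 3 < p) (ht : ∀ i, 1 ≤ t i)
    (hx : ∀ i, D (mono F (0, {i})) = 0) (hh : ∀ i, D (mono F (toral i)) = 0) (i j : Fin n) :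
    D (mono F (elem i j)) =
      Pi.single (Sum.inr i) (coeff (0, {j}) (D (mono F (elem i j)) (Sum.inr i)) • mono F (0, {j})) := by
  by_cases hij : i = j
  · subst hij; rw [hh]; simp
  have key : ∀ r b, coeff b (D (mono F (elem i j)) r) ≠ 0 → r = Sum.inr i ∧ b = (0, {j}) := by
    rintro r ⟨β, v⟩ hb
    obtain ⟨h1, h2, h3⟩ := hD.coeff_ne_zero hp ht hx hh (elem_mem hp ht i j) (fun l hl => by
      by_cases h : l = i
      · subst h; rw [tsub_self]; exact hx j
      · simp [h] at hl) hb
    obtain rfl : β = 0 := h1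
    obtain ⟨rfl, rfl⟩ := wtInt_eq_sub (v := v) (r := r) hij (by
      intro k
      have hbd := wtInt_bounds k v r
      refine int_eq_of_cast_eq (F := F) hp Fact.out ?_ (by split_ifs <;> omega)
        (by split_ifs <;> omega)
      rw [h3]
      simp only [wt, Finset.mem_singleton, Pi.single_apply]
      split_ifs <;> simp)
    exact ⟨rfl, rfl⟩
  ext r : 1
  refine ext_coeff fun b => ?_
  by_cases hr : r = Sum.inr i
  · subst hr
    rw [Pi.single_eq_same, map_smul, coeff_mono, smul_eq_mul]
    split_ifs with h
    · rw [h, mul_one]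
    · rw [mul_zero]
      by_contra hne
      exact h (key _ _ hne).2.symm
  · rw [Pi.single_eq_of_ne hr, map_zero]
    by_contra hne
    exact hr (key _ _ hne).1

/-- By `map_elem` the unknowns are scalars d_ij. The bracket {x_i x_{j'}, x_j x_{k'}} makes them
additive, d_ik = d_ij + d_jk, so d_ij = d_oj - d_oi for a fixed index o. This is how ∑ d_ok x_{k'}
∂_{k'} acts on x_i x_{j'}. -/
theorem IsDer.exists_kill_elem (hD : IsDer p t D) (hp : 3 < p) (hn : 3 ≤ n) (ht : ∀ i, 1 ≤ t i)
    (hx : ∀ i, D (mono F (0, {i})) = 0) (hh : ∀ i, D (mono F (toral i)) = 0) :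
    ∃ w ∈ evenFields F n, (∀ i, (D - inner w) (mono F (0, {i})) = 0) ∧
      ∀ i j, (D - inner w) (mono F (elem i j)) = 0 := by
  have hm := hD.map_elem hp ht hx hh
  obtain ⟨d, hd⟩ : ∃ d : Fin n → Fin n → F, ∀ i j,
      D (mono F (elem i j)) = Pi.single (Sum.inr i) (d i j • mono F (0, {j})) := ⟨_, hm⟩
  have hd0 : ∀ i, d i i = 0 := by
    intro i
    have := congrArg (coeff (0, {i})) (congrFun (hd i i) (Sum.inr i))
    rw [hh, Pi.single_eq_same, map_smul, coeff_mono] at this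
    simpa using this.symm
  have hham : ∀ i j : Fin n, ham (mono F (elem i j)) (Sum.inr i) = mono F (0, {j}) := by
    intro i j; rw [ham_inr, pd_inl_mono]; simp
  have hcoc : ∀ i j k, d i k = d i j + d j k := by
    intro i j k
    by_cases hij : i = j
    · subst hij; rw [hd0, zero_add]
    by_cases hjk : j = k
    · subst hjk; rw [hd0, add_zero]
    have l := hD.leibniz _ (elem_mem hp ht i j) _ (elem_mem hp ht j k)
    -- When k = i the bracket has the additional term x_j x_{j'}, which D kills already.
    have e : D (poisson (mono F (elem i j)) (mono F (elem j k))) = - D (mono F (elem i k)) := by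
      rw [poisson_singleton_singleton, map_sub]
      have e1 : D (if (Pi.single i 1 : Fin n → ℕ) k = 0 then (0 : O F n) else
          (binom (Pi.single i 1 - Pi.single k 1) (Pi.single j 1) : F) •
            mono F (Pi.single i 1 - Pi.single k 1 + Pi.single j 1, {j})) = 0 := by
        by_cases hki : k = i
        · subst hki
          rw [if_neg (by simp), tsub_self, zero_add, map_smul, hh, smul_zero]
        · rw [if_pos (by simp [hki]), map_zero]
      rw [e1, if_neg (by simp)]
      simp [binom_zero_right]
    rw [e] at l
    have l' := congrFun l (Sum.inr i)
    have hik : (Sum.inr i : Idx n) ≠ Sum.inr j := by simpa using hij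
    have g1 : vectorField F (D (mono F (elem j k))) (mono F (0, {j})) =
      D (mono F (elem j k)) (Sum.inr j) := vectorField_gen _ (Sum.inr j)
    have g2 : vectorField F (ham (mono F (elem j k))) (mono F (0, {j})) =
      ham (mono F (elem j k)) (Sum.inr j) := vectorField_gen _ (Sum.inr j)
    have g3 : ham (mono F (elem j k)) (Sum.inr i) = 0 := by
      rw [ham_inr, pd_inl_mono]; simp [hij]
    rw [Pi.sub_apply, br_apply, br_apply, hham, g1, g3, hd i j, hd j k, Pi.single_eq_of_ne hik,
      Pi.single_eq_same, Pi.single_eq_same, map_smul, g2, hham, Pi.neg_apply, hd i k,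
      Pi.single_eq_same] at l'
    have l'' := congrArg (coeff ((0 : Fin n → ℕ), {k})) l'
    simp only [map_neg, map_sub, map_smul, map_zero, coeff_mono, if_true, smul_eq_mul,
      mul_one] at l''
    linear_combination -l''
  let o : Fin n := ⟨0, by omega⟩
  have hE := hD.sub (isDer_inner (oddEuler_mem (d o)))
  have hEx : ∀ i, (D - inner (oddEuler (d o))) (mono F (0, {i})) = 0 := fun i => by
    rw [LinearMap.sub_apply, inner_const, hx, pdField_oddEuler, sub_zero]
  refine ⟨oddEuler (d o), oddEuler_mem _, hEx, fun i j => ?_⟩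
  rw [LinearMap.sub_apply, sub_eq_zero, hd, inner_apply]
  ext r : 1
  rcases r with k | k
  · rw [br_oddEuler_inl, Pi.single_eq_of_ne (by simp), ham_inl, pd_inr_mono_singleton]
    by_cases h : k = j
    · subst h; simp
    · simp [h]
  · rw [br_oddEuler_inr]
    by_cases h : k = i
    · subst h
      rw [hham, Pi.single_eq_same, Finset.sum_singleton, hcoc o k j]
      simp
    · rw [Pi.single_eq_of_ne (by simpa using h), ham_inr, pd_inl_mono]
      simp [h]

/-- By weight and parity D(x^u) is a combination of the fields x^(u \ k) ∂_k, k ∈ u, the same ones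
that occur in T_H(x^u). For distinct r, s ∈ u the element x_r x_{s'} commutes with x^u and is killed
by D, which forces the ratios at r and s to agree. -/
theorem IsDer.map_cubic (hD : IsDer p t D) (hp : 3 < p) (ht : ∀ i, 1 ≤ t i)
    (hx : ∀ i, D (mono F (0, {i})) = 0) (he : ∀ i j, D (mono F (elem i j)) = 0)
    {u : Finset (Fin n)} (hu : Odd u.card) :
    ∃ c : F, D (mono F (0, u)) = c • ham (mono F (0, u)) := by
  classical
  have hu' : mono F ((0 : Fin n → ℕ), u) ∈ oddTrunc F p t :=
    mono_mem_oddTrunc (fun _ => Nat.zero_le _) hu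
  have key : ∀ r b, coeff b (D (mono F (0, u)) r) ≠ 0 →
      ∃ k ∈ u, r = Sum.inl k ∧ b = (0, u.erase k) := by
    rintro r ⟨β, v⟩ hb
    obtain ⟨h1, h2, h3⟩ := hD.coeff_ne_zero hp ht hx (fun i => he i i) hu' (by simp) hb
    obtain rfl : β = 0 := h1
    obtain ⟨k, hk, rfl, rfl⟩ := wtInt_eq_indicator (v := v) (r := r) hu h2 (by
      intro k
      have hbd := wtInt_bounds k v r
      refine int_eq_of_cast_eq (F := F) hp Fact.out ?_ (by split_ifs <;> omega)
        (by split_ifs <;> omega)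
      rw [h3]
      simp [wt])
    exact ⟨k, hk, rfl, rfl⟩
  have hham : ∀ k ∈ u, ∃ ε : F, ε ≠ 0 ∧
      ham (mono F ((0 : Fin n → ℕ), u)) (Sum.inl k) = ε • mono F (0, u.erase k) := by
    intro k hk
    refine ⟨- (-1) ^ (u.filter (· < k)).card, neg_ne_zero.2 (pow_ne_zero _ (by simp)), ?_⟩
    rw [ham_inl, pd_inr_mono, if_pos hk, neg_smul]
  have hc : ∀ k, ∃ c : F,
      k ∈ u → D (mono F (0, u)) (Sum.inl k) = c • ham (mono F (0, u)) (Sum.inl k) := by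
    intro k
    by_cases hk : k ∈ u
    · obtain ⟨ε, hε, e⟩ := hham k hk
      refine ⟨coeff (0, u.erase k) (D (mono F (0, u)) (Sum.inl k)) / ε, fun _ => ?_⟩
      rw [e, smul_smul, div_mul_cancel₀ _ hε]
      refine ext_coeff fun b => ?_
      rw [map_smul, coeff_mono, smul_eq_mul]
      split_ifs with h
      · rw [h, mul_one]
      · rw [mul_zero]
        by_contra hne
        obtain ⟨l, hl, e1, e2⟩ := key _ _ hne
        cases e1
        exact h e2.symm
    · exact ⟨0, fun h => absurd h hk⟩
  choose c hc using hc
  have hcc : ∀ r ∈ u, ∀ s ∈ u, c r = c s := by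
    intro r hr s hs
    by_cases hrs : r = s
    · rw [hrs]
    have hp0 : poisson (mono F (elem r s)) (mono F (0, u)) = 0 := by
      rw [poisson_singleton_of_mem hs]
      simp [Ne.symm hrs]
    have l := hD.leibniz _ (elem_mem hp ht r s) _ hu'
    have l2 := ham_poisson (elem_mem (F := F) hp ht r s).2 hu'.2
    rw [hp0, map_zero] at l l2
    rw [he, map_zero, sub_zero] at l
    have g : ∀ f : Idx n → O F n, vectorField F f (ham (mono F (elem r s)) (Sum.inl s)) =
        - f (Sum.inl r) := by
      intro f
      rw [ham_inl, pd_inr_mono_singleton, if_pos rfl, map_neg]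
      congr 1
      exact vectorField_gen f (Sum.inl r)
    have l' := congrFun l (Sum.inl s)
    have l2' := congrFun l2 (Sum.inl s)
    rw [br_apply, g] at l' l2'
    rw [hc s hs, hc r hr, map_smul] at l'
    rw [Pi.zero_apply, sub_neg_eq_add] at l' l2'
    obtain ⟨ε, hε, e⟩ := hham r hr
    have l3 : (c r - c s) • ham (mono F (0, u)) (Sum.inl r) = 0 := by
      rw [eq_comm, add_eq_zero_iff_eq_neg] at l2'
      rw [l2', smul_neg] at l'
      rw [sub_smul, l']
      abel
    rw [e, smul_smul] at l3
    have := congrArg (coeff ((0 : Fin n → ℕ), u.erase r)) l3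
    rw [map_smul, coeff_mono, if_pos rfl, map_zero, smul_eq_mul, mul_one] at this
    exact sub_eq_zero.1 ((mul_eq_zero.1 this).resolve_right hε)
  obtain ⟨k₀, hk₀⟩ : u.Nonempty := by
    rw [← Finset.card_pos]; exact hu.pos
  refine ⟨c k₀, funext fun r => ?_⟩
  rw [Pi.smul_apply]
  rcases r with k | k
  · by_cases hk : k ∈ u
    · rw [hc k hk, hcc k hk k₀ hk₀]
    · rw [ham_inl, pd_inr_mono, if_neg hk, neg_zero, smul_zero]
      refine ext_coeff fun b => ?_
      by_contra hne
      rw [map_zero] at hne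
      obtain ⟨l, hl, e1, e2⟩ := key _ _ hne
      cases e1
      exact hk hl
  · rw [ham_inr, pd_inl_mono, if_pos (by simp), smul_zero]
    refine ext_coeff fun b => ?_
    by_contra hne
    rw [map_zero] at hne
    obtain ⟨l, hl, e1, e2⟩ := key _ _ hne
    cases e1

theorem IsDer.exists_kill_cubic (hD : IsDer p t D) (hp : 3 < p) (hn : 3 ≤ n) (ht : ∀ i, 1 ≤ t i)
    (hx : ∀ i, D (mono F (0, {i})) = 0) (he : ∀ i j, D (mono F (elem i j)) = 0) :
    ∃ w ∈ evenFields F n, (∀ i, (D - inner w) (mono F (0, {i})) = 0) ∧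
      (∀ i j, (D - inner w) (mono F (elem i j)) = 0) ∧
      ∀ u : Finset (Fin n), u.card = 3 → (D - inner w) (mono F (0, u)) = 0 := by
  obtain ⟨u₀, hu₀, -⟩ := exists_card_three hn ⟨0, by omega⟩
  obtain ⟨c, hc⟩ := hD.map_cubic hp ht hx he (u := u₀) (by rw [hu₀]; decide)
  -- With equal coefficients this field multiplies T_H(x^u) by (|u| - 1) c / 2, which is c for |u| =
  -- 3 and 0 on x_i x_{j'}. One 3-set suffices, since bracketing with x_r x_{s'} replaces r by s in
  -- x^v up to sign.
  let w : Idx n → O F n := oddEuler fun _ => c / 2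
  have hE : IsDer p t (D - inner w) := hD.sub (isDer_inner (oddEuler_mem _))
  have hEe : ∀ i j, (D - inner w) (mono F (elem i j)) = 0 := by
    intro i j
    rw [LinearMap.sub_apply, he, zero_sub, neg_eq_zero, inner_apply]
    ext r : 1
    rcases r with k | k
    · rw [br_oddEuler_inl, ham_inl, pd_inr_mono_singleton]
      by_cases h : k = j
      · subst h; simp
      · simp [h]
    · rw [br_oddEuler_inr]; simp
  refine ⟨w, oddEuler_mem _, fun i => ?_, hEe, ?_⟩
  · rw [LinearMap.sub_apply, inner_const, hx, pdField_oddEuler, sub_zero]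
  intro u hu
  refine swap_induction (u₀ := u₀) (P := fun u => (D - inner w) (mono F (0, u)) = 0) ?_ ?_ u
    (hu.trans hu₀.symm)
  · rw [LinearMap.sub_apply, hc, sub_eq_zero, inner_apply]
    ext r : 1
    rcases r with k | k
    · rw [br_oddEuler_inl, Pi.smul_apply]
      by_cases hk : k ∈ u₀
      · congr 1
        rw [Finset.sum_const, Finset.card_erase_of_mem hk, hu₀]
        have := two_ne_zero_of_char (F := F) hp
        simp only [nsmul_eq_mul]
        push_cast
        field_simp
      · rw [ham_inl, pd_inr_mono, if_neg hk]; simp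
    · rw [br_oddEuler_inr, Pi.smul_apply, ham_inr, pd_inl_mono]; simp
  · intro v hv r hr s hs h0
    have hv' : mono F ((0 : Fin n → ℕ), v) ∈ oddTrunc F p t :=
      mono_mem_oddTrunc (fun _ => Nat.zero_le _) (by rw [hv, hu₀]; decide)
    have l := hE.leibniz _ (elem_mem hp ht r s) _ hv'
    obtain ⟨ε, hε, e⟩ := poisson_single_const (F := F) hr (v := {s}) (by simp [hs])
    have h0' : (D - inner w) (mono F (0, v)) = 0 := h0
    rw [h0', hEe, map_zero, map_zero, sub_zero, e, map_smul] at l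
    rw [Finset.insert_eq]
    exact (smul_eq_zero.1 l).resolve_left hε

end

/-! ### Normal derivations -/

/-- A derivation that vanishes on the components of low degree, and on the elements
`x_i^(p^k) x_{i'}` up to terms outside `F ∂_i`. -/
structure IsNormal (p : ℕ) (t : Fin n → ℕ) (D : O F n →ₗ[F] (Idx n → O F n)) : Prop where
  der : IsDer p t D
  const : ∀ i, D (mono F (0, {i})) = 0
  elem : ∀ i j, D (mono F (elem i j)) = 0
  cubic : ∀ u : Finset (Fin n), u.card = 3 → D (mono F (0, u)) = 0
  power : ∀ i k, 1 ≤ k → k < t i →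
    coeff (0, ∅) (D (mono F (Pi.single i (p ^ k), {i})) (Sum.inl i)) = 0

/-- The combination `∑ c_{ik} (ad ∂_i) ^ (p ^ k)` over `1 ≤ k < t_i`. -/
noncomputable def adPowSum (p : ℕ) (t : Fin n → ℕ) (c : Fin n → ℕ → F) :
    O F n →ₗ[F] (Idx n → O F n) :=
  ∑ i, ∑ k ∈ Finset.Ico 1 (t i), c i k • adPow i (p ^ k)

theorem adPowSum_apply (p : ℕ) (t : Fin n → ℕ) (c : Fin n → ℕ → F) (a : O F n) :
    adPowSum p t c a = ∑ i, ∑ k ∈ Finset.Ico 1 (t i), c i k • adPow i (p ^ k) a := by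
  simp [adPowSum, LinearMap.sum_apply]

theorem sum_add_single (α : Fin n → ℕ) (i : Fin n) (c : ℕ) :
    ∑ l, (α + Pi.single i c : Fin n → ℕ) l = ∑ l, α l + c := by
  simp [Finset.sum_add_distrib]

theorem sum_single (i : Fin n) (c : ℕ) : ∑ l, (Pi.single i c : Fin n → ℕ) l = c := by
  simp

theorem exists_add_single {α : Fin n → ℕ} {i : Fin n} {c : ℕ} (h : c ≤ α i) :
    ∃ β : Fin n → ℕ, α = β + Pi.single i c := by
  refine ⟨α - Pi.single i c, ?_⟩
  ext j
  by_cases hj : j = i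
  · subst hj; simp; omega
  · simp [hj]

theorem two_mul_choose_two (a : ℕ) : (2 : F) * (a.choose 2 : ℕ) = a * (a - 1) := by
  induction a with
  | zero => simp
  | succ a ih =>
    rw [Nat.choose_succ_succ' a 1, Nat.choose_one_right]
    push_cast
    linear_combination ih

section

variable {p : ℕ} {t : Fin n → ℕ} {D : O F n →ₗ[F] (Idx n → O F n)}

theorem isDer_adPowSum [Fact p.Prime] [CharP F p] (c : Fin n → ℕ → F) : IsDer p t (adPowSum p t c) :=
  IsDer.sum _ fun i _ => IsDer.sum _ fun k _ => (isDer_adPow i k).smul _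

theorem adPowSum_mono_of_lt [Fact p.Prime] (c : Fin n → ℕ → F) {α : Fin n → ℕ} (h : ∀ i, α i < p)
    (u : Finset (Fin n)) : adPowSum p t c (mono F (α, u)) = 0 := by
  rw [adPowSum_apply]
  refine Finset.sum_eq_zero fun i _ => Finset.sum_eq_zero fun k hk => ?_
  rw [adPow_mono_of_lt, smul_zero]
  rw [Finset.mem_Ico] at hk
  calc α i < p := h i
    _ = p ^ 1 := (pow_one p).symm
    _ ≤ p ^ k := Nat.pow_le_pow_right (Fact.out : p.Prime).pos hk.1

theorem IsDer.exists_normal [Fact p.Prime] [CharP F p] (hD : IsDer p t D) (hp : 3 < p)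
    (hn : 3 ≤ n) (ht : ∀ i, 1 ≤ t i) :
    ∃ w ∈ evenFields F n, ∃ c : Fin n → ℕ → F, IsNormal p t (D - inner w - adPowSum p t c) := by
  obtain ⟨w₁, hw₁, h1⟩ := hD.exists_kill_const
  have hD₁ := hD.sub (isDer_inner hw₁)
  obtain ⟨w₂, hw₂, h2, h2'⟩ := hD₁.exists_kill_toral hp hn ht h1
  have hD₂ := hD₁.sub (isDer_inner hw₂)
  obtain ⟨w₃, hw₃, h3, h3'⟩ := hD₂.exists_kill_elem hp hn ht h2 h2'
  have hD₃ := hD₂.sub (isDer_inner hw₃)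
  obtain ⟨w₄, hw₄, h4, h4', h4''⟩ := hD₃.exists_kill_cubic hp hn ht h3 h3'
  have hD₄ := hD₃.sub (isDer_inner hw₄)
  have e : D - inner w₁ - inner w₂ - inner w₃ - inner w₄ = D - inner (w₁ + w₂ + w₃ + w₄) := by
    simp only [inner_add]; abel
  rw [e] at hD₄ h4 h4' h4''
  refine ⟨w₁ + w₂ + w₃ + w₄, add_mem (add_mem (add_mem hw₁ hw₂) hw₃) hw₄, ?_⟩
  generalize D - inner (w₁ + w₂ + w₃ + w₄) = E at *
  -- The sign compensates the -1 in `coeff_adPow`. Subtracting the p-power maps does not disturb the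
  -- earlier normalizations, where all exponents are below p.
  let c : Fin n → ℕ → F := fun i k =>
    - coeff (0, ∅) (E (mono F (Pi.single i (p ^ k), {i})) (Sum.inl i))
  refine ⟨c, hD₄.sub (isDer_adPowSum c), fun i => ?_, fun i j => ?_, fun u hu => ?_,
    fun i k hk hk' => ?_⟩
  · rw [LinearMap.sub_apply, h4, adPowSum_mono_of_lt _ fun l => by simp; omega, sub_zero]
  · rw [LinearMap.sub_apply, h4', adPowSum_mono_of_lt, sub_zero]
    intro l
    by_cases h : l = i
    · subst h; simp; omega
    · simp [h]; omega
  · rw [LinearMap.sub_apply, h4'' u hu, adPowSum_mono_of_lt _ fun l => by simp; omega, sub_zero]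
  · rw [LinearMap.sub_apply, Pi.sub_apply, map_sub, adPowSum_apply]
    simp only [Finset.sum_apply, map_sum, Pi.smul_apply, map_smul, coeff_adPow, smul_eq_mul]
    rw [Finset.sum_eq_single i, Finset.sum_eq_single k]
    · simp [c]
    · intro m _ hm; simp [hm]
    · intro h; exact absurd (Finset.mem_Ico.2 ⟨hk, hk'⟩) h
    · intro l _ hl; simp [hl]
    · simp

/-! ### Vanishing of normal derivations: induction on the degree -/

/-- `D` vanishes on the monomials of degree less than `N`. -/
def KillsBelow (p : ℕ) (t : Fin n → ℕ) (D : O F n →ₗ[F] (Idx n → O F n)) (N : ℕ) : Prop :=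
  ∀ (α : Fin n → ℕ) (u : Finset (Fin n)), (∑ i, α i) + u.card < N →
    (∀ i, α i ≤ p ^ t i - 1) → Odd u.card → D (mono F (α, u)) = 0

theorem KillsBelow.map_poisson {N : ℕ} (hK : KillsBelow p t D N) (hD : IsDer p t D)
    {α β : Fin n → ℕ} {u v : Finset (Fin n)} (hα : ∀ i, α i ≤ p ^ t i - 1)
    (hβ : ∀ i, β i ≤ p ^ t i - 1) (hu : Odd u.card) (hv : Odd v.card)
    (h1 : (∑ i, α i) + u.card < N) (h2 : (∑ i, β i) + v.card < N) :
    D (poisson (mono F (α, u)) (mono F (β, v))) = 0 := by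
  rw [hD.leibniz _ (mono_mem_oddTrunc hα hu) _ (mono_mem_oddTrunc hβ hv), hK α u h1 hα hu,
    hK β v h2 hβ hv, map_zero, map_zero, sub_zero]

theorem single_le (hp : 3 < p) (ht : ∀ i, 1 ≤ t i) (i : Fin n) {c : ℕ} (hc : c ≤ 2) (l : Fin n) :
    (Pi.single i c : Fin n → ℕ) l ≤ p ^ t l - 1 := by
  have := le_pow_sub_one hp ht l
  by_cases h : l = i
  · subst h; simp; omega
  · simp [h]

/-- For α = β + 2ε_i, the bracket {x_i^(2) x_{i'}, x^(β + ε_i) x_{j'}} is -binom(α_i, 2) x^(α)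
x_{j'}. The factors have degrees 3 and N - 1, hence the condition N ≥ 4. -/
theorem KillsBelow.map_of_choose {N : ℕ} (hK : KillsBelow p t D N) (hD : IsDer p t D)
    (hp : 3 < p) (ht : ∀ i, 1 ≤ t i) (hN : 4 ≤ N) {α : Fin n → ℕ} {i j : Fin n} (hij : i ≠ j)
    (hα : ∀ i, α i ≤ p ^ t i - 1) (hs : ∑ i, α i + 1 = N) (h : ((α i).choose 2 : F) ≠ 0) :
    D (mono F (α, {j})) = 0 := by
  have h2 : 2 ≤ α i := by
    by_contra hc
    rw [Nat.choose_eq_zero_of_lt (by omega)] at h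
    simp at h
  obtain ⟨β, rfl⟩ := exists_add_single h2
  rw [sum_add_single] at hs
  have hb : ∀ l, (β + Pi.single i 1 : Fin n → ℕ) l ≤ p ^ t l - 1 := by
    intro l
    refine le_trans ?_ (hα l)
    by_cases hl : l = i
    · subst hl; simp
    · simp [hl]
  have l := hK.map_poisson hD (single_le hp ht i le_rfl) hb (u := {i}) (v := {j})
    (by simp) (by simp) (by rw [sum_single, Finset.card_singleton]; omega)
    (by rw [sum_add_single, Finset.card_singleton]; omega)
  rw [poisson_singleton_singleton, if_pos (by simp [hij.symm]), if_neg (by simp),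
    add_tsub_cancel_right, zero_sub, map_neg, map_smul, neg_eq_zero, binom_single_left,
    add_comm (Pi.single i 2)] at l
  refine (smul_eq_zero.1 l).resolve_left ?_
  rw [add_comm]
  simpa using h

/-- For j ∈ u, bracketing x_j^(2) x_{j'} with x^(α - ε_j) x^u gives x^(α) x^u with factor α_j -
binom(α_j, 2); now both halves of the bracket contribute. -/
theorem KillsBelow.map_of_sub_choose {N : ℕ} (hK : KillsBelow p t D N) (hD : IsDer p t D)
    (hp : 3 < p) (ht : ∀ i, 1 ≤ t i) (hN : 4 ≤ N) {α : Fin n → ℕ} {u : Finset (Fin n)}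
    (hu : Odd u.card) {j : Fin n} (hj : j ∈ u) (hα : ∀ i, α i ≤ p ^ t i - 1)
    (hs : ∑ i, α i + u.card = N) (h0 : α j ≠ 0) (h : (α j : F) - ((α j).choose 2 : F) ≠ 0) :
    D (mono F (α, u)) = 0 := by
  obtain ⟨β, rfl⟩ := exists_add_single (show 1 ≤ α j by omega)
  rw [sum_add_single] at hs
  have hb : ∀ l, β l ≤ p ^ t l - 1 := fun l => le_trans (by simp) (hα l)
  have l := hK.map_poisson hD (single_le hp ht j le_rfl) hb (u := {j}) (v := u)
    (by simp) hu (by rw [sum_single, Finset.card_singleton]; omega) (by omega)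
  have e1 : (Pi.single j 2 - Pi.single j 1 : Fin n → ℕ) = Pi.single j 1 := by
    ext l
    by_cases hl : l = j
    · subst hl; simp
    · simp [hl]
  rw [poisson_singleton_of_mem hj, if_neg (by simp), e1, binom_single_left,
    add_comm (Pi.single j 1) β] at l
  by_cases hb0 : β j = 0
  · rw [if_pos hb0, sub_zero, hb0, map_smul] at l
    simpa using l
  · obtain ⟨γ, rfl⟩ := exists_add_single (show 1 ≤ β j by omega)
    rw [if_neg hb0, add_tsub_cancel_right, binom_single_left,
      show Pi.single j 2 + γ = γ + Pi.single j 1 + Pi.single j 1 by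
        rw [add_assoc, ← Pi.single_add, add_comm], ← sub_smul, map_smul] at l
    refine (smul_eq_zero.1 l).resolve_left ?_
    convert h using 3
    · simp [add_comm]
    · simp only [Pi.add_apply, Pi.single_eq_same]
      rw [show 2 + γ j = γ j + 1 + 1 by omega]

/-- The derivatives ∂_i of the monomial have lower degree, so its image under D has constant
coefficients, and the torus fixes their weights. This is the tool for monomials not reached by
brackets. -/
theorem KillsBelow.exists_weight {N : ℕ} (hK : KillsBelow p t D N) (hD : IsNormal p t D)
    (hp : 3 < p) (ht : ∀ i, 1 ≤ t i) {α : Fin n → ℕ} {j : Fin n}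
    (hα : ∀ i, α i ≤ p ^ t i - 1) (hs : ∑ i, α i + 1 = N) (h : D (mono F (α, {j})) ≠ 0) :
    ∃ r v, coeff (0, v) (D (mono F (α, {j})) r) ≠ 0 ∧ (v.card : ZMod 2) = mu r ∧
      ∀ i, (wtInt i v r : F) = (if i = j then 1 else 0) - α i := by
  obtain ⟨r, hr⟩ := Function.ne_iff.1 h
  obtain ⟨⟨β, v⟩, hb⟩ : ∃ b, coeff b (D (mono F (α, {j})) r) ≠ 0 := by
    by_contra hc
    push Not at hc
    exact hr (ext_coeff fun b => by rw [hc]; simp)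
  obtain ⟨h1, h2, h3⟩ := hD.der.coeff_ne_zero hp ht hD.const (fun i => hD.elem i i)
    (mono_mem_oddTrunc hα (by simp)) (fun i hi => by
      obtain ⟨γ, rfl⟩ := exists_add_single (show 1 ≤ α i by omega)
      rw [sum_add_single] at hs
      rw [add_tsub_cancel_right]
      exact hK _ _ (by rw [Finset.card_singleton]; omega)
        (fun l => le_trans (by simp) (hα l)) (by simp)) hb
  obtain rfl : β = 0 := h1
  exact ⟨r, v, hb, h2, fun i => by rw [h3]; simp [wt]⟩

end

/-- If p does not divide a, take b = 1. Otherwise Lucas' congruence binom(pc, pb) ≡ binom(c, b)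
reduces a = pc to c and yields a multiple of p. -/
theorem exists_choose_ne_zero (p : ℕ) [Fact p.Prime] [CharP F p] {a : ℕ} (ha : a ≠ 0)
    (h : ∀ k, a ≠ p ^ k) : ∃ b, 0 < b ∧ b < a ∧ (a.choose b : F) ≠ 0 ∧ (p ∣ a → p ∣ b) := by
  have hp : p.Prime := Fact.out
  induction a using Nat.strong_induction_on with
  | _ a ih =>
  by_cases hd : p ∣ a
  · obtain ⟨c, rfl⟩ := hd
    have hc : c ≠ 0 := by rintro rfl; simp at ha
    obtain ⟨b, h1, h2, h3, -⟩ := ih c (by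
      have := hp.two_le
      nlinarith [Nat.pos_of_ne_zero hc]) hc (fun k hk => h (k + 1) (by rw [hk, pow_succ']))
    refine ⟨p * b, Nat.mul_pos hp.pos h1, Nat.mul_lt_mul_of_pos_left h2 hp.pos, ?_,
      fun _ => dvd_mul_right _ _⟩
    have := Choose.choose_modEq_choose_mod_mul_choose_div_nat (n := p * c) (k := p * b) (p := p)
    simp only [Nat.mul_mod_right, Nat.choose_self, one_mul, Nat.mul_div_cancel_left _ hp.pos]
      at this
    rwa [(CharP.natCast_eq_natCast F p).2 this]
  · refine ⟨1, one_pos, ?_, ?_, fun h => absurd h hd⟩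
    · have := h 0
      simp at this
      omega
    · rwa [Nat.choose_one_right, Ne, CharP.cast_eq_zero_iff F p]

theorem eq_zero_of_mono {p : ℕ} {t : Fin n → ℕ} {D : O F n →ₗ[F] (Idx n → O F n)}
    (h : ∀ (α : Fin n → ℕ) (u : Finset (Fin n)), (∀ i, α i ≤ p ^ t i - 1) →
    Odd u.card → D (mono F (α, u)) = 0) {a : O F n} (ha : a ∈ oddTrunc F p t) : D a = 0 := by
  have hspan : a ∈ Submodule.span F
      (mono F '' {b : Mono n | (∀ i, b.1 i ≤ p ^ t i - 1) ∧ Odd b.2.card}) :=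
    mem_span_mono_iff.2 fun b hb => ⟨mem_trunc_iff.1 ha.1 b hb,
      ZMod.natCast_eq_one_iff_odd.1 (mem_parityPart_iff.1 ha.2 b hb)⟩
  have hle : Submodule.span F (mono F '' {b : Mono n |
      (∀ i, b.1 i ≤ p ^ t i - 1) ∧ Odd b.2.card}) ≤ LinearMap.ker D := by
    rw [Submodule.span_le]
    rintro _ ⟨⟨β, v⟩, hb, rfl⟩
    exact h β v hb.1 hb.2
  exact hle hspan

section

variable {p : ℕ} [Fact p.Prime] [CharP F p] {t : Fin n → ℕ} {D : O F n →ₗ[F] (Idx n → O F n)}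

theorem cast_pow_sub_one {m : ℕ} (hm : 1 ≤ m) : ((p ^ m - 1 : ℕ) : F) = -1 := by
  rw [Nat.cast_sub (Nat.one_le_pow _ _ (Fact.out : p.Prime).pos), Nat.cast_pow,
    CharP.cast_eq_zero F p, zero_pow (by omega)]
  simp

/-- The maximal exponent p^m - 1 is -1 in F, so any exponent with another residue can be raised
without leaving the truncated algebra. -/
theorem add_one_le_of_cast_ne {m a : ℕ} (hm : 1 ≤ m) (ha : a ≤ p ^ m - 1) (h : (a : F) ≠ -1) :
    a + 1 ≤ p ^ m - 1 := by
  have : a ≠ p ^ m - 1 := by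
    rintro rfl
    exact h (cast_pow_sub_one hm)
  omega

theorem KillsBelow.map_of_three_le_card {N : ℕ} (hK : KillsBelow p t D N) (hD : IsNormal p t D)
    (hp : 3 < p) (ht : ∀ i, 1 ≤ t i) {α : Fin n → ℕ} {u : Finset (Fin n)}
    (hu : Odd u.card) (hu3 : 3 ≤ u.card) (hα : ∀ i, α i ≤ p ^ t i - 1)
    (hs : ∑ i, α i + u.card = N) : D (mono F (α, u)) = 0 := by
  classical
  have h2F := two_ne_zero_of_char (F := F) hp
  by_cases h0 : α = 0
  · subst h0
    by_cases h3 : u.card = 3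
    · exact hD.cubic u h3
    -- For |u| ≥ 5, x^u is up to sign the bracket of x_i x^v, of degree 4, with the monomial of (u \
    -- v) ∪ {i}, of degree |u| - 2.
    obtain ⟨v, hvu, hv⟩ := Finset.exists_subset_card_eq hu3
    obtain ⟨i, hi⟩ : v.Nonempty := by rw [← Finset.card_pos]; omega
    have hc : (u \ v.erase i).card + 2 = u.card := by
      have := Finset.card_sdiff_add_card_eq_card ((Finset.erase_subset i v).trans hvu)
      rw [Finset.card_erase_of_mem hi, hv] at this
      omega
    have hiw : i ∈ u \ v.erase i := by simp [hvu hi]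
    have he : (u \ v.erase i).erase i = u \ v := by
      ext x
      simp only [Finset.mem_erase, Finset.mem_sdiff, not_and, ne_eq]
      constructor
      · rintro ⟨h1, h2, h3⟩; exact ⟨h2, h3 h1⟩
      · rintro ⟨h1, h2⟩; exact ⟨fun h => h2 (h ▸ hi), h1, fun _ => h2⟩
    obtain ⟨ε, hε, e⟩ := poisson_single_const (F := F) hiw (v := v)
      (by rw [he]; exact Finset.disjoint_sdiff)
    simp only [Pi.zero_apply, Finset.sum_const_zero, zero_add] at hs
    obtain ⟨q, hq⟩ := hu
    have l := hK.map_poisson hD.der (single_le hp ht i (by norm_num : 1 ≤ 2)) (u := v)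
      (β := 0) (v := u \ v.erase i) (fun _ => Nat.zero_le _) (by rw [hv]; decide)
      ⟨q - 1, by omega⟩ (by rw [sum_single, hv]; omega)
      (by simp only [Pi.zero_apply, Finset.sum_const_zero]; omega)
    rw [e, he, Finset.union_sdiff_of_subset hvu, map_smul] at l
    exact (smul_eq_zero.1 l).resolve_left hε
  · obtain ⟨i, hi⟩ := Function.ne_iff.1 h0
    have hpos : 0 < ∑ i, α i :=
      lt_of_lt_of_le (Nat.pos_of_ne_zero hi) (Finset.single_le_sum (fun _ _ => Nat.zero_le _)
        (Finset.mem_univ i))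
    obtain ⟨j, hj⟩ : u.Nonempty := by rw [← Finset.card_pos]; omega
    -- If α_j can be raised, x^(α) x^u = {x^(α + ε_j) x_{j'}, x^u}. If α_j = -1 in F, the factor of
    -- `map_of_sub_choose` is -1 - 1 = -2 ≠ 0.
    by_cases hc : (α j : F) = -1
    · refine hK.map_of_sub_choose hD.der hp ht (by omega) hu hj hα hs ?_ ?_
      · intro h; rw [h] at hc; simp at hc
      · intro h
        have := two_mul_choose_two (F := F) (α j)
        rw [hc] at h this
        have h4 : (2 : F) * 2 = 0 := by linear_combination -this - 2 * h
        exact h2F (by simpa using h4)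
    · have hb : ∀ l, (α + Pi.single j 1 : Fin n → ℕ) l ≤ p ^ t l - 1 := by
        intro l
        by_cases hl : l = j
        · subst hl; simpa using add_one_le_of_cast_ne (ht l) (hα l) hc
        · simpa [hl] using hα l
      have l := hK.map_poisson hD.der hb (u := {j}) (β := 0) (v := u) (fun _ => Nat.zero_le _)
        (by simp) hu (by rw [sum_add_single, Finset.card_singleton]; omega)
        (by simp only [Pi.zero_apply, Finset.sum_const_zero]; omega)
      rw [poisson_singleton_of_mem hj, if_neg (by simp), if_pos (by simp), sub_zero,
        add_tsub_cancel_right, binom_zero_right, add_zero] at l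
      simpa using l

theorem eq_zero_of_sum_eq_zero {α : Fin n → ℕ} (h : ∑ i, α i = 0) : α = 0 :=
  funext fun i => Finset.sum_eq_zero_iff.1 h i (Finset.mem_univ i)

theorem exists_ne_zero_of_sum {α : Fin n → ℕ} (h : ∑ i, α i ≠ 0) : ∃ i, α i ≠ 0 := by
  by_contra hc
  push Not at hc
  exact h (Finset.sum_eq_zero fun i _ => hc i)

theorem exists_eq_single {α : Fin n → ℕ} (h : ∑ i, α i = 1) : ∃ i, α = Pi.single i 1 := by
  obtain ⟨i, hi⟩ := exists_ne_zero_of_sum (α := α) (by omega)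
  obtain ⟨β, rfl⟩ := exists_add_single (show 1 ≤ α i by omega)
  rw [sum_add_single] at h
  exact ⟨i, by rw [eq_zero_of_sum_eq_zero (α := β) (by omega), zero_add]⟩

/-- Degree 3 is out of reach of brackets of lower degrees, but no even constant field has the weight
of x^(α) x_{j'} with |α| = 2: it is -1 at one index only, or has an entry -2, or has two entries -1.
-/
theorem KillsBelow.map_quadratic (hK : KillsBelow p t D 3) (hD : IsNormal p t D)
    (hp : 3 < p) (ht : ∀ i, 1 ≤ t i) {α : Fin n → ℕ} {j : Fin n}
    (hα : ∀ i, α i ≤ p ^ t i - 1) (hs : ∑ i, α i = 2) : D (mono F (α, {j})) = 0 := by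
  by_contra hne
  obtain ⟨r, v, -, hv, hw⟩ := hK.exists_weight hD hp ht hα (by rw [hs]) hne
  obtain ⟨i, hi⟩ := exists_ne_zero_of_sum (α := α) (by omega)
  obtain ⟨β, rfl⟩ := exists_add_single (show 1 ≤ α i by omega)
  rw [sum_add_single] at hs
  obtain ⟨l, rfl⟩ := exists_eq_single (α := β) (by omega)
  have hz : ∀ k, wtInt k v r = (if k = j then 1 else 0) -
      ((if k = l then 1 else 0) + (if k = i then 1 else 0)) := by
    intro k
    have hbd := wtInt_bounds k v r
    refine int_eq_of_cast_eq (F := F) hp Fact.out ?_ (by split_ifs <;> omega)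
      (by split_ifs <;> omega)
    rw [hw, Pi.add_apply, Pi.single_apply, Pi.single_apply]
    push_cast
    rfl
  by_cases hlj : l = j
  · exact wtInt_ne_neg (i := i) hv fun k => by rw [hz, hlj]; split_ifs <;> simp
  by_cases hij : i = j
  · exact wtInt_ne_neg (i := l) hv fun k => by rw [hz, hij]; split_ifs <;> simp
  by_cases hil : i = l
  · have := hz i
    have hbd := wtInt_bounds i v r
    rw [if_neg hij, if_pos hil, if_pos rfl] at this
    omega
  · refine hil (wtInt_neg_unique (v := v) (r := r) ?_ ?_)
    · rw [hz, if_neg hij, if_neg hil, if_pos rfl]; rfl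
    · rw [hz, if_neg hlj, if_pos rfl, if_neg (Ne.symm hil)]; rfl

theorem KillsBelow.map_single {N : ℕ} (hK : KillsBelow p t D N) (hD : IsNormal p t D)
    (hp : 3 < p) (ht : ∀ i, 1 ≤ t i) {a : ℕ} {i j : Fin n} (ha : a ≤ p ^ t i - 1)
    (hs : a + 1 = N) (hN : 4 ≤ N) (h0 : (a : F) = 0) : D (mono F (Pi.single i a, {j})) = 0 := by
  have hpp : p.Prime := Fact.out
  have hda : p ∣ a := (CharP.cast_eq_zero_iff F p a).1 h0
  have hbox : ∀ {b}, b ≤ p ^ t i - 1 → ∀ l, (Pi.single i b : Fin n → ℕ) l ≤ p ^ t l - 1 := by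
    intro b hb l
    by_cases hl : l = i
    · subst hl; simpa using hb
    · simp [hl]
  by_cases hpow : ∃ k, a = p ^ k
  · obtain ⟨k, rfl⟩ := hpow
    have hk1 : 1 ≤ k := by
      by_contra hc
      obtain rfl : k = 0 := by omega
      simp at hs
      omega
    have hkt : k < t i := by
      by_contra hc
      have := Nat.pow_le_pow_right hpp.pos (not_lt.1 hc)
      have := Nat.one_le_pow (t i) _ hpp.pos
      omega
    -- The exponent vanishes in F, so the weight is that of x_{i'}, and ∂_i is the only even
    -- constant field with this weight. Its coefficient is the one normalized to 0.
    have hii : D (mono F (Pi.single i (p ^ k), {i})) = 0 := by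
      by_contra hne
      obtain ⟨r, v, hc, hv, hw⟩ := hK.exists_weight hD hp ht (hbox ha)
        (by rw [sum_single, hs]) hne
      obtain ⟨l, hl, rfl, rfl⟩ := wtInt_eq_indicator (u := {i}) (v := v) (r := r) (by simp) hv (by
        intro l
        have hbd := wtInt_bounds l v r
        refine int_eq_of_cast_eq (F := F) hp Fact.out ?_ (by split_ifs <;> omega)
          (by split_ifs <;> omega)
        rw [hw, Pi.single_apply]
        simp only [Finset.mem_singleton]
        split_ifs
        · rw [h0]; simp
        · simp)
      rw [Finset.mem_singleton] at hl
      subst hl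
      rw [Finset.erase_singleton] at hc
      exact hc (hD.power l k hk1 hkt)
    by_cases hij : i = j
    · rw [← hij]; exact hii
    -- {x_i x_{j'}, x_i^(a) x_{i'}} = x_i^(a) x_{j'} moves the vanishing from i' to j', without
    -- lowering the degree.
    have l := hD.der.leibniz _ (elem_mem hp ht i j) _ (mono_mem_oddTrunc (u := {i}) (hbox ha)
      (by simp))
    rw [hii, hD.elem, map_zero, map_zero, sub_zero, poisson_singleton_singleton,
      if_neg (by simp), if_pos (by simp [Ne.symm hij]), tsub_self, binom_zero_left, zero_add,
      sub_zero] at l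
    simpa using l
  · push Not at hpow
    obtain ⟨b, hb0, hba, hc, hb⟩ := exists_choose_ne_zero (F := F) p (by omega) hpow
    have hdb := hb hda
    have hb1 : 1 < b := lt_of_lt_of_le hpp.one_lt (Nat.le_of_dvd hb0 hdb)
    -- The bracket of x_i^(b) x_{i'} and x_i^(a - b + 1) x_{j'} contains x_i^(a) x_{j'} with factor
    -- -binom(a, b). Both degrees are below N because 1 < b < a.
    have l := hK.map_poisson hD.der (hbox (b := b) (by omega)) (hbox (b := a - b + 1) (by omega))
      (u := {i}) (v := {j}) (by simp) (by simp) (by rw [sum_single, Finset.card_singleton]; omega)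
      (by rw [sum_single, Finset.card_singleton]; omega)
    have e1 : (Pi.single i (a - b + 1) - Pi.single i 1 : Fin n → ℕ) = Pi.single i (a - b) := by
      rw [Pi.single_add, add_tsub_cancel_right]
    have e2 : (Pi.single i b - Pi.single i 1 : Fin n → ℕ) = Pi.single i (b - 1) := by
      ext l
      by_cases hl : l = i
      · subst hl; simp
      · simp [hl]
    rw [poisson_singleton_singleton, if_neg (c := (Pi.single i (a - b + 1) : Fin n → ℕ) i = 0)
      (by simp), e1, binom_single_left, ← Pi.single_add, Pi.single_eq_same,
      show b + (a - b) = a by omega] at l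
    by_cases hij : i = j
    · subst hij
      -- For i = j the other half of the bracket has factor binom(a, b - 1). It vanishes by b
      -- binom(a, b) = (a - b + 1) binom(a, b - 1), as a and b are both 0 in F; this is why b was
      -- chosen divisible by p.
      have hz : ((a.choose (b - 1) : ℕ) : F) = 0 := by
        have := congrArg (Nat.cast (R := F)) (Nat.choose_succ_right_eq a (b - 1))
        rw [show b - 1 + 1 = b by omega, show a - (b - 1) = a - b + 1 by omega] at this
        push_cast [Nat.cast_sub hba.le] at this
        rw [h0, (CharP.cast_eq_zero_iff F p b).2 hdb] at this
        simpa using this.symm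
      rw [if_neg (by simp; omega), e2, binom_single_left, Pi.single_eq_same,
        show b - 1 + (a - b + 1) = a by omega, hz, zero_smul, zero_sub, map_neg, map_smul,
        neg_eq_zero] at l
      exact (smul_eq_zero.1 l).resolve_left hc
    · rw [if_pos (by simp [Ne.symm hij]), zero_sub, map_neg, map_smul, neg_eq_zero] at l
      exact (smul_eq_zero.1 l).resolve_left hc

theorem KillsBelow.map_of_cast_eq_zero {N : ℕ} (hK : KillsBelow p t D N) (hD : IsNormal p t D)
    (hp : 3 < p) (ht : ∀ i, 1 ≤ t i) (hN : 4 ≤ N) {α : Fin n → ℕ} {j : Fin n}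
    (hα : ∀ i, α i ≤ p ^ t i - 1) (hs : ∑ i, α i + 1 = N) (h0 : ∀ i, (α i : F) = 0) :
    D (mono F (α, {j})) = 0 := by
  by_cases h2 : ∃ i l, i ≠ j ∧ l ≠ i ∧ α i ≠ 0 ∧ α l ≠ 0
  · obtain ⟨i, l, hij, hli, hi, hl⟩ := h2
    have hpi : p ≤ α i :=
      Nat.le_of_dvd (Nat.pos_of_ne_zero hi) ((CharP.cast_eq_zero_iff F p _).1 (h0 i))
    have h1l : α l + 1 ≤ p ^ t l - 1 :=
      add_one_le_of_cast_ne (F := F) (ht l) (hα l) (by rw [h0]; simp)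
    have hαi := hα i
    obtain ⟨β, hβ⟩ := exists_add_single (α := α) (i := i) le_rfl
    have hβi : β i = 0 := by
      have := congrFun hβ i
      simp at this
      exact this
    generalize α i = a at *
    subst hβ
    rw [sum_add_single] at hs
    have hlpos : β l ≤ ∑ i, β i :=
      Finset.single_le_sum (fun _ _ => Nat.zero_le _) (Finset.mem_univ l)
    have hβl : (β + Pi.single i a : Fin n → ℕ) l = β l := by simp [hli]
    rw [hβl] at hl h1l
    -- Two different variables occur, so the monomial splits as -{x_i^(a) x_{l'}, x^(β + ε_l)
    -- x_{j'}}, where β omits x_i. The degrees drop because β_l > 0 and a ≥ p.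
    have lb := hK.map_poisson hD.der (α := Pi.single i a) (β := β + Pi.single l 1)
      (u := {l}) (v := {j}) (by
        intro k
        by_cases hk : k = i
        · subst hk; simpa using hαi
        · simp [hk]) (by
        intro k
        by_cases hk : k = l
        · subst hk; simpa using h1l
        · simpa [hk] using le_trans (by simp) (hα k)) (by simp) (by simp)
      (by rw [sum_single, Finset.card_singleton]; omega)
      (by rw [sum_add_single, Finset.card_singleton]; omega)
    rw [poisson_singleton_singleton, if_pos (by simp [Ne.symm hij]), if_neg (by simp),
      add_tsub_cancel_right, binom_single_left, hβi, add_zero, Nat.choose_self, zero_sub,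
      map_neg, neg_eq_zero, add_comm _ β] at lb
    simpa using lb
  · push Not at h2
    obtain ⟨i, hi⟩ : ∃ i, α = Pi.single i (α i) := by
      by_cases h : ∃ i, i ≠ j ∧ α i ≠ 0
      · obtain ⟨i, hij, hi⟩ := h
        refine ⟨i, funext fun l => ?_⟩
        by_cases hl : l = i
        · subst hl; simp
        · rw [Pi.single_eq_of_ne hl]; exact h2 i l hij hl hi
      · push Not at h
        refine ⟨j, funext fun l => ?_⟩
        by_cases hl : l = j
        · subst hl; simp
        · rw [Pi.single_eq_of_ne hl]; exact h l hl
    have hai := hα i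
    have h0i := h0 i
    generalize α i = a at *
    subst hi
    rw [sum_single] at hs
    exact hK.map_single hD hp ht hai hs hN h0i

/-- {x^(α - ε_i) x_{i'}, x_i^(2) x_{j'}} contains x^(α) x_{j'} with factor -α_i = -1. The other
term, if present, has exponent α_j - 1 = -1 in F at j, where binom(-1, 2) = 1, so `map_of_choose`
kills it. -/
theorem KillsBelow.map_of_cast_eq_one {N : ℕ} (hK : KillsBelow p t D N) (hD : IsNormal p t D)
    (hp : 3 < p) (ht : ∀ i, 1 ≤ t i) (hN : 4 ≤ N) {α : Fin n → ℕ} {i j : Fin n}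
    (hα : ∀ i, α i ≤ p ^ t i - 1) (hs : ∑ i, α i + 1 = N) (hij : i ≠ j) (hi : (α i : F) = 1)
    (hj : (α j : F) = 0) : D (mono F (α, {j})) = 0 := by
  have h2F := two_ne_zero_of_char (F := F) hp
  have h1 : 1 ≤ α i := by
    rw [Nat.one_le_iff_ne_zero]
    intro h
    rw [h] at hi
    simp at hi
  have hi1 : α i + 1 ≤ p ^ t i - 1 := by
    refine add_one_le_of_cast_ne (F := F) (ht i) (hα i) fun h => h2F ?_
    rw [hi] at h
    linear_combination h
  obtain ⟨β, rfl⟩ := exists_add_single h1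
  rw [sum_add_single] at hs
  have hb : ∀ l, β l ≤ p ^ t l - 1 := fun l => le_trans (by simp) (hα l)
  have e1 : (Pi.single i 2 - Pi.single i 1 : Fin n → ℕ) = Pi.single i 1 := by
    ext l
    by_cases hl : l = i
    · subst hl; simp
    · simp [hl]
  have l := hK.map_poisson hD.der hb (single_le hp ht i le_rfl) (u := {i}) (v := {j})
    (by simp) (by simp) (by rw [Finset.card_singleton]; omega)
    (by rw [sum_single, Finset.card_singleton]; omega)
  have hextra : D (if β j = 0 then (0 : O F n) else
      (binom (β - Pi.single j 1) (Pi.single i 2) : F) •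
        mono F (β - Pi.single j 1 + Pi.single i 2, {i})) = 0 := by
    split_ifs with h
    · exact map_zero D
    · obtain ⟨γ, rfl⟩ := exists_add_single (show 1 ≤ β j by omega)
      rw [add_tsub_cancel_right, map_smul]
      rw [sum_add_single] at hs
      have hji : j ≠ i := hij.symm
      rw [hK.map_of_choose hD.der hp ht hN hji (α := γ + Pi.single i 2), smul_zero]
      · intro k
        by_cases hk : k = i
        · subst hk; simp [hij] at hi1 ⊢; omega
        · refine le_trans ?_ (hb k)
          simp [hk]
      · rw [sum_add_single]; omega
      · intro hc
        have hg : (γ j : F) = -1 := by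
          simp [hji] at hj
          linear_combination hj
        have := two_mul_choose_two (F := F) (γ j)
        simp only [Pi.add_apply, Pi.single_eq_of_ne hji, add_zero] at hc
        rw [hc, hg] at this
        exact h2F (by linear_combination -this)
  rw [poisson_singleton_singleton, map_sub, hextra, if_neg (by simp), e1, binom_single_right,
    Nat.choose_one_right, zero_sub, map_smul, neg_eq_zero] at l
  refine (smul_eq_zero.1 l).resolve_left ?_
  simp only [Pi.add_apply, Pi.single_eq_same] at hi
  rw [hi]
  exact one_ne_zero

/-- If D does not kill the monomial, `map_of_choose` forces α_i ∈ {0, 1} in F for i ≠ j, and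
`map_of_sub_choose` forces α_j ∈ {0, 3}. The value 3 would give the weight -2 at j, which no
constant field has. The remaining residues are the two preceding lemmas. -/
theorem KillsBelow.map_linear {N : ℕ} (hK : KillsBelow p t D N) (hD : IsNormal p t D)
    (hp : 3 < p) (ht : ∀ i, 1 ≤ t i) (hN : 4 ≤ N) {α : Fin n → ℕ} {j : Fin n}
    (hα : ∀ i, α i ≤ p ^ t i - 1) (hs : ∑ i, α i + 1 = N) : D (mono F (α, {j})) = 0 := by
  by_contra hne
  obtain ⟨r, v, -, hv, hw⟩ := hK.exists_weight hD hp ht hα hs hne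
  have h01 : ∀ i, i ≠ j → (α i : F) = 0 ∨ (α i : F) = 1 := by
    intro i hij
    have hc : ((α i).choose 2 : F) = 0 := by
      by_contra hc
      exact hne (hK.map_of_choose hD.der hp ht hN hij hα hs hc)
    have := two_mul_choose_two (F := F) (α i)
    rw [hc, mul_zero, eq_comm, mul_eq_zero, sub_eq_zero] at this
    exact this
  have hj0 : (α j : F) = 0 := by
    by_contra hj
    have hc : (α j : F) - ((α j).choose 2 : F) = 0 := by
      by_contra hc
      refine hne (hK.map_of_sub_choose hD.der hp ht hN (by simp) (Finset.mem_singleton_self j) hα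
        (by rw [Finset.card_singleton, hs]) (fun h => hj (by rw [h]; simp)) hc)
    have h3 : (α j : F) = 3 := by
      have h := two_mul_choose_two (F := F) (α j)
      refine mul_left_cancel₀ hj ?_
      linear_combination -2 * hc - h
    have h := hw j
    have hbd := wtInt_bounds j v r
    rw [if_pos rfl, h3] at h
    have := int_eq_of_cast_eq (F := F) hp Fact.out (x := wtInt j v r) (y := -2)
      (by rw [h]; push_cast; ring) (by omega) (by omega)
    omega
  by_cases h : ∃ i, i ≠ j ∧ (α i : F) = 1
  · obtain ⟨i, hij, hi⟩ := h
    exact hne (hK.map_of_cast_eq_one hD hp ht hN hα hs hij hi hj0)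
  · push Not at h
    refine hne (hK.map_of_cast_eq_zero hD hp ht hN hα hs fun i => ?_)
    by_cases hij : i = j
    · rw [hij, hj0]
    · exact (h01 i hij).resolve_right (h i hij)

theorem IsNormal.killsBelow (hD : IsNormal p t D) (hp : 3 < p) (ht : ∀ i, 1 ≤ t i) (N : ℕ) :
    KillsBelow p t D N := by
  induction N with
  | zero => intro α u h; omega
  | succ N ih =>
    intro α u h hα hu
    rcases Nat.lt_or_ge ((∑ i, α i) + u.card) N with hlt | hge
    · exact ih α u hlt hα hu
    have hs : ∑ i, α i + u.card = N := by omega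
    by_cases h3 : 3 ≤ u.card
    · exact ih.map_of_three_le_card hD hp ht hu h3 hα hs
    have h1 : u.card = 1 := by
      obtain ⟨q, hq⟩ := hu
      omega
    obtain ⟨j, rfl⟩ := Finset.card_eq_one.1 h1
    rw [Finset.card_singleton] at hs
    rcases Nat.lt_or_ge N 4 with hN | hN
    · have hcases : ∑ i, α i = 0 ∨ ∑ i, α i = 1 ∨ ∑ i, α i = 2 := by omega
      rcases hcases with h0 | h0 | h0
      · rw [eq_zero_of_sum_eq_zero h0]; exact hD.const j
      · obtain ⟨i, rfl⟩ := exists_eq_single h0; exact hD.elem i j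
      · obtain rfl : N = 3 := by omega
        exact ih.map_quadratic hD hp ht hα h0
    · exact ih.map_linear hD hp ht hN hα hs

theorem IsDer.exists_eq_inner_add (hD : IsDer p t D) (hp : 3 < p) (hn : 3 ≤ n)
    (ht : ∀ i, 1 ≤ t i) : ∃ w ∈ evenFields F n, ∃ c : Fin n → ℕ → F,
      ∀ a ∈ oddTrunc F p t, D a = br w (ham a) + adPowSum p t c a := by
  obtain ⟨w, hw, c, h⟩ := hD.exists_normal hp hn ht
  refine ⟨w, hw, c, fun a ha => ?_⟩
  have := eq_zero_of_mono (fun α u hα hu =>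
    h.killsBelow hp ht (∑ i, α i + u.card + 1) α u (Nat.lt_succ_self _) hα hu) ha
  rw [LinearMap.sub_apply, LinearMap.sub_apply, sub_sub, sub_eq_zero] at this
  exact this

/-- An even vector field whose bracket with every even Hamiltonian field is truncated is itself
truncated. -/
theorem mem_trunc_of_br_mem (hp : 3 < p) (hn : 3 ≤ n) (ht : ∀ i, 1 ≤ t i) {w : Idx n → O F n}
    (hw : w ∈ evenFields F n)
    (h : ∀ a ∈ oddTrunc F p t, ∀ r, br w (ham a) r ∈ trunc F p t) (r : Idx n) :
    w r ∈ trunc F p t := by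
  have hpp : p.Prime := Fact.out
  have hkill : ∀ (j : Fin n) (f : Idx n → O F n), (∀ r, f r ∈ trunc F p t) →
      (pdField j ^ p ^ t j) f = 0 := by
    intro j f hf
    ext r : 1
    refine ext_coeff fun ⟨β, v⟩ => ?_
    rw [pdField_pow_apply, coeff_pd_inl_pow, Pi.zero_apply, map_zero]
    by_contra hne
    have := mem_trunc_iff.1 (hf r) _ hne j
    have := Nat.one_le_pow (t j) _ hpp.pos
    simp at *
    omega
  -- The p^(t_j)-th power of ad ∂_j is a derivation and kills both T_H(a) and [w, T_H(a)], these
  -- being truncated. So its value at w commutes with every T_H(a).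
  have hz : ∀ j, (pdField j ^ p ^ t j) w = 0 := by
    intro j
    have hc : ∀ a ∈ oddTrunc F p t, br (ham a) ((pdField j ^ p ^ t j) w) = 0 := by
      intro a ha
      have e := pdField_pow_br p j (t j) hw (ham_mem ha.2)
      rw [hkill j _ (h a ha), hkill j _ (ham_mem_trunc ha.1), map_zero, add_zero] at e
      rw [br_swap, ← e, neg_zero]
    refine eq_zero_of_centralizes hp hn (fun i => ?_) (fun i => hc _ (elem_mem hp ht i i))
      fun u hu => hc _ (mono_mem_oddTrunc (fun _ => Nat.zero_le _) (by rw [hu]; decide))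
    have := hc _ (const_mem i)
    rwa [br_ham_const, neg_eq_zero] at this
  refine mem_trunc_iff.2 fun ⟨α, u⟩ hne j => ?_
  by_contra hc
  have hle : p ^ t j ≤ α j := by
    simp only at hc
    omega
  obtain ⟨β, rfl⟩ := exists_add_single hle
  rw [← coeff_pd_inl_pow, ← pdField_pow_apply, hz] at hne
  simp at hne

end

/-! ### Return to the Lie algebras of operators -/

/-- The coefficients of a vector field, given as an operator. -/
noncomputable def fieldCoeffs : Module.End F (O F n) →ₗ[F] (Idx n → O F n) :=
  LinearMap.pi fun r => LinearMap.applyₗ (mono F (gen r))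

theorem fieldCoeffs_vectorField (f : Idx n → O F n) : fieldCoeffs (vectorField F f) = f :=
  funext fun r => vectorField_gen f r

section

variable {p : ℕ} {t : Fin n → ℕ}

theorem mem_wittPart_zero {E : Module.End F (O F n)} (h : E ∈ wittPart F p t 0) :
    vectorField F (fieldCoeffs E) = E ∧ fieldCoeffs E ∈ evenFields F n ∧
      ∀ r, fieldCoeffs E r ∈ trunc F p t := by
  obtain ⟨f, hf, rfl⟩ := mem_wittPart.1 h
  rw [fieldCoeffs_vectorField]
  exact ⟨rfl, mem_evenFields.2 fun r => by simpa using (hf r).2, fun r => (hf r).1⟩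

theorem vectorField_mem_wittPart {f : Idx n → O F n} (hf : f ∈ evenFields F n)
    (ht : ∀ r, f r ∈ trunc F p t) : vectorField F f ∈ wittPart F p t 0 :=
  mem_wittPart.2 ⟨f, fun r => ⟨ht r, by simpa using mem_evenFields.1 hf r⟩, rfl⟩

variable [Fact p.Prime] [CharP F p]

/-- `T_H` as a map onto `ℋ𝒪`. -/
noncomputable def hamHO (p : ℕ) [Fact p.Prime] [CharP F p] (t : Fin n → ℕ) :
    oddTrunc F p t →ₗ[F] HO F p t where
  toFun a := ⟨⟨vectorField F (ham a.1),
    vectorField_mem_wittPart (ham_mem a.2.2) (ham_mem_trunc a.2.1)⟩,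
    ⟨a.1, a.2.1, TH_eq_vectorField_ham a.2.2⟩⟩
  map_add' a b := Subtype.ext (Subtype.ext (by simp))
  map_smul' c a := Subtype.ext (Subtype.ext (by simp))

theorem coe_hamHO (a : oddTrunc F p t) :
    ((hamHO p t a : W F p t) : Module.End F (O F n)) = vectorField F (ham a.1) := rfl

theorem hamHO_surjective : Function.Surjective (hamHO (F := F) p t) := by
  intro x
  obtain ⟨a, ha, ha1, e⟩ := exists_odd_of_mem x.2 x.1.2
  refine ⟨⟨a, ha, ha1⟩, Subtype.ext (Subtype.ext ?_)⟩
  rw [coe_hamHO, ← TH_eq_vectorField_ham ha1, e]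
  rfl

theorem hamHO_poisson (a b : oddTrunc F p t) :
    hamHO p t ⟨poisson a.1 b.1, poisson_mem a.2 b.2⟩ = ⁅hamHO p t a, hamHO p t b⁆ := by
  refine Subtype.ext (Subtype.ext ?_)
  rw [coe_hamHO, ham_poisson a.2.2 b.2.2, vectorField_br (ham_mem a.2.2) (ham_mem b.2.2)]
  rfl

theorem fieldCoeffs_lie (a : oddTrunc F p t) (x : W F p t) :
    fieldCoeffs (⁅hamHO p t a, x⁆ : W F p t).1 = br (ham a.1) (fieldCoeffs x.1) := by
  obtain ⟨h1, h2, -⟩ := mem_wittPart_zero x.2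
  have e : (⁅hamHO p t a, x⁆ : W F p t).1 = ⁅vectorField F (ham a.1), x.1⁆ := rfl
  rw [e]
  conv_lhs => rw [← h1]
  rw [← vectorField_br (ham_mem a.2.2) h2, fieldCoeffs_vectorField]

theorem coe_ad_pow (i : Fin n) (m : ℕ) (x : W F p t) :
    ((LieAlgebra.ad F (W F p t) (partialW F p t i) ^ m) x).1 =
      (LieAlgebra.ad F (Module.End F (O F n)) (pd F (Sum.inl i)) ^ m) x.1 := by
  induction m generalizing x with
  | zero => rfl
  | succ m ih =>
    rw [pow_succ, Module.End.mul_apply, ih, pow_succ, Module.End.mul_apply]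
    rfl

theorem exists_isDer (D : LieDerivation F (HO F p t) (W F p t)) :
    ∃ E : O F n →ₗ[F] (Idx n → O F n), IsDer p t E ∧
      ∀ a : oddTrunc F p t, E a.1 = fieldCoeffs (D (hamHO p t a)).1 := by
  -- The values of E outside the odd truncated elements are arbitrary; `IsDer` does not involve
  -- them.
  obtain ⟨E, hE⟩ := LinearMap.exists_extend (fieldCoeffs ∘ₗ (W F p t).toSubmodule.subtype ∘ₗ
    (D : HO F p t →ₗ[F] W F p t) ∘ₗ hamHO p t)
  have hE' : ∀ a : oddTrunc F p t, E a.1 = fieldCoeffs (D (hamHO p t a)).1 :=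
    fun a => LinearMap.congr_fun hE a
  refine ⟨E, ⟨fun a ha => ?_, fun a ha b hb => ?_⟩, hE'⟩
  · rw [hE' ⟨a, ha⟩]; exact (mem_wittPart_zero (D _).2).2.1
  · rw [hE' ⟨a, ha⟩, hE' ⟨b, hb⟩, hE' ⟨poisson a b, poisson_mem ha hb⟩,
      hamHO_poisson ⟨a, ha⟩ ⟨b, hb⟩, LieDerivation.apply_lie_eq_sub, ← fieldCoeffs_lie ⟨a, ha⟩,
      ← fieldCoeffs_lie ⟨b, hb⟩, ← map_sub]
    rfl

theorem restrictTo_ad_mem_derSpace (w : W F p t) :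
    restrictTo (HO F p t) (LieAlgebra.ad F (W F p t) w) ∈
      derSpace F (HO F p t) (W F p t) := by
  refine ⟨{ toLinearMap := restrictTo (HO F p t) (LieAlgebra.ad F (W F p t) w)
            leibniz' := fun a b => ?_ }, rfl⟩
  change ⁅w, ⁅(a : W F p t), (b : W F p t)⁆⁆ =
    ⁅(a : W F p t), ⁅w, (b : W F p t)⁆⁆ - ⁅(b : W F p t), ⁅w, (a : W F p t)⁆⁆
  rw [leibniz_lie, ← lie_skew (b : W F p t) ⁅w, (a : W F p t)⁆]
  abel

theorem restrictTo_ad_pow_mem_derSpace (i : Fin n) (k : ℕ) :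
    restrictTo (HO F p t) (LieAlgebra.ad F (W F p t) (partialW F p t i) ^ p ^ k) ∈
      derSpace F (HO F p t) (W F p t) := by
  refine ⟨{ toLinearMap := restrictTo (HO F p t)
              (LieAlgebra.ad F (W F p t) (partialW F p t i) ^ p ^ k)
            leibniz' := fun a b => Subtype.ext ?_ }, rfl⟩
  have e : ∀ x : W F p t, ((LieAlgebra.ad F (W F p t) (partialW F p t i) ^ p ^ k) x).1 =
      ⁅pd F (Sum.inl i) ^ p ^ k, x.1⁆ := fun x => by
    rw [coe_ad_pow, ad_pow_char p]; rfl
  change ((LieAlgebra.ad F (W F p t) (partialW F p t i) ^ p ^ k) ⁅(a : W F p t), (b : W F p t)⁆).1 =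
    ⁅(a : W F p t).1, ((LieAlgebra.ad F (W F p t) (partialW F p t i) ^ p ^ k) b).1⁆ -
    ⁅(b : W F p t).1, ((LieAlgebra.ad F (W F p t) (partialW F p t i) ^ p ^ k) a).1⁆
  rw [e, e, e, LieSubalgebra.coe_bracket, leibniz_lie,
    ← lie_skew (b : W F p t).1 ⁅_, (a : W F p t).1⁆]
  abel

theorem coe_restrictTo_ad_pow (i : Fin n) (m : ℕ) (a : oddTrunc F p t) :
    (restrictTo (HO F p t) (LieAlgebra.ad F (W F p t) (partialW F p t i) ^ m)
      (hamHO p t a)).1 = vectorField F (adPow i m a.1) := by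
  rw [adPow_apply, vectorField_pdField_pow i _ (ham_mem a.2.2)]
  exact coe_ad_pow i m (hamHO p t a : W F p t)

theorem eq_of_fieldCoeffs {D : LieDerivation F (HO F p t) (W F p t)}
    {E : O F n →ₗ[F] (Idx n → O F n)}
    (hED : ∀ a : oddTrunc F p t, E a.1 = fieldCoeffs (D (hamHO p t a)).1)
    {w : Idx n → O F n} (hw : w ∈ evenFields F n) (hwt : ∀ r, w r ∈ trunc F p t)
    {c : Fin n → ℕ → F} (h : ∀ a ∈ oddTrunc F p t, E a = br w (ham a) + adPowSum p t c a) :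
    (D : HO F p t →ₗ[F] W F p t) = (restrictTo (HO F p t) ∘ₗ
        (LieAlgebra.ad F (W F p t) : W F p t →ₗ[F] Module.End F (W F p t)))
        ⟨vectorField F w, vectorField_mem_wittPart hw hwt⟩ +
      ∑ i, ∑ k ∈ Finset.Ico 1 (t i), c i k • restrictTo (HO F p t)
        (LieAlgebra.ad F (W F p t) (partialW F p t i) ^ p ^ k) := by
  refine LinearMap.ext fun x => Subtype.ext ?_
  obtain ⟨a, rfl⟩ := hamHO_surjective x
  have e1 : (D (hamHO p t a)).1 = vectorField F (E a.1) := by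
    rw [hED, (mem_wittPart_zero (D _).2).1]
  refine Eq.trans e1 ?_
  let ι : W F p t →ₗ[F] Module.End F (O F n) := (W F p t).incl
  have hι : ∀ y : W F p t, y.1 = ι y := fun _ => rfl
  have e2 := fun i k => (hι _).symm.trans (coe_restrictTo_ad_pow (F := F) i (p ^ k) a)
  rw [hι]
  simp only [LinearMap.add_apply, LinearMap.sum_apply, LinearMap.smul_apply, map_add, map_sum,
    map_smul, e2]
  rw [h a.1 a.2, map_add, vectorField_br hw (ham_mem a.2.2), adPowSum_apply]
  simp only [map_sum, map_smul]
  rfl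

theorem derSpace_le (hp : 3 < p) (hn : 3 ≤ n) (ht : ∀ i, 1 ≤ t i) :
    derSpace F (HO F p t) (W F p t) ≤ adSpace (HO F p t) ⊔
      Submodule.span F {φ | ∃ (i : Fin n) (k : ℕ), 1 ≤ k ∧ k < t i ∧
        φ = restrictTo (HO F p t)
          (LieAlgebra.ad F (W F p t) (partialW F p t i) ^ p ^ k)} := by
  rintro _ ⟨D, rfl⟩
  obtain ⟨E, hE, hED⟩ := exists_isDer D
  obtain ⟨w, hw, c, h⟩ := hE.exists_eq_inner_add hp hn ht
  have hsum : ∀ a ∈ oddTrunc F p t, ∀ r, adPowSum p t c a r ∈ trunc F p t := by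
    intro a ha r
    rw [adPowSum_apply, Finset.sum_apply]
    refine sum_mem fun i _ => ?_
    rw [Finset.sum_apply]
    exact sum_mem fun k _ => Submodule.smul_mem _ _
      (pdField_pow_mem_trunc i _ (ham_mem_trunc ha.1) r)
  -- The derivation and the powers of ad ∂_i both take truncated values on `HO`, hence so does the
  -- bracket with w, and w itself lies in `W`.
  have hwt := mem_trunc_of_br_mem hp hn ht hw fun a ha r => by
    have e : br w (ham a) = E a - adPowSum p t c a := by rw [h a ha, add_sub_cancel_right]
    rw [e, hED ⟨a, ha⟩]
    exact sub_mem ((mem_wittPart_zero (D _).2).2.2 r) (hsum a ha r)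
  change (D : HO F p t →ₗ[F] W F p t) ∈ _
  rw [eq_of_fieldCoeffs hED hw hwt h]
  refine Submodule.add_mem_sup (LinearMap.mem_range_self _ _) (sum_mem fun i _ =>
    sum_mem fun k hk => Submodule.smul_mem _ _ (Submodule.subset_span ?_))
  rw [Finset.mem_Ico] at hk
  exact ⟨i, k, hk.1, hk.2, rfl⟩

theorem le_derSpace : adSpace (HO F p t) ⊔
      Submodule.span F {φ | ∃ (i : Fin n) (k : ℕ), 1 ≤ k ∧ k < t i ∧
        φ = restrictTo (HO F p t)
          (LieAlgebra.ad F (W F p t) (partialW F p t i) ^ p ^ k)} ≤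
    derSpace F (HO F p t) (W F p t) := by
  refine sup_le ?_ (Submodule.span_le.2 ?_)
  · rintro _ ⟨w, rfl⟩
    exact restrictTo_ad_mem_derSpace w
  · rintro _ ⟨i, k, -, -, rfl⟩
    exact restrictTo_ad_pow_mem_derSpace i k

end

end OddHamiltonian

theorem mainTheorem2 {F : Type*} [Field F] (p : ℕ) [Fact p.Prime] [CharP F p] (hp : 3 < p)
    (n : ℕ) (hn : 3 ≤ n) (t : Fin n → ℕ) (ht : ∀ i, 1 ≤ t i) :
    OddHamiltonian.derSpace F (OddHamiltonian.HO F p t) (OddHamiltonian.W F p t) =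
      OddHamiltonian.adSpace (OddHamiltonian.HO F p t) ⊔
      Submodule.span F {φ | ∃ (i : Fin n) (k : ℕ), 1 ≤ k ∧ k < t i ∧
        φ = OddHamiltonian.restrictTo (OddHamiltonian.HO F p t)
          (LieAlgebra.ad F (OddHamiltonian.W F p t) (OddHamiltonian.partialW F p t i) ^ p ^ k)} := by
  exact le_antisymm (OddHamiltonian.derSpace_le hp hn ht) OddHamiltonian.le_derSpace
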